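/- Let $X$ be a complex Banach space, $A:D(A)\subset X\to X$ a closed linear operator, and $G\subset\mathbb C$ open. For a closed operator $B$ in $X$ and $\nu\ge 0$ let $\mathrm{Exp}_{B,\nu}(X)$ be the space of $v\in\bigcap_k D(B^k)$ with $\|B^kv\|\le C\nu^k\|v\|$ for all $k\ge1$ ($C$ independent of $k$), with norm $\sup_{k\ge0}\nu^{-k}\|B^kv\|$. An element of $\mathrm{Exp}_{A,G}(X)$ is a finite sum $v=\sum_i v_i$ with $v_i\in \mathrm{Exp}_{A-a_iI,\nu_i}(X)$, $a_i\in G$, $\nu_i<\mathrm{dist}(a_i,\partial G)$. For $g$ analytic on $G$, $g(A)v=\sum_i g_{a_i}(A)v_i$ with $g_{a}(A)w=\sum_{n\ge0}\frac{g^{(n)}(a)}{n!}(A-aI)^nw$. Since the value may depend on the representation of $v$ (when $G$ has holes), elements and vector-functions are taken together with their representations: for each choice of finitely many $a_i,\nu_i$ as above we work in the space $E=\prod_i \mathrm{Exp}_{A-a_iI,\nu_i}(X)$, whose elements $(v_i)$ represent $\sum_i v_i$, and on which $g(A)$ acts componentwise. Let $m\ge1$ be an integer, $\mu\in(m-1,m]$,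 $\lambda$ a finite Borel measure on $[0,m-1]$, and $f:[0,m-1]\times G\to\mathbb C$ (jointly) continuous, and analytic in the second variable. Let $D_*^\alpha$ denote the Caputo–Djrbashian derivative with lower terminal $0$, put $$L[u](t)=D_*^\mu u(t)+\int_{[0,m-1]}f(\alpha,A)D_*^\alpha u(t)\,\lambda(d\alpha),\qquad \Delta(s,z)=s^\mu+\int_{[0,m-1]}f(\alpha,z)s^\alpha\,\lambda(d\alpha),$$ and $$c_\beta(t,z)=\mathcal L^{-1}\Big[\frac{s^\beta}{\Delta(s,z)}\Big](t),\qquad S_k(t,z)=c_{\mu-k-1}(t,z)+\int_{(k,m-1]}f(\alpha,z)c_{\alpha-k-1}(t,z)\,\lambda(d\alpha),\quad k=0,\dots,m-1,$$ where $\mathcal L^{-1}[F]$ is the continuous function on $[0,\infty)$ whose Laplace transform converges absolutely and equals $F(s)$ for all large real $s$. A solution of $L[u]=0$ (for $t>0$), $u^{(j)}(0)=\varphi_j$ ($j=0,\dots,m-1$) is a function $u\in C^m((0,\infty);E)\cap C^{m-1}([0,\infty);E)$ for which the integrals in $D_*^\mu u(t)$, $D_*^\alpha u(t)$ ($\alpha\in[0,m-1]$)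 and $L[u](t)$ converge for $t>0$, and which satisfies the equation and the initial conditions in $E$. Then: 1. For all $z\in G$ and $\beta\le\mu-1$ the inverse Laplace transform $c_\beta(\cdot,z)$ exists; for $0\le k\le m-1$ and $t\ge0$ the integral in $S_k(t,z)$ converges for $z\in G$, and $S_k(t,\cdot)$ is analytic on $G$. 2. For $0\le k\le m-1$ and $\varphi_k\in E$, $u_k(t)=S_k(t,A)\varphi_k$ solves $$L[u]=0,\qquad u^{(j)}(0)=\delta_{jk}\varphi_k,\quad j=0,\dots,m-1 .$$ 3. For $\varphi_0,\dots,\varphi_{m-1}\in E$, the solution of $$L[u]=0,\qquad u^{(j)}(0)=\varphi_j,\quad j=0,\dots,m-1,$$ is $u(t)=\sum_{k=0}^{m-1}S_k(t,A)\varphi_k$; that is, this $u$ is a solution, and every solution (with values in $E$) equals it for $t\ge0$. -/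

import Mathlib

open Set MeasureTheory
open scoped NNReal ENNReal

noncomputable section

namespace FracCauchy

section Operators

variable {X : Type*} [NormedAddCommGroup X] [NormedSpace ℂ X]

/-- The operator `A - a I`, with the domain of `A`. -/
def shift (A : X →ₗ.[ℂ] X) (a : ℂ) : X →ₗ.[ℂ] X where
  domain := A.domain
  toFun := A.toFun - a • A.domain.subtype

open Classical in
/-- The action `v ↦ A v`, extended by `0` outside the domain of `A` (the extension is only
used at vectors of the domain). -/
def act (A : X →ₗ.[ℂ] X) (v : X) : X :=
  if h : v ∈ A.domain then A ⟨v, h⟩ else 0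

/-- `v ∈ ⋂ₖ D(A ^ k)`: all iterates `v, A v, A² v, …` exist. -/
def InAllPowers (A : X →ₗ.[ℂ] X) (v : X) : Prop :=
  ∀ k : ℕ, (act A)^[k] v ∈ A.domain

theorem act_add (A : X →ₗ.[ℂ] X) {v w : X} (hv : v ∈ A.domain) (hw : w ∈ A.domain) :
    act A (v + w) = act A v + act A w := by
  have h := A.map_add ⟨v, hv⟩ ⟨w, hw⟩
  simp only [act, dif_pos hv, dif_pos hw, dif_pos (A.domain.add_mem hv hw)]
  exact h

theorem act_smul (A : X →ₗ.[ℂ] X) (c : ℂ) {v : X} (hv : v ∈ A.domain) :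
    act A (c • v) = c • act A v := by
  have h := A.map_smul c ⟨v, hv⟩
  simp only [act, dif_pos hv, dif_pos (A.domain.smul_mem c hv)]
  exact h

theorem act_zero (A : X →ₗ.[ℂ] X) : act A 0 = 0 := by
  have h := act_smul A 0 (v := 0) A.domain.zero_mem
  simpa using h

theorem iter_zero (A : X →ₗ.[ℂ] X) (k : ℕ) : (act A)^[k] 0 = 0 :=
  Function.iterate_fixed (act_zero A) k

theorem iter_add (A : X →ₗ.[ℂ] X) {v w : X} (hv : InAllPowers A v) (hw : InAllPowers A w)
    (k : ℕ) : (act A)^[k] (v + w) = (act A)^[k] v + (act A)^[k] w := by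
  induction k with
  | zero => rfl
  | succ k ih =>
    simp only [Function.iterate_succ_apply', ih]
    exact act_add A (hv k) (hw k)

theorem iter_smul (A : X →ₗ.[ℂ] X) (c : ℂ) {v : X} (hv : InAllPowers A v)
    (k : ℕ) : (act A)^[k] (c • v) = c • (act A)^[k] v := by
  induction k with
  | zero => rfl
  | succ k ih =>
    simp only [Function.iterate_succ_apply', ih]
    exact act_smul A c (hv k)

/-- `v` is a vector of exponential type `ν` for `A`: `v ∈ ⋂ₖ D(A ^ k)` and
`‖A ^ k v‖ ≤ C ν ^ k ‖v‖` for all `k ≥ 1`, with `C` independent of `k`. -/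
def IsExpType (A : X →ₗ.[ℂ] X) (ν : ℝ≥0) (v : X) : Prop :=
  InAllPowers A v ∧
    ∃ C : ℝ, ∀ k : ℕ, 1 ≤ k → ‖(act A)^[k] v‖ ≤ C * (ν : ℝ) ^ k * ‖v‖

theorem IsExpType.bound {A : X →ₗ.[ℂ] X} {ν : ℝ≥0} {v : X} (hv : IsExpType A ν v) :
    ∃ M : ℝ, 0 ≤ M ∧ ∀ k : ℕ, ‖(act A)^[k] v‖ ≤ M * (ν : ℝ) ^ k := by
  obtain ⟨C, hC⟩ := hv.2
  refine ⟨(1 + |C|) * ‖v‖, by positivity, fun k => ?_⟩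
  rcases Nat.eq_zero_or_pos k with rfl | hk
  · simpa using le_mul_of_one_le_left (norm_nonneg v) (by linarith [abs_nonneg C])
  · refine (hC k hk).trans ?_
    have h1 : 0 ≤ (ν : ℝ) ^ k * ‖v‖ := by positivity
    nlinarith [le_abs_self C]

theorem isExpType_of_bound {A : X →ₗ.[ℂ] X} {ν : ℝ≥0} {v : X} (h0 : InAllPowers A v)
    {M : ℝ} (h : ∀ k : ℕ, ‖(act A)^[k] v‖ ≤ M * (ν : ℝ) ^ k) : IsExpType A ν v := by
  refine ⟨h0, ?_⟩
  by_cases hv : v = 0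
  · exact ⟨0, fun k _ => by simp [hv, iter_zero]⟩
  · refine ⟨M / ‖v‖, fun k _ => (h k).trans (le_of_eq ?_)⟩
    have : ‖v‖ ≠ 0 := norm_ne_zero_iff.mpr hv
    field_simp

/-- The linear space of vectors of exponential type `ν` for `A`. -/
def expSubmodule (A : X →ₗ.[ℂ] X) (ν : ℝ≥0) : Submodule ℂ X where
  carrier := {v | IsExpType A ν v}
  zero_mem' := ⟨fun k => by rw [iter_zero]; exact A.domain.zero_mem,
    0, fun k _ => by simp [iter_zero]⟩
  add_mem' := by
    intro v w hv hw
    obtain ⟨M, -, hM⟩ := hv.bound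
    obtain ⟨N, -, hN⟩ := hw.bound
    refine isExpType_of_bound (M := M + N) (fun k => ?_) (fun k => ?_)
    · rw [iter_add A hv.1 hw.1]
      exact A.domain.add_mem (hv.1 k) (hw.1 k)
    · rw [iter_add A hv.1 hw.1, add_mul]
      exact (norm_add_le _ _).trans (add_le_add (hM k) (hN k))
  smul_mem' := by
    intro c v hv
    obtain ⟨M, -, hM⟩ := hv.bound
    refine isExpType_of_bound (M := ‖c‖ * M) (fun k => ?_) (fun k => ?_)
    · rw [iter_smul A c hv.1]
      exact A.domain.smul_mem c (hv.1 k)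
    · rw [iter_smul A c hv.1, norm_smul, mul_assoc]
      exact mul_le_mul_of_nonneg_left (hM k) (norm_nonneg c)

/-- The space `Exp_{A, ν}(X)` of vectors of exponential type `ν`, as a type of its own: it does
not carry the norm of `X`, but the norm `sup_k ‖A ^ k v‖ / ν ^ k` below. -/
def ExpSpace (A : X →ₗ.[ℂ] X) (ν : ℝ≥0) : Type _ := ↥(expSubmodule A ν)

instance (A : X →ₗ.[ℂ] X) (ν : ℝ≥0) : AddCommGroup (ExpSpace A ν) :=
  inferInstanceAs (AddCommGroup ↥(expSubmodule A ν))

instance (A : X →ₗ.[ℂ] X) (ν : ℝ≥0) : Module ℂ (ExpSpace A ν) :=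
  inferInstanceAs (Module ℂ ↥(expSubmodule A ν))

/-- The underlying vector of `X`. -/
def ExpSpace.val {A : X →ₗ.[ℂ] X} {ν : ℝ≥0} (v : ExpSpace A ν) : X :=
  Subtype.val (p := fun x => x ∈ expSubmodule A ν) v

theorem ExpSpace.isExpType {A : X →ₗ.[ℂ] X} {ν : ℝ≥0} (v : ExpSpace A ν) :
    IsExpType A ν v.val :=
  Subtype.property (p := fun x => x ∈ expSubmodule A ν) v

/-- The norm `sup_k ‖A ^ k v‖ / ν ^ k` (the term `k = 0` is `‖v‖`; for `ν = 0` the terms with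
`k ≥ 1` vanish). -/
instance (A : X →ₗ.[ℂ] X) (ν : ℝ≥0) : Norm (ExpSpace A ν) :=
  ⟨fun v => ⨆ k : ℕ, ‖(act A)^[k] v.val‖ / (ν : ℝ) ^ k⟩

theorem ExpSpace.norm_def {A : X →ₗ.[ℂ] X} {ν : ℝ≥0} (v : ExpSpace A ν) :
    ‖v‖ = ⨆ k : ℕ, ‖(act A)^[k] v.val‖ / (ν : ℝ) ^ k := rfl

theorem ExpSpace.bddAbove {A : X →ₗ.[ℂ] X} {ν : ℝ≥0} (v : ExpSpace A ν) :
    BddAbove (range fun k : ℕ => ‖(act A)^[k] v.val‖ / (ν : ℝ) ^ k) := by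
  obtain ⟨M, hM0, hM⟩ := v.isExpType.bound
  refine ⟨M, ?_⟩
  rintro _ ⟨k, rfl⟩
  exact div_le_of_le_mul₀ (by positivity) hM0 (hM k)

theorem ExpSpace.normCore (A : X →ₗ.[ℂ] X) (ν : ℝ≥0) : NormedSpace.Core ℂ (ExpSpace A ν) where
  norm_nonneg v := Real.iSup_nonneg fun k => by positivity
  norm_smul c v := by
    simp only [ExpSpace.norm_def]
    rw [Real.mul_iSup_of_nonneg (norm_nonneg c)]
    congr 1
    funext k
    have h : (act A)^[k] (c • v).val = c • (act A)^[k] v.val := iter_smul A c v.isExpType.1 k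
    rw [h, norm_smul, mul_div_assoc]
  norm_triangle v w := by
    simp only [ExpSpace.norm_def]
    refine ciSup_le fun k => ?_
    have h : (act A)^[k] (v + w).val = (act A)^[k] v.val + (act A)^[k] w.val :=
      iter_add A v.isExpType.1 w.isExpType.1 k
    rw [h]
    refine le_trans ?_ (add_le_add (le_ciSup v.bddAbove k) (le_ciSup w.bddAbove k))
    rw [← add_div]
    exact div_le_div_of_nonneg_right (norm_add_le _ _) (by positivity)
  norm_eq_zero_iff v := by
    constructor
    · intro h
      have h0 : ‖v.val‖ ≤ 0 := by
        have := le_ciSup v.bddAbove 0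
        rw [← ExpSpace.norm_def, h] at this
        simpa using this
      exact Subtype.ext (norm_le_zero_iff.mp h0)
    · rintro rfl
      have h : ∀ k : ℕ, (act A)^[k] (ExpSpace.val (0 : ExpSpace A ν)) = 0 := iter_zero A
      simp [ExpSpace.norm_def, h]

instance (A : X →ₗ.[ℂ] X) (ν : ℝ≥0) : NormedAddCommGroup (ExpSpace A ν) :=
  NormedAddCommGroup.ofCore (ExpSpace.normCore A ν)

instance (A : X →ₗ.[ℂ] X) (ν : ℝ≥0) : NormedSpace ℂ (ExpSpace A ν) :=
  NormedSpace.ofCore (ExpSpace.normCore A ν)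

theorem IsExpType.act {A : X →ₗ.[ℂ] X} {ν : ℝ≥0} {v : X} (hv : IsExpType A ν v) :
    IsExpType A ν (act A v) := by
  obtain ⟨M, -, hM⟩ := hv.bound
  refine isExpType_of_bound (M := M * ν) (fun k => ?_) (fun k => ?_)
  · rw [← Function.iterate_succ_apply]
    exact hv.1 (k + 1)
  · rw [← Function.iterate_succ_apply, mul_assoc, ← pow_succ']
    exact hM (k + 1)

/-- The operator `A` restricted to `Exp_{A, ν}(X)`. -/
def restr (A : X →ₗ.[ℂ] X) (ν : ℝ≥0) : ExpSpace A ν →ₗ[ℂ] ExpSpace A ν where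
  toFun v := ⟨act A v.val, v.isExpType.act⟩
  map_add' v w := Subtype.ext (act_add A (v.isExpType.1 0) (w.isExpType.1 0))
  map_smul' c v := Subtype.ext (act_smul A c (v.isExpType.1 0))

/-- `g_a(A) v = ∑ₙ g⁽ⁿ⁾(a) / n! (A - a I)ⁿ v` for `v ∈ Exp_{A - a I, ν}(X)`. -/
def localCalc (A : X →ₗ.[ℂ] X) (a : ℂ) (ν : ℝ≥0) (g : ℂ → ℂ)
    (v : ExpSpace (shift A a) ν) : ExpSpace (shift A a) ν :=
  ∑' n : ℕ, (iteratedDeriv n g a / (n.factorial : ℂ)) • ((restr (shift A a) ν) ^ n) v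

/-- Finite families `(v_i)` with `v_i ∈ Exp_{A - a_i I, ν_i}(X)`. When `a_i ∈ G` and
`ν_i < dist(a_i, ∂G)`, such a family represents the element `v = ∑ v_i` of `Exp_{A, G}(X)`, and
every element of `Exp_{A, G}(X)` has such representations. The sup norm over `i` of the norms of
the `Exp_{A - a_i I, ν_i}(X)` makes the map `(v_i) ↦ ∑ v_i ∈ X` continuous. -/
abbrev ExpFamily {ι : Type*} (A : X →ₗ.[ℂ] X) (a : ι → ℂ) (ν : ι → ℝ≥0) : Type _ :=
  ∀ i, ExpSpace (shift A (a i)) (ν i)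

/-- The operator `g(A)` with symbol `g`: `g(A) ∑ v_i = ∑ g_{a_i}(A) v_i`. -/
def opCalc {ι : Type*} (A : X →ₗ.[ℂ] X) (a : ι → ℂ) (ν : ι → ℝ≥0) (g : ℂ → ℂ)
    (v : ExpFamily A a ν) : ExpFamily A a ν :=
  fun i => localCalc A (a i) (ν i) g (v i)

end Operators

section Caputo

variable {E : Type*} [NormedAddCommGroup E] [NormedSpace ℂ E]

/-- The integrand of the Caputo derivative of order `α`, `n - 1 < α < n`, `n = ⌈α⌉`. -/
def caputoIntegrand (α : ℝ) (g : ℝ → E) (t τ : ℝ) : E :=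
  ((t - τ) ^ ((⌈α⌉₊ : ℝ) - α - 1)) • iteratedDeriv ⌈α⌉₊ g τ

open Classical in
/-- The Caputo-Djrbashian derivative of order `α ≥ 0` at `t > 0` (with lower terminal `0`). -/
def caputo (α : ℝ) (g : ℝ → E) (t : ℝ) : E :=
  if (⌈α⌉₊ : ℝ) = α then iteratedDeriv ⌈α⌉₊ g t
  else (1 / Real.Gamma ((⌈α⌉₊ : ℝ) - α)) • ∫ τ in (0 : ℝ)..t, caputoIntegrand α g t τ

/-- The integral in the Caputo derivative (if any) converges. -/
def CaputoConverges (α : ℝ) (g : ℝ → E) (t : ℝ) : Prop :=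
  (⌈α⌉₊ : ℝ) ≠ α → IntervalIntegrable (caputoIntegrand α g t) volume 0 t

/-- `u` solves `D_*^μ u(t) + ∫_{[0, m-1]} B(α) D_*^α u(t) λ(dα) = 0` for `t > 0`, with
`u⁽ʲ⁾(0) = φ_j` for `j = 0, …, m - 1`, in the class `C^m(0, ∞) ∩ C^{m-1}[0, ∞)`. Only the values
of `u` on `[0, ∞)` matter. -/
structure IsSolution (m : ℕ) (μ : ℝ) (lam : Measure ℝ) (B : ℝ → E → E) (φ : Fin m → E)
    (u : ℝ → E) : Prop where
  contDiffOn_pos : ContDiffOn ℝ m u (Ioi 0)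
  contDiffOn_nonneg : ContDiffOn ℝ ((m - 1 : ℕ) : WithTop ℕ∞) u (Ici 0)
  caputo_top : ∀ t : ℝ, 0 < t → CaputoConverges μ u t
  caputo_low : ∀ t : ℝ, 0 < t → ∀ α ∈ Icc (0 : ℝ) ((m : ℝ) - 1), CaputoConverges α u t
  integrable : ∀ t : ℝ, 0 < t →
    IntegrableOn (fun α => B α (caputo α u t)) (Icc 0 ((m : ℝ) - 1)) lam
  equation : ∀ t : ℝ, 0 < t →
    caputo μ u t + ∫ α in Icc 0 ((m : ℝ) - 1), B α (caputo α u t) ∂lam = 0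
  initial : ∀ j : Fin m, iteratedDerivWithin j u (Ici 0) 0 = φ j

end Caputo

section Laplace

/-- `g` is the inverse Laplace transform of `F`: it is continuous on `[0, ∞)` and, for all large
real `s`, its Laplace integral converges absolutely and equals `F s`. Such a `g` is unique on
`[0, ∞)`. -/
def IsInverseLaplace (F : ℝ → ℂ) (g : ℝ → ℂ) : Prop :=
  ContinuousOn g (Ici 0) ∧ ∃ s₀ : ℝ, 0 ≤ s₀ ∧ ∀ s : ℝ, s₀ < s →
    IntegrableOn (fun t : ℝ => (Real.exp (-(s * t)) : ℂ) * g t) (Ioi 0) ∧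
    ∫ t in Ioi (0 : ℝ), (Real.exp (-(s * t)) : ℂ) * g t = F s

open Classical in
/-- The inverse Laplace transform of `F` (the zero function if there is none). -/
def inverseLaplace (F : ℝ → ℂ) : ℝ → ℂ :=
  if h : ∃ g, IsInverseLaplace F g then h.choose else 0

variable (m : ℕ) (μ : ℝ) (lam : Measure ℝ) (f : ℝ → ℂ → ℂ)

/-- `Δ(s, z) = s^μ + ∫_{[0, m-1]} f(α, z) s^α λ(dα)`. -/
def charFn (s : ℝ) (z : ℂ) : ℂ :=
  ((s ^ μ : ℝ) : ℂ) + ∫ α in Icc 0 ((m : ℝ) - 1), f α z * ((s ^ α : ℝ) : ℂ) ∂lam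

/-- `s^β / Δ(s, z)` as a function of `s`. -/
def cTransform (β : ℝ) (z : ℂ) (s : ℝ) : ℂ :=
  ((s ^ β : ℝ) : ℂ) / charFn m μ lam f s z

/-- `c_β(t, z) = L⁻¹[s^β / Δ(s, z)](t)`. -/
def cFn (β t : ℝ) (z : ℂ) : ℂ :=
  inverseLaplace (cTransform m μ lam f β z) t

/-- `S_k(t, z) = c_{μ-k-1}(t, z) + ∫_{(k, m-1]} f(α, z) c_{α-k-1}(t, z) λ(dα)`. The interval is
open at `k`: the Laplace transform of `D_*^k u` does not involve `u⁽ᵏ⁾(0)`. -/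
def solFn (k : ℕ) (t : ℝ) (z : ℂ) : ℂ :=
  cFn m μ lam f (μ - k - 1) t z +
    ∫ α in Ioc (k : ℝ) ((m : ℝ) - 1), f α z * cFn m μ lam f (α - k - 1) t z ∂lam

end Laplace

end FracCauchy

end

noncomputable section

namespace FracCauchy

/-! Write `h_γ(t) = t ^ (γ - 1) / Γ(γ)`. Differentiation lowers the order `γ` by one and fractional
integration of order `a` raises it by `a`. For fixed `t`, all kernels of order at least `γ` form one
vector `δ ↦ exp (σ δ) h_{γ+δ}(t)` in the bounded continuous functions on `[0, ∞)` (`kernelFamily`),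
and raising the order by `η` is translation by `η` with the factor `exp (-σ η)`. Seek `u(t) = t ^ k
/ k! φ - ℓ(h_{μ+1}(t))` with a functional `ℓ` independent of time. The equation becomes `(1 + C) x =
data`, where `C` averages `exp (-σ (μ - α)) f(α, A)` composed with translation by `μ - α`. Since `μ
- α ≥ μ - m + 1 > 0`, a large `σ` makes `C` a contraction, and one Neumann series gives a solution
for all times (`isSolution_solution`).

For scalar symbols, the Laplace transform of the kernels is an exponential in `δ`, hence an
eigenvector of every translation: `1 + C` multiplies it by `Δ(S, z) S ^ (-μ)`. This produces `c_β`
from the same Neumann series (`isInverseLaplace_resolventKernel`); inverse transforms are unique by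
Lerch's theorem, and `S_k(t, z)` is identified with the solution with datum `1`
(`solFn_eq_solution`).

The passage from symbols to operators uses a universal model. Near `a`, the scaled Taylor
coefficients of `f(α, ·)` lie in `ℓ¹`, where multiplication by `(z - a) / r` is the shift. Solve the
problem once for the shift with datum `e₀`. The maps `b ↦ ∑ bₙ R ^ n y` intertwine the shift with
any contraction `R` and therefore carry this solution to the one for `R` (`seqCalc_solutionSeq`).
With `R = (z - a) / r` the `ℓ¹` solution turns out to be the Taylor sequence of `S_k(t, ·)`, which
gives analyticity; with `R = (A - a I) / r` it gives `S_k(t, A) φ`.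

Uniqueness (`IsSolution.eq_zero`) is a weighted-norm estimate: with zero data, `u⁽ᵐ⁻¹⁾` is the
fractional integral of order `μ - m + 1` of `D_*^μ u`, and in the norm weighted by `exp (-s t)` this
integral gains the factor `s ^ (-(μ - m + 1))`. -/

open Filter Topology BoundedContinuousFunction

/-! ### Riemann-Liouville kernels: bounds, derivatives, convolutions, Laplace transforms -/

/-- The Riemann-Liouville kernel `t ^ (γ - 1) / Γ(γ)` for `t > 0`, extended by zero. -/
def rlKernel (γ t : ℝ) : ℝ := if 0 < t then t ^ (γ - 1) / Real.Gamma γ else 0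

theorem rlKernel_of_pos (γ : ℝ) {t : ℝ} (ht : 0 < t) :
    rlKernel γ t = t ^ (γ - 1) / Real.Gamma γ := if_pos ht

theorem rlKernel_of_nonpos (γ : ℝ) {t : ℝ} (ht : t ≤ 0) : rlKernel γ t = 0 :=
  if_neg ht.not_gt

theorem rlKernel_nonneg {γ : ℝ} (hγ : 0 < γ) (t : ℝ) : 0 ≤ rlKernel γ t := by
  unfold rlKernel
  split_ifs with h
  · exact div_nonneg (Real.rpow_nonneg h.le _) (Real.Gamma_pos_of_pos hγ).le
  · exact le_rfl

theorem rlKernel_pos {γ t : ℝ} (hγ : 0 < γ) (ht : 0 < t) : 0 < rlKernel γ t := by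
  rw [rlKernel_of_pos γ ht]
  exact div_pos (Real.rpow_pos_of_pos ht _) (Real.Gamma_pos_of_pos hγ)

theorem measurable_rlKernel (γ : ℝ) : Measurable (rlKernel γ) := by
  unfold rlKernel
  exact Measurable.ite measurableSet_Ioi ((measurable_id.pow_const _).div_const _)
    measurable_const

theorem rlKernel_one {t : ℝ} (ht : 0 < t) : rlKernel 1 t = 1 := by
  simp [rlKernel_of_pos 1 ht]

theorem rlKernel_nat_succ (k : ℕ) {t : ℝ} (ht : 0 < t) :
    rlKernel (k + 1) t = t ^ k / (k.factorial : ℝ) := by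
  rw [rlKernel_of_pos _ ht, Real.Gamma_nat_eq_factorial, add_sub_cancel_right, Real.rpow_natCast]

/-- `Real.Gamma` is `0` at the poles and division by `0` gives `0`, which agrees with the zeros of
the entire function `1 / Γ`. This matches the vanishing derivatives of `t ^ k / k!` beyond its
degree. -/
theorem rlKernel_neg_nat (k : ℕ) (t : ℝ) : rlKernel (-k) t = 0 := by
  unfold rlKernel
  simp [Real.Gamma_neg_nat_eq_zero]

theorem rlKernel_scale (γ : ℝ) {x T : ℝ} (hx : 0 < x) (hT : 0 < T) :
    rlKernel γ x = (x / T) ^ (γ - 1) * rlKernel γ T := by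
  rw [rlKernel_of_pos γ hx, rlKernel_of_pos γ hT, Real.div_rpow hx.le hT.le]
  have : T ^ (γ - 1) ≠ 0 := (Real.rpow_pos_of_pos hT _).ne'
  field_simp

/-- Keep only the tail `y > x` of the Gamma integral and bound `y ^ (γ - 1)` below by `x ^ (γ - 1)`
there. -/
theorem rpow_le_exp_mul_Gamma {γ x : ℝ} (hγ : 1 ≤ γ) (hx : 0 < x) :
    x ^ (γ - 1) ≤ Real.exp x * Real.Gamma γ := by
  have hγ0 : 0 < γ := by linarith
  have hI := Real.GammaIntegral_convergent hγ0
  have h1 : ∫ y in Ioi x, Real.exp (-y) * x ^ (γ - 1) ≤ Real.Gamma γ := by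
    rw [Real.Gamma_eq_integral hγ0]
    calc ∫ y in Ioi x, Real.exp (-y) * x ^ (γ - 1)
        ≤ ∫ y in Ioi x, Real.exp (-y) * y ^ (γ - 1) := by
          refine setIntegral_mono_on ?_ (hI.mono_set (Ioi_subset_Ioi hx.le)) measurableSet_Ioi ?_
          · exact (integrableOn_exp_neg_Ioi x).mul_const _
          · intro y hy
            have hy' : x < y := hy
            gcongr
      _ ≤ ∫ y in Ioi 0, Real.exp (-y) * y ^ (γ - 1) := by
          refine setIntegral_mono_set hI ?_ (Ioi_subset_Ioi hx.le).eventuallyLE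
          filter_upwards [ae_restrict_mem measurableSet_Ioi] with y hy
          exact mul_nonneg (Real.exp_pos _).le (Real.rpow_nonneg (le_of_lt hy) _)
  rw [integral_mul_const, integral_exp_neg_Ioi] at h1
  calc x ^ (γ - 1) = Real.exp x * (Real.exp (-x) * x ^ (γ - 1)) := by
        rw [← mul_assoc, ← Real.exp_add]; simp
    _ ≤ _ := by gcongr

/-- The constant is explicit in `γ`, so that with `s = exp σ` the bound absorbs the weight `exp (σ
δ)` for all large orders at once. -/
theorem rlKernel_le {γ s : ℝ} (hγ : 1 ≤ γ) (hs : 0 < s) (t : ℝ) :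
    rlKernel γ t ≤ s ^ (1 - γ) * Real.exp (s * t) := by
  rcases le_or_gt t 0 with ht | ht
  · rw [rlKernel_of_nonpos γ ht]; positivity
  · have hG := Real.Gamma_pos_of_pos (by linarith : 0 < γ)
    rw [rlKernel_of_pos γ ht, div_le_iff₀ hG]
    have h := rpow_le_exp_mul_Gamma hγ (mul_pos hs ht)
    rw [Real.mul_rpow hs.le ht.le] at h
    have h2 : s ^ (1 - γ) * s ^ (γ - 1) = 1 := by
      rw [← Real.rpow_add hs]; simp
    calc t ^ (γ - 1) = s ^ (1 - γ) * (s ^ (γ - 1) * t ^ (γ - 1)) := by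
          rw [← mul_assoc, h2, one_mul]
      _ ≤ s ^ (1 - γ) * (Real.exp (s * t) * Real.Gamma γ) := by gcongr
      _ = _ := by ring

theorem Gamma_inv_eq (γ : ℝ) : (Real.Gamma γ)⁻¹ = γ * (Real.Gamma (γ + 1))⁻¹ := by
  rcases eq_or_ne γ 0 with rfl | h
  · simp [Real.Gamma_zero]
  · rw [Real.Gamma_add_one h, mul_inv, ← mul_assoc, mul_inv_cancel₀ h, one_mul]

theorem continuous_Gamma_inv : Continuous fun γ : ℝ => (Real.Gamma γ)⁻¹ := by
  have h : (fun γ : ℝ => (Real.Gamma γ)⁻¹) = fun γ : ℝ => ((Complex.Gamma γ)⁻¹).re := by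
    funext γ
    rw [Complex.Gamma_ofReal, ← Complex.ofReal_inv, Complex.ofReal_re]
  rw [h]
  exact Complex.continuous_re.comp
    (Complex.differentiable_one_div_Gamma.continuous.comp Complex.continuous_ofReal)

theorem hasDerivAt_rlKernel (γ : ℝ) {t : ℝ} (ht : 0 < t) :
    HasDerivAt (rlKernel (γ + 1)) (rlKernel γ t) t := by
  have h : HasDerivAt (fun x : ℝ => x ^ γ * (Real.Gamma (γ + 1))⁻¹)
      (γ * t ^ (γ - 1) * (Real.Gamma (γ + 1))⁻¹) t :=
    (Real.hasDerivAt_rpow_const (Or.inl ht.ne')).mul_const _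
  have e : rlKernel γ t = γ * t ^ (γ - 1) * (Real.Gamma (γ + 1))⁻¹ := by
    rw [rlKernel_of_pos γ ht, div_eq_mul_inv, Gamma_inv_eq]; ring
  rw [e]
  refine h.congr_of_eventuallyEq ?_
  filter_upwards [lt_mem_nhds ht] with x hx
  rw [rlKernel_of_pos _ hx, add_sub_cancel_right, div_eq_mul_inv]

/-- This is the Beta integral `B(b, a) = Γ(b) Γ(a) / Γ(a + b)`, rescaled to `[0, t]`. -/
theorem integral_rlKernel_mul {a b t : ℝ} (ha : 0 < a) (hb : 0 < b) (ht : 0 < t) :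
    ∫ τ in (0 : ℝ)..t, rlKernel a (t - τ) * rlKernel b τ = rlKernel (a + b) t := by
  have hG := Complex.betaIntegral_scaled (b : ℂ) (a : ℂ) ht
  rw [Complex.betaIntegral_eq_Gamma_mul_div _ _ (by simpa) (by simpa)] at hG
  have h1 : ∫ x in (0 : ℝ)..t, (x : ℂ) ^ ((b : ℂ) - 1) * ((t : ℂ) - x) ^ ((a : ℂ) - 1) =
      ((∫ x in (0 : ℝ)..t, x ^ (b - 1) * (t - x) ^ (a - 1) : ℝ) : ℂ) := by
    rw [← intervalIntegral.integral_ofReal]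
    refine intervalIntegral.integral_congr fun x hx => ?_
    rw [uIcc_of_le ht.le] at hx
    rw [Complex.ofReal_mul, Complex.ofReal_cpow hx.1, Complex.ofReal_cpow (by linarith [hx.2])]
    push_cast
    rfl
  have h2 : (t : ℂ) ^ ((b : ℂ) + a - 1) * (Complex.Gamma b * Complex.Gamma a /
      Complex.Gamma (b + a)) = ((t ^ (b + a - 1) * (Real.Gamma b * Real.Gamma a /
      Real.Gamma (b + a)) : ℝ) : ℂ) := by
    rw [← Complex.ofReal_add, Complex.Gamma_ofReal, Complex.Gamma_ofReal, Complex.Gamma_ofReal]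
    push_cast
    rw [Complex.ofReal_cpow ht.le]
    push_cast
    rfl
  rw [h1, h2] at hG
  have hG' := Complex.ofReal_injective hG
  have hga := (Real.Gamma_pos_of_pos ha).ne'
  have hgb := (Real.Gamma_pos_of_pos hb).ne'
  calc ∫ τ in (0 : ℝ)..t, rlKernel a (t - τ) * rlKernel b τ
      = ∫ τ in (0 : ℝ)..t, (τ ^ (b - 1) * (t - τ) ^ (a - 1)) *
          ((Real.Gamma b)⁻¹ * (Real.Gamma a)⁻¹) := by
        refine intervalIntegral.integral_congr_ae' ?_ ?_
        · have h0 : ∀ᵐ τ : ℝ, τ ≠ t := by simp [ae_iff, measure_singleton]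
          filter_upwards [h0] with τ h0 hτ
          rw [rlKernel_of_pos a (by
            have := lt_of_le_of_ne hτ.2 h0
            linarith), rlKernel_of_pos b hτ.1]
          simp only [div_eq_mul_inv]
          ring
        · exact Eventually.of_forall fun τ hτ => absurd (hτ.1.trans_le hτ.2) ht.not_gt
    _ = rlKernel (a + b) t := by
        rw [intervalIntegral.integral_mul_const, hG', rlKernel_of_pos _ ht, add_comm b a]
        field_simp

theorem intervalIntegrable_rlKernel_mul {a b t : ℝ} (ha : 0 < a) (hb : 0 < b) (ht : 0 < t) :
    IntervalIntegrable (fun τ => rlKernel a (t - τ) * rlKernel b τ) volume 0 t := by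
  -- A non-integrable function has integral `0` by convention, but the computed value is positive.
  by_contra h
  have := intervalIntegral.integral_undef h
  rw [integral_rlKernel_mul ha hb ht] at this
  exact (rlKernel_pos (by linarith) ht).ne' this

theorem integral_exp_mul_rlKernel {γ S : ℝ} (hγ : 0 < γ) (hS : 0 < S) :
    ∫ t in Ioi (0 : ℝ), Real.exp (-(S * t)) * rlKernel γ t = S ^ (-γ) := by
  have h := Real.integral_rpow_mul_exp_neg_mul_Ioi hγ hS
  have hg := (Real.Gamma_pos_of_pos hγ).ne'
  calc ∫ t in Ioi (0 : ℝ), Real.exp (-(S * t)) * rlKernel γ t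
      = ∫ t in Ioi (0 : ℝ), (t ^ (γ - 1) * Real.exp (-(S * t))) * (Real.Gamma γ)⁻¹ := by
        refine setIntegral_congr_fun measurableSet_Ioi fun t ht => ?_
        simp only [rlKernel_of_pos γ ht]
        ring
    _ = S ^ (-γ) := by
        rw [integral_mul_const, h, mul_assoc, mul_inv_cancel₀ hg, mul_one, one_div,
          Real.inv_rpow hS.le, Real.rpow_neg hS.le]

theorem integrableOn_exp_mul_rlKernel {γ S : ℝ} (hγ : 0 < γ) (hS : 0 < S) :
    IntegrableOn (fun t => Real.exp (-(S * t)) * rlKernel γ t) (Ioi 0) := by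
  by_contra h
  have := integral_undef h
  rw [integral_exp_mul_rlKernel hγ hS] at this
  exact (Real.rpow_pos_of_pos hS _).ne' this

theorem intervalIntegrable_rlKernel_sub {γ t : ℝ} (hγ : 0 < γ) (ht : 0 < t) :
    IntervalIntegrable (fun τ => rlKernel γ (t - τ)) volume 0 t := by
  have h := intervalIntegrable_rlKernel_mul hγ one_pos ht
  refine h.congr fun τ hτ => ?_
  rw [uIoc_of_le ht.le] at hτ
  simp [rlKernel_one hτ.1]

theorem intervalIntegrable_rlKernel_mul_exp {γ t : ℝ} (s : ℝ) (hγ : 0 < γ) (ht : 0 < t) :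
    IntervalIntegrable (fun τ => rlKernel γ (t - τ) * Real.exp (s * τ)) volume 0 t :=
  (intervalIntegrable_rlKernel_sub hγ ht).mul_continuousOn (by fun_prop)

/-- Reflect `τ ↦ t - τ` and enlarge the interval to `(0, ∞)`, which leaves the Laplace transform.
The decay of `s ^ (-γ)` drives the uniqueness proof. -/
theorem integral_rlKernel_mul_exp_le {γ s t : ℝ} (hγ : 0 < γ) (hs : 0 < s) (ht : 0 < t) :
    ∫ τ in (0 : ℝ)..t, rlKernel γ (t - τ) * Real.exp (s * τ) ≤
      Real.exp (s * t) * s ^ (-γ) := by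
  have h1 : ∫ τ in (0 : ℝ)..t, rlKernel γ (t - τ) * Real.exp (s * τ) =
      ∫ x in (0 : ℝ)..t, Real.exp (s * t) * (Real.exp (-(s * x)) * rlKernel γ x) := by
    have := intervalIntegral.integral_comp_sub_left (a := 0) (b := t)
      (fun x => Real.exp (s * t) * (Real.exp (-(s * x)) * rlKernel γ x)) t
    rw [sub_self, sub_zero] at this
    rw [← this]
    refine intervalIntegral.integral_congr fun τ _ => ?_
    rw [← mul_assoc, ← Real.exp_add, mul_comm]
    congr 2
    ring
  rw [h1, intervalIntegral.integral_const_mul, intervalIntegral.integral_of_le ht.le,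
    ← integral_exp_mul_rlKernel hγ hs]
  refine mul_le_mul_of_nonneg_left ?_ (Real.exp_pos _).le
  refine setIntegral_mono_set (integrableOn_exp_mul_rlKernel hγ hs) ?_
    Ioc_subset_Ioi_self.eventuallyLE
  exact Eventually.of_forall fun x => mul_nonneg (Real.exp_pos _).le (rlKernel_nonneg hγ x)

/-! ### Kernels of all orders as one curve of bounded continuous functions -/

theorem intervalIntegral_bcf_apply {Y : Type*} [NormedAddCommGroup Y] [NormedSpace ℝ Y]
    [CompleteSpace Y] {f : ℝ → ℝ≥0 →ᵇ Y} {a b : ℝ} (hf : IntervalIntegrable f volume a b)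
    (δ : ℝ≥0) : (∫ x in a..b, f x) δ = ∫ x in a..b, f x δ :=
  ((evalCLM ℝ δ : (ℝ≥0 →ᵇ Y) →L[ℝ] Y).intervalIntegral_comp_comm hf).symm

theorem continuous_exp_mul_rlKernel (σ γ t : ℝ) :
    Continuous fun δ : ℝ => Real.exp (σ * δ) * rlKernel (γ + δ) t := by
  rcases le_or_gt t 0 with ht | ht
  · simp only [rlKernel_of_nonpos _ ht, mul_zero]
    exact continuous_const
  · simp only [rlKernel_of_pos _ ht, div_eq_mul_inv]
    have h1 : Continuous fun δ : ℝ => t ^ (γ + δ - 1) :=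
      continuous_const.rpow (by fun_prop) fun _ => Or.inl ht.ne'
    have h2 : Continuous fun δ : ℝ => (Real.Gamma (γ + δ))⁻¹ :=
      continuous_Gamma_inv.comp (by fun_prop)
    exact (by fun_prop : Continuous fun δ : ℝ => Real.exp (σ * δ)).mul (h1.mul h2)

theorem abs_exp_mul_rlKernel_le (σ : ℝ) {γ δ : ℝ} (h : 1 ≤ γ + δ) (t : ℝ) :
    |Real.exp (σ * δ) * rlKernel (γ + δ) t| ≤
      Real.exp (σ * (1 - γ)) * Real.exp (Real.exp σ * t) := by
  rw [abs_of_nonneg (mul_nonneg (Real.exp_pos _).le (rlKernel_nonneg (by linarith) t))]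
  calc Real.exp (σ * δ) * rlKernel (γ + δ) t
      ≤ Real.exp (σ * δ) * ((Real.exp σ) ^ (1 - (γ + δ)) * Real.exp (Real.exp σ * t)) :=
        mul_le_mul_of_nonneg_left (rlKernel_le h (Real.exp_pos _) t) (Real.exp_pos _).le
    _ = _ := by
        rw [← Real.exp_mul, ← mul_assoc, ← Real.exp_add]
        congr 2
        ring

/-- The order `γ` may be negative. The orders `γ + δ` below `1` correspond to a compact range of
`δ`, where continuity suffices; the uniform exponential bound covers the rest. -/
theorem exists_bound_exp_mul_rlKernel (σ γ t : ℝ) :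
    ∃ C : ℝ, ∀ δ : ℝ≥0, ‖Real.exp (σ * δ) * rlKernel (γ + δ) t‖ ≤ C := by
  obtain ⟨C, hC⟩ := (isCompact_Icc (a := 0) (b := 1 - γ)).exists_bound_of_continuousOn
    (continuous_exp_mul_rlKernel σ γ t).continuousOn
  refine ⟨max C (Real.exp (σ * (1 - γ)) * Real.exp (Real.exp σ * t)), fun δ => ?_⟩
  rcases le_total (δ : ℝ) (1 - γ) with h | h
  · exact (hC δ ⟨δ.2, h⟩).trans (le_max_left _ _)
  · exact (abs_exp_mul_rlKernel_le σ (by linarith) t).trans (le_max_right _ _)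

/-- The family `δ ↦ exp (σ δ) t ^ (γ + δ - 1) / Γ(γ + δ)` of Riemann-Liouville kernels, as a
bounded continuous function of `δ ≥ 0`. -/
def kernelFamily (σ γ t : ℝ) : ℝ≥0 →ᵇ ℝ :=
  BoundedContinuousFunction.ofNormedAddCommGroup
    (fun δ : ℝ≥0 => Real.exp (σ * δ) * rlKernel (γ + δ) t)
    ((continuous_exp_mul_rlKernel σ γ t).comp NNReal.continuous_coe)
    (exists_bound_exp_mul_rlKernel σ γ t).choose
    (exists_bound_exp_mul_rlKernel σ γ t).choose_spec

@[simp]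
theorem kernelFamily_apply (σ γ t : ℝ) (δ : ℝ≥0) :
    kernelFamily σ γ t δ = Real.exp (σ * δ) * rlKernel (γ + δ) t := rfl

theorem kernelFamily_of_nonpos (σ γ : ℝ) {t : ℝ} (ht : t ≤ 0) : kernelFamily σ γ t = 0 := by
  ext δ
  simp [rlKernel_of_nonpos _ ht]

theorem norm_kernelFamily_le {σ γ : ℝ} (hγ : 1 ≤ γ) (t : ℝ) :
    ‖kernelFamily σ γ t‖ ≤ Real.exp (σ * (1 - γ)) * Real.exp (Real.exp σ * t) :=
  (BoundedContinuousFunction.norm_le (by positivity)).2 fun δ =>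
    abs_exp_mul_rlKernel_le σ (by linarith [δ.2]) t

/-- Each kernel is homogeneous. Because `x / T ≤ 1`, the extra factor `(x / T) ^ δ` is at most `1`,
so the estimate is uniform in `δ`. -/
theorem norm_kernelFamily_scale (σ γ : ℝ) {x T : ℝ} (hx : 0 < x) (hxT : x ≤ T) :
    ‖kernelFamily σ γ x‖ ≤ (x / T) ^ (γ - 1) * ‖kernelFamily σ γ T‖ := by
  have hT : 0 < T := hx.trans_le hxT
  have hq : 0 < x / T := div_pos hx hT
  refine (BoundedContinuousFunction.norm_le (by positivity)).2 fun δ => ?_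
  have h1 : kernelFamily σ γ x δ =
      (x / T) ^ (γ - 1) * ((x / T) ^ (δ : ℝ) * kernelFamily σ γ T δ) := by
    simp only [kernelFamily_apply]
    rw [rlKernel_scale _ hx hT, ← mul_assoc ((x / T) ^ (γ - 1)), ← Real.rpow_add hq]
    rw [show γ - 1 + (δ : ℝ) = γ + δ - 1 by ring]
    ring
  rw [h1, norm_mul, Real.norm_of_nonneg (Real.rpow_nonneg hq.le _), norm_mul,
    Real.norm_of_nonneg (Real.rpow_nonneg hq.le _)]
  refine mul_le_mul_of_nonneg_left ?_ (Real.rpow_nonneg hq.le _)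
  calc (x / T) ^ (δ : ℝ) * ‖kernelFamily σ γ T δ‖
      ≤ 1 * ‖kernelFamily σ γ T‖ := mul_le_mul
        (Real.rpow_le_one hq.le ((div_le_one hT).2 hxT) δ.2) (norm_coe_le_norm _ _)
        (norm_nonneg _) zero_le_one
    _ = _ := one_mul _

theorem exists_bound_kernelFamily (σ γ : ℝ) {a T : ℝ} (ha : 0 < a) :
    ∃ C : ℝ, ∀ x ∈ Icc a T, ‖kernelFamily σ γ x‖ ≤ C := by
  have hc : ContinuousOn (fun x : ℝ => (x / T) ^ (γ - 1) * ‖kernelFamily σ γ T‖) (Icc a T) := by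
    refine ContinuousOn.mul ?_ continuousOn_const
    refine ContinuousOn.rpow_const (by fun_prop) fun x hx => Or.inl ?_
    have : 0 < x := ha.trans_le hx.1
    exact (div_pos this (this.trans_le hx.2)).ne'
  obtain ⟨C, hC⟩ := isCompact_Icc.exists_bound_of_continuousOn hc
  exact ⟨C, fun x hx => (norm_kernelFamily_scale σ γ (ha.trans_le hx.1) hx.2).trans
    ((le_abs_self _).trans (hC x hx))⟩

theorem hasDerivAt_kernelFamily_apply (σ γ : ℝ) {t : ℝ} (ht : 0 < t) (δ : ℝ≥0) :
    HasDerivAt (fun t => kernelFamily σ (γ + 1) t δ) (kernelFamily σ γ t δ) t := by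
  simp only [kernelFamily_apply]
  rw [add_right_comm]
  exact (hasDerivAt_rlKernel _ ht).const_mul _

/-- The pointwise derivatives in `t` are the values of the family of order `γ - 1`, which is bounded
on compact subintervals of `(0, ∞)`. Hence the curve is locally Lipschitz in the sup norm. -/
theorem continuousOn_kernelFamily (σ γ : ℝ) : ContinuousOn (kernelFamily σ γ) (Ioi 0) := by
  intro t ht
  have ht : 0 < t := ht
  refine ContinuousAt.continuousWithinAt ?_
  obtain ⟨C, hC⟩ := exists_bound_kernelFamily σ (γ - 1) (a := t / 2) (T := 2 * t) (by positivity)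
  have hL : LipschitzOnWith C.toNNReal (kernelFamily σ γ) (Icc (t / 2) (2 * t)) := by
    refine LipschitzOnWith.of_dist_le_mul fun x hx y hy => ?_
    rw [dist_eq_norm]
    refine (BoundedContinuousFunction.norm_le (by positivity)).2 fun δ => ?_
    have := Convex.norm_image_sub_le_of_norm_hasDerivWithin_le
      (f := fun t => kernelFamily σ γ t δ) (f' := fun t => kernelFamily σ (γ - 1) t δ)
      (s := Icc (t / 2) (2 * t)) (C := C.toNNReal) ?_ ?_ (convex_Icc _ _) hy hx
    · simpa [dist_eq_norm] using this
    · intro z hz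
      have := hasDerivAt_kernelFamily_apply σ (γ - 1) (t := z) (by linarith [hz.1]) δ
      rw [sub_add_cancel] at this
      exact this.hasDerivWithinAt
    · intro z hz
      exact (norm_coe_le_norm _ _).trans ((hC z hz).trans (Real.le_coe_toNNReal _))
  exact hL.continuousOn.continuousAt (Icc_mem_nhds (by linarith) (by linarith))

/-- The fundamental theorem of calculus for each `δ` gives an integral identity between vectors,
whose integrand is continuous in the sup norm; differentiating it gives the derivative in the Banach
space. -/
theorem hasDerivAt_kernelFamily (σ γ : ℝ) {t : ℝ} (ht : 0 < t) :
    HasDerivAt (kernelFamily σ (γ + 1)) (kernelFamily σ γ t) t := by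
  have hsub : ∀ {x : ℝ}, 0 < x → uIcc (t / 2) x ⊆ Ioi 0 := fun hx y hy =>
    (lt_min (half_pos ht) hx).trans_le hy.1
  have hint : ∀ {x : ℝ}, 0 < x → IntervalIntegrable (kernelFamily σ γ) volume (t / 2) x :=
    fun hx => ((continuousOn_kernelFamily σ γ).mono (hsub hx)).intervalIntegrable
  have key : ∀ {x : ℝ}, 0 < x → kernelFamily σ (γ + 1) x =
      kernelFamily σ (γ + 1) (t / 2) + ∫ y in (t / 2)..x, kernelFamily σ γ y := by
    intro x hx
    ext δ
    have h2 : ∫ y in (t / 2)..x, kernelFamily σ γ y δ =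
        kernelFamily σ (γ + 1) x δ - kernelFamily σ (γ + 1) (t / 2) δ := by
      refine intervalIntegral.integral_eq_sub_of_hasDerivAt
        (fun y hy => hasDerivAt_kernelFamily_apply σ γ (hsub hx hy) δ) ?_
      exact (ContinuousOn.intervalIntegrable
        ((evalCLM ℝ δ : (ℝ≥0 →ᵇ ℝ) →L[ℝ] ℝ).continuous.comp_continuousOn
        ((continuousOn_kernelFamily σ γ).mono (hsub hx))))
    rw [BoundedContinuousFunction.add_apply, intervalIntegral_bcf_apply (hint hx), h2]
    ring
  have hc := (continuousOn_kernelFamily σ γ).continuousAt (Ioi_mem_nhds ht)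
  have hd := intervalIntegral.integral_hasDerivAt_right (hint ht)
    ((continuousOn_kernelFamily σ γ).stronglyMeasurableAtFilter isOpen_Ioi t ht) hc
  refine (hd.const_add (kernelFamily σ (γ + 1) (t / 2))).congr_of_eventuallyEq ?_
  filter_upwards [lt_mem_nhds ht] with x hx using key hx

theorem norm_kernelFamily_le_rpow (σ γ : ℝ) {x : ℝ} (hx : |x| ≤ 1) :
    ‖kernelFamily σ γ x‖ ≤ |x| ^ (γ - 1) * ‖kernelFamily σ γ 1‖ := by
  rcases le_or_gt x 0 with h | h
  · rw [kernelFamily_of_nonpos σ γ h, norm_zero]; positivity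
  · rw [abs_of_pos h] at hx ⊢
    simpa using norm_kernelFamily_scale σ γ h hx

/-- At `t = 0` the family of order `γ + 1` is `O(|x| ^ γ)`, which is `o(x)` when `γ > 1`. -/
theorem hasDerivAt_kernelFamily_of_one_lt (σ : ℝ) {γ : ℝ} (hγ : 1 < γ) (t : ℝ) :
    HasDerivAt (kernelFamily σ (γ + 1)) (kernelFamily σ γ t) t := by
  rcases lt_trichotomy t 0 with ht | rfl | ht
  · rw [kernelFamily_of_nonpos σ γ ht.le]
    refine (hasDerivAt_const t (0 : ℝ≥0 →ᵇ ℝ)).congr_of_eventuallyEq ?_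
    filter_upwards [gt_mem_nhds ht] with x hx using kernelFamily_of_nonpos _ _ hx.le
  · rw [kernelFamily_of_nonpos σ γ le_rfl, hasDerivAt_iff_isLittleO]
    simp only [kernelFamily_of_nonpos σ (γ + 1) le_rfl, sub_zero, smul_zero]
    refine Asymptotics.IsBigO.trans_isLittleO (g := fun x : ℝ => |x| ^ γ) ?_ ?_
    · refine Asymptotics.IsBigO.of_bound ‖kernelFamily σ (γ + 1) 1‖ ?_
      filter_upwards [Metric.closedBall_mem_nhds (0 : ℝ) one_pos] with x hx
      rw [mem_closedBall_zero_iff] at hx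
      have := norm_kernelFamily_le_rpow σ (γ + 1) hx
      rw [add_sub_cancel_right] at this
      rw [Real.norm_of_nonneg (by positivity : 0 ≤ |x| ^ γ)]
      linarith
    · rw [Asymptotics.isLittleO_iff]
      intro c hc
      have hcont : ContinuousAt (fun x : ℝ => |x| ^ (γ - 1)) 0 :=
        (continuous_abs.continuousAt).rpow_const (Or.inr (by linarith))
      have h0 : (fun x : ℝ => |x| ^ (γ - 1)) 0 < c := by
        simp [Real.zero_rpow (by linarith : γ - 1 ≠ 0), hc]
      filter_upwards [hcont.eventually_lt continuousAt_const h0] with x hx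
      rw [Real.norm_of_nonneg (by positivity : 0 ≤ |x| ^ γ), Real.norm_eq_abs]
      calc |x| ^ γ = |x| ^ (γ - 1) * |x| := by
            rw [← Real.rpow_add_one' (abs_nonneg x) (by linarith), sub_add_cancel]
        _ ≤ c * |x| := by gcongr
  · exact hasDerivAt_kernelFamily σ γ ht

theorem continuous_kernelFamily (σ : ℝ) {γ : ℝ} (hγ : 1 < γ) :
    Continuous (kernelFamily σ γ) := by
  rw [continuous_iff_continuousAt]
  intro t
  rcases lt_trichotomy t 0 with ht | rfl | ht
  · refine ContinuousAt.congr (continuousAt_const (y := (0 : ℝ≥0 →ᵇ ℝ))) ?_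
    filter_upwards [gt_mem_nhds ht] with x hx using (kernelFamily_of_nonpos _ _ hx.le).symm
  · rw [ContinuousAt, kernelFamily_of_nonpos σ γ le_rfl]
    refine squeeze_zero_norm' (a := fun x : ℝ => |x| ^ (γ - 1) * ‖kernelFamily σ γ 1‖) ?_ ?_
    · filter_upwards [Metric.closedBall_mem_nhds (0 : ℝ) one_pos] with x hx
      exact norm_kernelFamily_le_rpow σ γ (mem_closedBall_zero_iff.1 hx)
    · have hcont : ContinuousAt (fun x : ℝ => |x| ^ (γ - 1) * ‖kernelFamily σ γ 1‖) 0 :=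
        ((continuous_abs.continuousAt).rpow_const (Or.inr (by linarith))).mul continuousAt_const
      simpa [ContinuousAt, Real.zero_rpow (by linarith : γ - 1 ≠ 0)] using hcont
  · exact (continuousOn_kernelFamily σ γ).continuousAt (Ioi_mem_nhds ht)

theorem intervalIntegrable_rlKernel_smul_kernelFamily (σ : ℝ) {a γ t : ℝ} (ha : 0 < a)
    (hγ : 0 < γ) (ht : 0 < t) :
    IntervalIntegrable (fun τ => rlKernel a (t - τ) • kernelFamily σ γ τ) volume 0 t := by
  have h0 := (intervalIntegrable_rlKernel_mul ha hγ ht).const_mul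
    (‖kernelFamily σ γ t‖ * (rlKernel γ t)⁻¹)
  refine h0.mono_fun' ?_ ?_
  · refine AEStronglyMeasurable.smul
      ((measurable_rlKernel a).comp (by fun_prop)).aestronglyMeasurable ?_
    rw [uIoc_of_le ht.le]
    exact ((continuousOn_kernelFamily σ γ).mono Ioc_subset_Ioi_self).aestronglyMeasurable
      measurableSet_Ioc
  · rw [uIoc_of_le ht.le]
    filter_upwards [ae_restrict_mem measurableSet_Ioc] with τ hτ
    have h1 := norm_kernelFamily_scale σ γ hτ.1 hτ.2
    have h2 := rlKernel_scale γ hτ.1 ht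
    have h3 := (rlKernel_pos hγ ht).ne'
    rw [norm_smul, Real.norm_of_nonneg (rlKernel_nonneg ha _)]
    calc rlKernel a (t - τ) * ‖kernelFamily σ γ τ‖
        ≤ rlKernel a (t - τ) * ((τ / t) ^ (γ - 1) * ‖kernelFamily σ γ t‖) :=
          mul_le_mul_of_nonneg_left h1 (rlKernel_nonneg ha _)
      _ = _ := by
          rw [h2]
          field_simp

theorem integral_rlKernel_smul_kernelFamily (σ : ℝ) {a γ t : ℝ} (ha : 0 < a)
    (hγ : 0 < γ) (ht : 0 < t) :
    ∫ τ in (0 : ℝ)..t, rlKernel a (t - τ) • kernelFamily σ γ τ = kernelFamily σ (γ + a) t := by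
  ext δ
  rw [intervalIntegral_bcf_apply (intervalIntegrable_rlKernel_smul_kernelFamily σ ha hγ ht)]
  calc _ = ∫ τ in (0 : ℝ)..t, Real.exp (σ * δ) * (rlKernel a (t - τ) * rlKernel (γ + δ) τ) := by
        refine intervalIntegral.integral_congr fun τ _ => ?_
        change rlKernel a (t - τ) * (Real.exp (σ * δ) * rlKernel (γ + δ) τ) = _
        ring
    _ = _ := by
        rw [intervalIntegral.integral_const_mul,
          integral_rlKernel_mul ha (by have := δ.2; linarith : 0 < γ + (δ : ℝ)) ht,
          kernelFamily_apply]
        congr 2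
        ring

/-- The translation `x ↦ x (· + η)` of bounded continuous functions on `[0, ∞)`. -/
def translate (Y : Type*) [NormedAddCommGroup Y] [NormedSpace ℝ Y] (η : ℝ≥0) :
    (ℝ≥0 →ᵇ Y) →L[ℝ] (ℝ≥0 →ᵇ Y) :=
  BoundedContinuousFunction.compContinuousCLM Y ℝ ⟨fun δ => δ + η, by fun_prop⟩

@[simp]
theorem translate_apply (Y : Type*) [NormedAddCommGroup Y] [NormedSpace ℝ Y] (η : ℝ≥0)
    (x : ℝ≥0 →ᵇ Y) (δ : ℝ≥0) : translate Y η x δ = x (δ + η) := rfl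

/-- The factor `exp (-σ η)` comes from the weight in the family; it is the source of all contraction
estimates for `convOp`. -/
theorem kernelFamily_add (σ γ t : ℝ) (η δ : ℝ≥0) :
    kernelFamily σ (γ + η) t δ = Real.exp (-(σ * η)) * kernelFamily σ γ t (δ + η) := by
  simp only [kernelFamily_apply, NNReal.coe_add]
  rw [← mul_assoc, ← Real.exp_add, add_assoc, add_comm (η : ℝ) δ]
  congr 2
  ring

theorem integrableOn_exp_smul_kernelFamily {σ γ S : ℝ} (hγ : 1 ≤ γ) (hS : Real.exp σ < S) :
    IntegrableOn (fun t => Real.exp (-(S * t)) • kernelFamily σ γ t) (Ioi 0) := by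
  have h0 : IntegrableOn (fun t => Real.exp (σ * (1 - γ)) * Real.exp (-(S - Real.exp σ) * t))
      (Ioi 0) := (integrableOn_exp_mul_Ioi (by linarith) 0).const_mul _
  refine Integrable.mono' h0 ?_ ?_
  · exact (ContinuousOn.smul (f := fun t : ℝ => Real.exp (-(S * t))) (by fun_prop)
      (continuousOn_kernelFamily σ γ)).aestronglyMeasurable measurableSet_Ioi
  · refine Eventually.of_forall fun t => ?_
    rw [norm_smul, Real.norm_of_nonneg (Real.exp_pos _).le]
    calc Real.exp (-(S * t)) * ‖kernelFamily σ γ t‖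
        ≤ Real.exp (-(S * t)) * (Real.exp (σ * (1 - γ)) * Real.exp (Real.exp σ * t)) :=
          mul_le_mul_of_nonneg_left (norm_kernelFamily_le hγ t) (Real.exp_pos _).le
      _ = _ := by
          rw [← Real.exp_add, ← Real.exp_add, ← Real.exp_add]
          congr 1
          ring

/-- The result is an exponential in `δ`, hence an eigenvector of all translations. -/
theorem integral_exp_smul_kernelFamily_apply {σ γ S : ℝ} (hγ : 1 ≤ γ) (hS : Real.exp σ < S)
    (δ : ℝ≥0) :
    (∫ t in Ioi (0 : ℝ), Real.exp (-(S * t)) • kernelFamily σ γ t) δ =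
      S ^ (-γ) * (Real.exp σ / S) ^ (δ : ℝ) := by
  have hS0 : 0 < S := (Real.exp_pos _).trans hS
  refine ((evalCLM ℝ δ : (ℝ≥0 →ᵇ ℝ) →L[ℝ] ℝ).integral_comp_comm
    (integrableOn_exp_smul_kernelFamily hγ hS)).symm.trans ?_
  calc _ = ∫ t in Ioi (0 : ℝ), Real.exp (σ * δ) *
          (Real.exp (-(S * t)) * rlKernel (γ + δ) t) := by
        refine setIntegral_congr_fun measurableSet_Ioi fun t _ => ?_
        change Real.exp (-(S * t)) * (Real.exp (σ * δ) * rlKernel (γ + δ) t) = _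
        ring
    _ = _ := by
        rw [integral_const_mul,
          integral_exp_mul_rlKernel (by have := δ.2; linarith : 0 < γ + (δ : ℝ)) hS0,
          Real.div_rpow (Real.exp_pos _).le hS0.le, ← Real.exp_mul, neg_add, Real.rpow_add hS0,
          Real.rpow_neg hS0.le (δ : ℝ)]
        ring

/-! ### Neumann series and intertwining maps -/

section Resolvent

variable {V W : Type*} [NormedAddCommGroup V] [NormedSpace ℝ V] [CompleteSpace V]
  [NormedAddCommGroup W] [NormedSpace ℝ W] [CompleteSpace W]

/-- The Neumann series `∑ (-C) ^ n` of `(1 + C)⁻¹`. -/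
def neumann (C : V →L[ℝ] V) : V →L[ℝ] V := ∑' n : ℕ, (-C) ^ n

theorem one_add_mul_neumann {C : V →L[ℝ] V} (hC : ‖C‖ < 1) : (1 + C) * neumann C = 1 := by
  have := mul_neg_geom_series (-C) (by rwa [norm_neg])
  rwa [sub_neg_eq_add] at this

theorem neumann_mul_one_add {C : V →L[ℝ] V} (hC : ‖C‖ < 1) : neumann C * (1 + C) = 1 := by
  have := geom_series_mul_neg (-C) (by rwa [norm_neg])
  rwa [sub_neg_eq_add] at this

theorem neumann_apply_add {C : V →L[ℝ] V} (hC : ‖C‖ < 1) (x : V) :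
    neumann C x + C (neumann C x) = x := by
  have := congrArg (fun T : V →L[ℝ] V => T x) (one_add_mul_neumann hC)
  simpa [add_mul] using this

theorem neumann_apply_of_add_eq {C : V →L[ℝ] V} (hC : ‖C‖ < 1) {x y : V} (h : y + C y = x) :
    neumann C x = y := by
  have := congrArg (fun T : V →L[ℝ] V => T y) (neumann_mul_one_add hC)
  rw [← h]
  simpa using this

theorem neumann_intertwine {C : V →L[ℝ] V} {D : W →L[ℝ] W} (hC : ‖C‖ < 1) (hD : ‖D‖ < 1)
    (T : V →L[ℝ] W) (h : ∀ x, T (C x) = D (T x)) (x : V) :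
    T (neumann C x) = neumann D (T x) := by
  refine (neumann_apply_of_add_eq hD ?_).symm
  rw [← h, ← map_add, neumann_apply_add hC]

end Resolvent

/-! ### Averages of weighted translations with operator coefficients -/

section ConvOp

variable {Y : Type*} [NormedAddCommGroup Y] [NormedSpace ℝ Y]

/-- The coefficient `exp (-σ (κ - α)⁺) F(α) x(δ + (κ - α)⁺)` in the operator `convOp`. -/
def convIntegrand (σ : ℝ≥0) (F : ℝ →ᵇ (Y →L[ℝ] Y)) (κ : ℝ) (x : ℝ≥0 →ᵇ Y) (δ : ℝ≥0) (α : ℝ) :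
    Y :=
  Real.exp (-(σ * Real.toNNReal (κ - α))) • F α (x (δ + Real.toNNReal (κ - α)))

theorem continuous_convIntegrand (σ : ℝ≥0) (F : ℝ →ᵇ (Y →L[ℝ] Y)) (κ : ℝ) (x : ℝ≥0 →ᵇ Y) :
    Continuous fun q : ℝ≥0 × ℝ => convIntegrand σ F κ x q.1 q.2 := by
  have h1 : Continuous fun q : ℝ≥0 × ℝ => Real.toNNReal (κ - q.2) :=
    continuous_real_toNNReal.comp (by fun_prop)
  have h2 : Continuous fun q : ℝ≥0 × ℝ => x (q.1 + Real.toNNReal (κ - q.2)) :=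
    x.continuous.comp (continuous_fst.add h1)
  have h3 : Continuous fun q : ℝ≥0 × ℝ => F q.2 := F.continuous.comp continuous_snd
  exact (Real.continuous_exp.comp
    (continuous_const.mul (NNReal.continuous_coe.comp h1)).neg).smul (h3.clm_apply h2)

theorem norm_convIntegrand_le (σ : ℝ≥0) (F : ℝ →ᵇ (Y →L[ℝ] Y)) (κ : ℝ) (x : ℝ≥0 →ᵇ Y)
    (δ : ℝ≥0) (α : ℝ) : ‖convIntegrand σ F κ x δ α‖ ≤
      Real.exp (-(σ * Real.toNNReal (κ - α))) * (‖F‖ * ‖x‖) := by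
  rw [convIntegrand, norm_smul, Real.norm_of_nonneg (Real.exp_pos _).le]
  refine mul_le_mul_of_nonneg_left ?_ (Real.exp_pos _).le
  exact (ContinuousLinearMap.le_opNorm _ _).trans
    (mul_le_mul (F.norm_coe_le_norm _) (x.norm_coe_le_norm _) (norm_nonneg _) (norm_nonneg F))

theorem norm_convIntegrand_le' (σ : ℝ≥0) (F : ℝ →ᵇ (Y →L[ℝ] Y)) (κ : ℝ) (x : ℝ≥0 →ᵇ Y)
    (δ : ℝ≥0) (α : ℝ) : ‖convIntegrand σ F κ x δ α‖ ≤ ‖F‖ * ‖x‖ := by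
  refine (norm_convIntegrand_le σ F κ x δ α).trans
    (mul_le_of_le_one_left (by positivity) (Real.exp_le_one_iff.2 ?_))
  have : (0 : ℝ) ≤ σ * Real.toNNReal (κ - α) := by positivity
  linarith

variable (σ : ℝ≥0) (F : ℝ →ᵇ (Y →L[ℝ] Y)) (ρ : Measure ℝ) [IsFiniteMeasure ρ] (κ : ℝ)

theorem integrable_convIntegrand (x : ℝ≥0 →ᵇ Y) (δ : ℝ≥0) :
    Integrable (convIntegrand σ F κ x δ) ρ :=
  Integrable.of_bound ((continuous_convIntegrand σ F κ x).comp
    (by fun_prop : Continuous fun α : ℝ => (δ, α))).aestronglyMeasurable _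
    (Eventually.of_forall fun α => norm_convIntegrand_le' σ F κ x δ α)

theorem norm_integral_convIntegrand_le (x : ℝ≥0 →ᵇ Y) (δ : ℝ≥0) :
    ‖∫ α, convIntegrand σ F κ x δ α ∂ρ‖ ≤ ‖F‖ * ρ.real univ * ‖x‖ := by
  refine (norm_integral_le_of_norm_le_const (Eventually.of_forall fun α =>
    norm_convIntegrand_le' σ F κ x δ α)).trans (le_of_eq ?_)
  ring

/-- The operator `x ↦ ∫ exp (-σ (κ - α)⁺) F(α) x(· + (κ - α)⁺) ρ(dα)`. -/
def convOp : (ℝ≥0 →ᵇ Y) →L[ℝ] (ℝ≥0 →ᵇ Y) :=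
  LinearMap.mkContinuous
    { toFun := fun x => BoundedContinuousFunction.ofNormedAddCommGroup
        (fun δ => ∫ α, convIntegrand σ F κ x δ α ∂ρ)
        (continuous_of_dominated (bound := fun _ => ‖F‖ * ‖x‖)
          (fun δ => (integrable_convIntegrand σ F ρ κ x δ).aestronglyMeasurable)
          (fun δ => Eventually.of_forall fun α => norm_convIntegrand_le' σ F κ x δ α)
          (integrable_const _)
          (Eventually.of_forall fun α => (continuous_convIntegrand σ F κ x).comp
            (by fun_prop : Continuous fun δ : ℝ≥0 => (δ, α))))
        _ (norm_integral_convIntegrand_le σ F ρ κ x)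
      map_add' := fun x y => by
        ext δ
        simp only [coe_ofNormedAddCommGroup, BoundedContinuousFunction.coe_add, Pi.add_apply]
        rw [← integral_add (integrable_convIntegrand σ F ρ κ x δ)
          (integrable_convIntegrand σ F ρ κ y δ)]
        simp [convIntegrand]
      map_smul' := fun c x => by
        ext δ
        simp only [coe_ofNormedAddCommGroup, BoundedContinuousFunction.coe_smul, RingHom.id_apply]
        rw [← integral_smul]
        refine integral_congr_ae (Eventually.of_forall fun α => ?_)
        simp only [convIntegrand, BoundedContinuousFunction.coe_smul, map_smul]
        rw [smul_comm] }
    (‖F‖ * ρ.real univ)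
    fun x => (BoundedContinuousFunction.norm_le (by positivity)).2
      (norm_integral_convIntegrand_le σ F ρ κ x)

theorem convOp_apply (x : ℝ≥0 →ᵇ Y) (δ : ℝ≥0) :
    convOp σ F ρ κ x δ = ∫ α, convIntegrand σ F κ x δ α ∂ρ := rfl

/-- If `κ - α` is bounded below by a positive number, then `q` can be made small by increasing `σ`.
-/
theorem norm_convOp_le {q : ℝ} (hq : 0 ≤ q)
    (h : ∀ᵐ α ∂ρ, Real.exp (-(σ * Real.toNNReal (κ - α))) ≤ q) :
    ‖convOp σ F ρ κ‖ ≤ q * (‖F‖ * ρ.real univ) := by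
  refine ContinuousLinearMap.opNorm_le_bound _ (by positivity) fun x => ?_
  refine (BoundedContinuousFunction.norm_le (by positivity)).2 fun δ => ?_
  rw [convOp_apply]
  have := norm_integral_le_of_norm_le_const (μ := ρ) (f := convIntegrand σ F κ x δ)
    (C := q * (‖F‖ * ‖x‖)) (by
      filter_upwards [h] with α hα
      exact (norm_convIntegrand_le σ F κ x δ α).trans
        (mul_le_mul_of_nonneg_right hα (by positivity)))
  exact this.trans (le_of_eq (by ring))

theorem translate_convOp (η : ℝ≥0) (x : ℝ≥0 →ᵇ Y) :
    translate Y η (convOp σ F ρ κ x) = convOp σ F ρ κ (translate Y η x) := by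
  ext δ
  rw [translate_apply, convOp_apply, convOp_apply]
  simp only [convIntegrand, translate_apply, add_right_comm]

theorem convOp_intertwine [CompleteSpace Y] {Y' : Type*} [NormedAddCommGroup Y']
    [NormedSpace ℝ Y'] [CompleteSpace Y'] (F' : ℝ →ᵇ (Y' →L[ℝ] Y')) (T : Y →L[ℝ] Y')
    (h : ∀ α y, T (F α y) = F' α (T y)) (x : ℝ≥0 →ᵇ Y) :
    T.compLeftContinuousBounded ℝ≥0 (convOp σ F ρ κ x) =
      convOp σ F' ρ κ (T.compLeftContinuousBounded ℝ≥0 x) := by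
  ext δ
  rw [ContinuousLinearMap.compLeftContinuousBounded_apply, convOp_apply, convOp_apply,
    ← T.integral_comp_comm (integrable_convIntegrand σ F ρ κ x δ)]
  simp only [convIntegrand, map_smul, h, ContinuousLinearMap.compLeftContinuousBounded_apply]

/-- Translations commute with each other and the coefficients commute by `h`; Fubini exchanges the
two averages. -/
theorem convOp_comm [CompleteSpace Y] (ρ' : Measure ℝ) [IsFiniteMeasure ρ'] (κ' : ℝ)
    (h : ∀ α β y, F α (F β y) = F β (F α y)) (x : ℝ≥0 →ᵇ Y) :
    convOp σ F ρ κ (convOp σ F ρ' κ' x) = convOp σ F ρ' κ' (convOp σ F ρ κ x) := by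
  have key : ∀ (ρ₁ ρ₂ : Measure ℝ) [IsFiniteMeasure ρ₁] [IsFiniteMeasure ρ₂] (κ₁ κ₂ : ℝ)
      (δ : ℝ≥0), convOp σ F ρ₁ κ₁ (convOp σ F ρ₂ κ₂ x) δ = ∫ α, ∫ β,
        Real.exp (-(σ * Real.toNNReal (κ₁ - α))) •
          F α (convIntegrand σ F κ₂ x (δ + Real.toNNReal (κ₁ - α)) β) ∂ρ₂ ∂ρ₁ := by
    intro ρ₁ ρ₂ _ _ κ₁ κ₂ δ
    rw [convOp_apply]
    refine integral_congr_ae (Eventually.of_forall fun α => ?_)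
    simp only [convIntegrand]
    rw [convOp_apply, integral_smul]
    congr 1
    exact ((F α).integral_comp_comm (integrable_convIntegrand σ F ρ₂ κ₂ x _)).symm
  ext δ
  rw [key, key, integral_integral_swap]
  · refine integral_congr_ae (Eventually.of_forall fun β => ?_)
    refine integral_congr_ae (Eventually.of_forall fun α => ?_)
    simp only [convIntegrand, map_smul]
    rw [h, smul_comm, add_right_comm]
  · refine Integrable.of_bound (C := ‖F‖ * (‖F‖ * ‖x‖)) (Continuous.aestronglyMeasurable ?_) ?_
    · have h1 : Continuous fun q : ℝ × ℝ => Real.toNNReal (κ - q.1) :=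
        continuous_real_toNNReal.comp (by fun_prop)
      have h2 : Continuous fun q : ℝ × ℝ =>
          convIntegrand σ F κ' x (δ + Real.toNNReal (κ - q.1)) q.2 :=
        (continuous_convIntegrand σ F κ' x).comp
          ((continuous_const.add h1).prodMk continuous_snd)
      exact (Real.continuous_exp.comp
        (continuous_const.mul (NNReal.continuous_coe.comp h1)).neg).smul
        ((F.continuous.comp continuous_fst).clm_apply h2)
    · refine Eventually.of_forall fun q => ?_
      simp only [Function.uncurry]
      rw [norm_smul, Real.norm_of_nonneg (Real.exp_pos _).le]
      refine (mul_le_of_le_one_left (norm_nonneg _) (Real.exp_le_one_iff.2 ?_)).trans ?_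
      · have : (0 : ℝ) ≤ σ * Real.toNNReal (κ - q.1) := by positivity
        linarith
      · exact (ContinuousLinearMap.le_opNorm _ _).trans (mul_le_mul (F.norm_coe_le_norm _)
          (norm_convIntegrand_le' _ _ _ _ _ _) (norm_nonneg _) (norm_nonneg F))

end ConvOp

/-! ### Vector-valued kernel families -/

section Tensor

variable {Y : Type*} [NormedAddCommGroup Y] [NormedSpace ℝ Y]

/-- The map `x ↦ x(·) φ`. -/
def tensor (φ : Y) : (ℝ≥0 →ᵇ ℝ) →L[ℝ] (ℝ≥0 →ᵇ Y) :=
  (ContinuousLinearMap.toSpanSingleton ℝ φ).compLeftContinuousBounded ℝ≥0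

@[simp]
theorem tensor_apply (φ : Y) (x : ℝ≥0 →ᵇ ℝ) (δ : ℝ≥0) : tensor φ x δ = x δ • φ := rfl

theorem kernelFamily_add_eq (σ γ t : ℝ) (η : ℝ≥0) :
    kernelFamily σ (γ + η) t = Real.exp (-(σ * η)) • translate ℝ η (kernelFamily σ γ t) := by
  ext δ
  exact kernelFamily_add σ γ t η δ

theorem tensor_kernelFamily_add (σ γ t : ℝ) (η : ℝ≥0) (φ : Y) :
    tensor φ (kernelFamily σ (γ + η) t) =
      Real.exp (-(σ * η)) • translate Y η (tensor φ (kernelFamily σ γ t)) := by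
  rw [kernelFamily_add_eq, map_smul]
  rfl

end Tensor

/-! ### Towers of derivatives and the derivatives of `t ^ k / k!` -/

section Derivatives

variable {E : Type*} [NormedAddCommGroup E] [NormedSpace ℝ E]

theorem iteratedDerivWithin_eqOn_of_hasDerivWithinAt {s : Set ℝ} (hs : UniqueDiffOn ℝ s)
    {u : ℝ → E} {g : ℕ → ℝ → E} {N : ℕ} (h0 : EqOn u (g 0) s)
    (h : ∀ n < N, ∀ x ∈ s, HasDerivWithinAt (g n) (g (n + 1) x) s x) :
    ∀ n ≤ N, EqOn (iteratedDerivWithin n u s) (g n) s := by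
  intro n hn
  induction n with
  | zero => simpa using h0
  | succ n ih =>
    intro x hx
    rw [iteratedDerivWithin_succ, derivWithin_congr (ih (by omega)) (ih (by omega) hx)]
    exact (h n (by omega) x hx).derivWithin (hs x hx)

theorem contDiffOn_of_hasDerivWithinAt {s : Set ℝ} (hs : UniqueDiffOn ℝ s)
    {u : ℝ → E} {g : ℕ → ℝ → E} {N : ℕ} (h0 : EqOn u (g 0) s)
    (h : ∀ n < N, ∀ x ∈ s, HasDerivWithinAt (g n) (g (n + 1) x) s x)
    (hN : ContinuousOn (g N) s) : ContDiffOn ℝ N u s := by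
  have key := iteratedDerivWithin_eqOn_of_hasDerivWithinAt hs h0 h
  rw [contDiffOn_nat_iff_continuousOn_differentiableOn_deriv hs]
  refine ⟨fun n hn => ?_, fun n hn => ?_⟩
  · refine ContinuousOn.congr ?_ (key n hn)
    rcases hn.eq_or_lt with rfl | hn
    · exact hN
    · exact fun x hx => (h n hn x hx).continuousWithinAt
  · exact DifferentiableOn.congr (fun x hx => (h n hn x hx).differentiableWithinAt)
      (key n hn.le)

/-- The `n`-th derivative of `t ^ k / k!`. -/
def monoDeriv (k n : ℕ) (t : ℝ) : ℝ :=
  if n ≤ k then t ^ (k - n) / ((k - n).factorial : ℝ) else 0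

theorem hasDerivAt_monoDeriv (k n : ℕ) (t : ℝ) :
    HasDerivAt (monoDeriv k n) (monoDeriv k (n + 1) t) t := by
  unfold monoDeriv
  rcases lt_trichotomy n k with h | rfl | h
  · obtain ⟨d, rfl⟩ : ∃ d, k = n + 1 + d := ⟨k - (n + 1), by omega⟩
    simp only [show n ≤ n + 1 + d by omega, show n + 1 ≤ n + 1 + d by omega, if_true,
      show n + 1 + d - n = d + 1 by omega, show n + 1 + d - (n + 1) = d by omega]
    have := (hasDerivAt_pow (d + 1) t).div_const ((d + 1).factorial : ℝ)
    refine this.congr_deriv ?_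
    rw [Nat.factorial_succ, Nat.add_sub_cancel]
    push_cast
    field_simp
  · simpa using hasDerivAt_const t (1 : ℝ)
  · simp only [show ¬ n ≤ k by omega, show ¬ n + 1 ≤ k by omega, if_false]
    exact hasDerivAt_const t (0 : ℝ)

theorem monoDeriv_eq_rlKernel (k n : ℕ) {t : ℝ} (ht : 0 < t) :
    monoDeriv k n t = rlKernel (k + 1 - n) t := by
  unfold monoDeriv
  split_ifs with h
  · rw [← rlKernel_nat_succ _ ht, Nat.cast_sub h]
    congr 1
    ring
  · rw [show ((k : ℝ) + 1 - n) = -((n - (k + 1) : ℕ) : ℝ) by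
      rw [Nat.cast_sub (by omega)]; push_cast; ring, rlKernel_neg_nat]

theorem monoDeriv_zero_right (k n : ℕ) : monoDeriv k n 0 = if n = k then 1 else 0 := by
  unfold monoDeriv
  rcases lt_trichotomy n k with h | rfl | h
  · rw [if_pos h.le, if_neg h.ne, zero_pow (by omega), zero_div]
  · simp
  · rw [if_neg (by omega), if_neg (by omega)]

end Derivatives

/-! ### Caputo derivatives as convolutions with kernels -/

section Caputo

variable {E : Type*} [NormedAddCommGroup E] [NormedSpace ℂ E]

theorem caputoIntegrand_ae_eq {α : ℝ} {u w : ℝ → E} {t : ℝ} (hα : α < (⌈α⌉₊ : ℝ))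
    (hw : ∀ τ ∈ Ioo 0 t, iteratedDeriv ⌈α⌉₊ u τ = w τ) :
    ∀ᵐ τ, τ ∈ Ioc 0 t → caputoIntegrand α u t τ =
      Real.Gamma (⌈α⌉₊ - α) • (rlKernel (⌈α⌉₊ - α) (t - τ) • w τ) := by
  have h0 : ∀ᵐ τ : ℝ, τ ≠ t := by simp [ae_iff, measure_singleton]
  filter_upwards [h0] with τ h0 hτ
  have h1 : τ < t := lt_of_le_of_ne hτ.2 h0
  have hG := (Real.Gamma_pos_of_pos (sub_pos.2 hα)).ne'
  rw [caputoIntegrand, hw τ ⟨hτ.1, h1⟩, rlKernel_of_pos _ (sub_pos.2 h1), smul_smul]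
  congr 1
  field_simp

theorem caputoConverges_iff {α : ℝ} {u w : ℝ → E} {t : ℝ} (ht : 0 < t)
    (hα : α < (⌈α⌉₊ : ℝ)) (hw : ∀ τ ∈ Ioo 0 t, iteratedDeriv ⌈α⌉₊ u τ = w τ) :
    CaputoConverges α u t ↔
      IntervalIntegrable (fun τ => rlKernel (⌈α⌉₊ - α) (t - τ) • w τ) volume 0 t := by
  have h := (ae_restrict_iff' (μ := volume) measurableSet_Ioc).2 (caputoIntegrand_ae_eq hα hw)
  have hG := (Real.Gamma_pos_of_pos (sub_pos.2 hα)).ne'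
  simp only [CaputoConverges, ne_eq, hα.ne', not_false_eq_true, forall_const]
  rw [intervalIntegrable_iff_integrableOn_Ioc_of_le ht.le,
    intervalIntegrable_iff_integrableOn_Ioc_of_le ht.le, IntegrableOn, IntegrableOn,
    integrable_congr h]
  exact integrable_smul_iff hG _

theorem caputo_of_lt {α : ℝ} {u w : ℝ → E} {t : ℝ} (ht : 0 < t)
    (hα : α < (⌈α⌉₊ : ℝ)) (hw : ∀ τ ∈ Ioo 0 t, iteratedDeriv ⌈α⌉₊ u τ = w τ) :
    caputo α u t = ∫ τ in (0 : ℝ)..t, rlKernel (⌈α⌉₊ - α) (t - τ) • w τ := by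
  have hG := (Real.Gamma_pos_of_pos (sub_pos.2 hα)).ne'
  rw [caputo, if_neg hα.ne']
  rw [intervalIntegral.integral_congr_ae (g := fun τ => Real.Gamma (⌈α⌉₊ - α) •
    (rlKernel (⌈α⌉₊ - α) (t - τ) • w τ)), intervalIntegral.integral_smul, smul_smul,
    one_div_mul_cancel hG, one_smul]
  rw [uIoc_of_le ht.le]
  exact caputoIntegrand_ae_eq hα hw

theorem caputo_of_eq {α : ℝ} {u : ℝ → E} {t : ℝ} (hα : (⌈α⌉₊ : ℝ) = α) :
    caputo α u t = iteratedDeriv ⌈α⌉₊ u t := if_pos hα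

end Caputo

/-! ### The functional behind the candidate solution -/

section SolFunctional

variable {Y : Type*} [NormedAddCommGroup Y] [NormedSpace ℝ Y] (σ : ℝ≥0)
  (F : ℝ →ᵇ (Y →L[ℝ] Y)) (lam : Measure ℝ) [IsFiniteMeasure lam] (m : ℕ) (μ : ℝ)
  (k : ℕ)

/-- The operator `x ↦ ∫_{[0, m-1]} exp (-σ (μ - α)) F(α) x(· + μ - α) λ(dα)`. -/
abbrev volterraOp : (ℝ≥0 →ᵇ Y) →L[ℝ] (ℝ≥0 →ᵇ Y) :=
  convOp σ F (lam.restrict (Icc 0 ((m : ℝ) - 1))) μ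

/-- The operator `x ↦ ∫_{[0, k]} exp (-σ (k - α)) F(α) x(· + k - α) λ(dα)`. -/
abbrev dataOp : (ℝ≥0 →ᵇ Y) →L[ℝ] (ℝ≥0 →ᵇ Y) :=
  convOp σ F (lam.restrict (Icc 0 (k : ℝ))) k

/-- The functional which gives the solution `t ^ k / k! φ - solFunctional φ (h (μ + 1) t)` with
the initial datum `u⁽ᵏ⁾(0) = φ`. -/
def solFunctional (φ : Y) : (ℝ≥0 →ᵇ ℝ) →L[ℝ] Y :=
  evalCLM ℝ 0 ∘L neumann (volterraOp σ F lam m μ) ∘L dataOp σ F lam k ∘L tensor φ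

/-- The candidate solution with the initial datum `u⁽ᵏ⁾(0) = φ`. -/
def solution (φ : Y) (t : ℝ) : Y :=
  (t ^ k / (k.factorial : ℝ)) • φ - solFunctional σ F lam m μ k φ (kernelFamily σ (μ + 1) t)

variable {σ F lam m μ k}

theorem solFunctional_apply (φ : Y) (x : ℝ≥0 →ᵇ ℝ) : solFunctional σ F lam m μ k φ x =
    neumann (volterraOp σ F lam m μ) (dataOp σ F lam k (tensor φ x)) 0 := rfl

theorem integral_data_eq (φ : Y) (t : ℝ) :
    dataOp σ F lam k (tensor φ (kernelFamily σ 1 t)) 0 =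
      ∫ α in Icc 0 (k : ℝ), F α (rlKernel (k + 1 - α) t • φ) ∂lam := by
  rw [convOp_apply]
  refine integral_congr_ae ?_
  filter_upwards [ae_restrict_mem measurableSet_Icc] with α hα
  simp only [convIntegrand, zero_add, tensor_apply, kernelFamily_apply,
    Real.coe_toNNReal _ (sub_nonneg.2 hα.2)]
  rw [map_smul, smul_smul, ← mul_assoc, ← Real.exp_add, neg_add_cancel, Real.exp_zero, one_mul,
    map_smul]
  congr 2
  ring

theorem integrable_data (φ : Y) (t : ℝ) :
    IntegrableOn (fun α => F α (rlKernel (k + 1 - α) t • φ)) (Icc 0 (k : ℝ)) lam := by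
  -- The weights `exp (± σ (k - α))` cancel, so any shift would do; `0` is taken.
  refine Integrable.congr (integrable_convIntegrand 0 F (lam.restrict (Icc 0 (k : ℝ))) k
    (tensor φ (kernelFamily (0 : ℝ≥0) 1 t)) 0) ?_
  filter_upwards [ae_restrict_mem measurableSet_Icc] with α hα
  simp only [convIntegrand, zero_add, tensor_apply, kernelFamily_apply,
    Real.coe_toNNReal _ (sub_nonneg.2 hα.2)]
  rw [map_smul, smul_smul, ← mul_assoc, ← Real.exp_add, neg_add_cancel, Real.exp_zero, one_mul,
    map_smul]
  congr 2
  ring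

variable [CompleteSpace Y]

/-- The solution is built only from averages of translations and coefficients, a Neumann series and
evaluation at `0`, and each step respects a map commuting with the coefficients. -/
theorem solution_intertwine {Y' : Type*} [NormedAddCommGroup Y'] [NormedSpace ℝ Y']
    [CompleteSpace Y'] {F' : ℝ →ᵇ (Y' →L[ℝ] Y')} (hC : ‖volterraOp σ F lam m μ‖ < 1)
    (hC' : ‖volterraOp σ F' lam m μ‖ < 1) (T : Y →L[ℝ] Y')
    (h : ∀ α y, T (F α y) = F' α (T y)) (φ : Y) (t : ℝ) :
    T (solution σ F lam m μ k φ t) = solution σ F' lam m μ k (T φ) t := by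
  rw [solution, solution, map_sub, map_smul, solFunctional_apply, solFunctional_apply]
  congr 1
  have h1 := neumann_intertwine hC hC' (T.compLeftContinuousBounded ℝ≥0)
    (convOp_intertwine σ F _ μ F' T h)
  rw [← ContinuousLinearMap.compLeftContinuousBounded_apply, h1,
    convOp_intertwine σ F _ k F' T h]
  congr 3
  ext δ
  simp

theorem neumann_translate (hC : ‖volterraOp σ F lam m μ‖ < 1) (η : ℝ≥0) (x : ℝ≥0 →ᵇ Y) :
    neumann (volterraOp σ F lam m μ) (translate Y η x) =
      translate Y η (neumann (volterraOp σ F lam m μ) x) :=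
  (neumann_intertwine hC hC (translate Y η) (translate_convOp σ F _ μ η) x).symm

/-- Changing the order by `η` only moves the evaluation point from `0` to `η`. Thus a single vector
carries, through its values at `δ = μ - α`, the contributions of all derivatives `D_*^α u`. -/
theorem solFunctional_kernelFamily_add (hC : ‖volterraOp σ F lam m μ‖ < 1) (φ : Y) (γ t : ℝ)
    (η : ℝ≥0) : solFunctional σ F lam m μ k φ (kernelFamily σ (γ + η) t) =
      Real.exp (-(σ * η)) • neumann (volterraOp σ F lam m μ)
        (dataOp σ F lam k (tensor φ (kernelFamily σ γ t))) η := by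
  rw [solFunctional_apply, tensor_kernelFamily_add, map_smul, map_smul, ← translate_convOp,
    neumann_translate hC]
  simp

theorem integrable_solFunctional (hC : ‖volterraOp σ F lam m μ‖ < 1)
    (hμ : (m : ℝ) - 1 < μ) (φ : Y) (t : ℝ) :
    IntegrableOn (fun α => F α (solFunctional σ F lam m μ k φ (kernelFamily σ (μ + 1 - α) t)))
      (Icc 0 ((m : ℝ) - 1)) lam := by
  refine Integrable.congr (integrable_convIntegrand σ F (lam.restrict (Icc 0 ((m : ℝ) - 1))) μ
    (neumann (volterraOp σ F lam m μ) (dataOp σ F lam k (tensor φ (kernelFamily σ 1 t)))) 0) ?_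
  filter_upwards [ae_restrict_mem measurableSet_Icc] with α hα
  have h1 : μ + 1 - α = 1 + Real.toNNReal (μ - α) := by
    rw [Real.coe_toNNReal _ (by linarith [hα.2])]; ring
  rw [h1, solFunctional_kernelFamily_add hC, convIntegrand, map_smul, zero_add]

/-- This is `(1 + C) x = data` evaluated at `δ = 0`, where `x` is the Neumann solution for the
kernels of order `1`. The terms on the left are, up to sign, the non-polynomial parts of `D_*^μ u`
and `D_*^α u`. -/
theorem solFunctional_equation (hC : ‖volterraOp σ F lam m μ‖ < 1)
    (hμ : (m : ℝ) - 1 < μ) (φ : Y) (t : ℝ) :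
    solFunctional σ F lam m μ k φ (kernelFamily σ 1 t) +
      ∫ α in Icc 0 ((m : ℝ) - 1),
        F α (solFunctional σ F lam m μ k φ (kernelFamily σ (μ + 1 - α) t)) ∂lam =
      ∫ α in Icc 0 (k : ℝ), F α (rlKernel (k + 1 - α) t • φ) ∂lam := by
  rw [← integral_data_eq (σ := σ)]
  have h := congrArg (fun x : ℝ≥0 →ᵇ Y => x 0) (neumann_apply_add hC
    (dataOp σ F lam k (tensor φ (kernelFamily σ 1 t))))
  simp only [BoundedContinuousFunction.coe_add, Pi.add_apply] at h
  rw [← h, solFunctional_apply]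
  congr 1
  rw [convOp_apply]
  refine integral_congr_ae ?_
  filter_upwards [ae_restrict_mem measurableSet_Icc] with α hα
  have h1 : μ + 1 - α = 1 + Real.toNNReal (μ - α) := by
    rw [Real.coe_toNNReal _ (by linarith [hα.2])]; ring
  rw [h1, solFunctional_kernelFamily_add hC, convIntegrand, map_smul, zero_add]

end SolFunctional

/-! ### Existence: the candidate solves the equation -/

section Existence

variable {Y : Type*} [NormedAddCommGroup Y] [NormedSpace ℝ Y]

/-- The `n`-th derivative of `solution`. -/
def solutionDeriv (σ : ℝ≥0) (F : ℝ →ᵇ (Y →L[ℝ] Y)) (lam : Measure ℝ) [IsFiniteMeasure lam]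
    (m : ℕ) (μ : ℝ) (k : ℕ) (φ : Y) (n : ℕ) (t : ℝ) : Y :=
  monoDeriv k n t • φ - solFunctional σ F lam m μ k φ (kernelFamily σ (μ + 1 - n) t)

variable {σ : ℝ≥0} {F : ℝ →ᵇ (Y →L[ℝ] Y)} {lam : Measure ℝ} [IsFiniteMeasure lam]
  {m : ℕ} {μ : ℝ} {k : ℕ}

theorem solutionDeriv_zero (φ : Y) (t : ℝ) :
    solutionDeriv σ F lam m μ k φ 0 t = solution σ F lam m μ k φ t := by
  simp [solutionDeriv, solution, monoDeriv]

/-- The new kernel order is `μ - n`. At `t = 0` it must exceed `1`; for `t > 0` any order is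
allowed. -/
theorem hasDerivAt_solutionDeriv (φ : Y) (n : ℕ) {t : ℝ} (h : 0 < t ∨ (n : ℝ) + 1 < μ) :
    HasDerivAt (solutionDeriv σ F lam m μ k φ n) (solutionDeriv σ F lam m μ k φ (n + 1) t) t := by
  have h1 : HasDerivAt (kernelFamily σ (μ + 1 - n)) (kernelFamily σ (μ + 1 - (n + 1 : ℕ)) t) t := by
    rw [show μ + 1 - (n : ℝ) = μ + 1 - (n + 1 : ℕ) + 1 by push_cast; ring]
    rcases h with h | h
    · exact hasDerivAt_kernelFamily _ _ h
    · exact hasDerivAt_kernelFamily_of_one_lt _ (by push_cast; linarith) t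
  exact ((hasDerivAt_monoDeriv k n t).smul_const φ).sub
    ((solFunctional σ F lam m μ k φ).hasFDerivAt.comp_hasDerivAt t h1)

theorem iteratedDeriv_solution (φ : Y) {u : ℝ → Y}
    (hu : EqOn u (solution σ F lam m μ k φ) (Ici 0)) (n : ℕ) {t : ℝ} (ht : 0 < t) :
    iteratedDeriv n u t = solutionDeriv σ F lam m μ k φ n t := by
  rw [← iteratedDerivWithin_of_isOpen isOpen_Ioi (mem_Ioi.2 ht)]
  refine iteratedDerivWithin_eqOn_of_hasDerivWithinAt (N := n) isOpen_Ioi.uniqueDiffOn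
    (fun x hx => ?_) (fun j _ x hx => (hasDerivAt_solutionDeriv φ j (Or.inl hx)).hasDerivWithinAt)
    n le_rfl ht
  rw [hu (mem_Ici_of_Ioi hx), solutionDeriv_zero]

end Existence

section Existence

variable {E : Type*} [NormedAddCommGroup E] [NormedSpace ℂ E] [CompleteSpace E]
  {σ : ℝ≥0} {F : ℝ →ᵇ (E →L[ℝ] E)} {lam : Measure ℝ} [IsFiniteMeasure lam]
  {m : ℕ} {μ : ℝ} {k : ℕ}

/-- Fractional integration of order `⌈α⌉₊ - α` raises the kernel order from `μ + 1 - ⌈α⌉₊` to `μ + 1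
- α`; the former is positive because `⌈α⌉₊ ≤ m < μ + 1`. The polynomial part survives exactly when
`⌈α⌉₊ ≤ k`, that is, when `α ≤ k`. -/
theorem caputo_solution_aux (hμ₁ : (m : ℝ) - 1 < μ) (φ : E)
    {u : ℝ → E} (hu : EqOn u (solution σ F lam m μ k φ) (Ici 0)) {α : ℝ}
    (hn : ⌈α⌉₊ ≤ m) {t : ℝ} (ht : 0 < t) :
    CaputoConverges α u t ∧ caputo α u t = (if α ≤ k then rlKernel (k + 1 - α) t else 0) • φ -
      solFunctional σ F lam m μ k φ (kernelFamily σ (μ + 1 - α) t) := by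
  have hle : α ≤ (⌈α⌉₊ : ℝ) := Nat.le_ceil α
  rcases hle.eq_or_lt with h | h
  · refine ⟨fun h' => absurd h.symm h', ?_⟩
    rw [caputo_of_eq h.symm, iteratedDeriv_solution φ hu _ ht, solutionDeriv,
      monoDeriv_eq_rlKernel _ _ ht, ← h]
    congr 2
    split_ifs with hk
    · rfl
    -- For an integer `α > k` the order `k + 1 - α` is a nonpositive integer, where the kernel is
    -- zero.
    · have hk' : k + 1 ≤ ⌈α⌉₊ := Nat.lt_ceil.2 (not_le.1 hk)
      rw [show ((k : ℝ) + 1 - α) = -((⌈α⌉₊ - (k + 1) : ℕ) : ℝ) by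
        rw [Nat.cast_sub hk', ← h]; push_cast; ring, rlKernel_neg_nat]
  · have hw : ∀ τ ∈ Ioo 0 t, iteratedDeriv ⌈α⌉₊ u τ = solutionDeriv σ F lam m μ k φ ⌈α⌉₊ τ :=
      fun τ hτ => iteratedDeriv_solution φ hu _ hτ.1
    rw [caputoConverges_iff ht h hw, caputo_of_lt ht h hw]
    have hn' : (⌈α⌉₊ : ℝ) ≤ m := by exact_mod_cast hn
    have ha : 0 < (⌈α⌉₊ : ℝ) - α := sub_pos.2 h
    have hγ : 0 < μ + 1 - (⌈α⌉₊ : ℝ) := by linarith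
    have hI1 : IntervalIntegrable
        (fun τ => rlKernel (⌈α⌉₊ - α) (t - τ) * monoDeriv k ⌈α⌉₊ τ) volume 0 t :=
      (intervalIntegrable_rlKernel_sub ha ht).mul_continuousOn
        fun τ _ => (hasDerivAt_monoDeriv k _ τ).continuousAt.continuousWithinAt
    have hI2 := intervalIntegrable_rlKernel_smul_kernelFamily σ ha hγ ht
    have hI2' := (solFunctional σ F lam m μ k φ).integrable_comp hI2.1
    have hI2'' : IntervalIntegrable (fun τ => solFunctional σ F lam m μ k φ
        (rlKernel (⌈α⌉₊ - α) (t - τ) • kernelFamily σ (μ + 1 - ⌈α⌉₊) τ)) volume 0 t :=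
      (intervalIntegrable_iff_integrableOn_Ioc_of_le ht.le).2 hI2'
    have e : (fun τ => rlKernel (⌈α⌉₊ - α) (t - τ) • solutionDeriv σ F lam m μ k φ ⌈α⌉₊ τ) =
        fun τ => (rlKernel (⌈α⌉₊ - α) (t - τ) * monoDeriv k ⌈α⌉₊ τ) • φ -
          solFunctional σ F lam m μ k φ
            (rlKernel (⌈α⌉₊ - α) (t - τ) • kernelFamily σ (μ + 1 - ⌈α⌉₊) τ) := by
      funext τ
      rw [solutionDeriv, smul_sub, smul_smul, map_smul]
    have hI1' : IntervalIntegrable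
        (fun τ => (rlKernel (⌈α⌉₊ - α) (t - τ) * monoDeriv k ⌈α⌉₊ τ) • φ) volume 0 t :=
      ⟨hI1.1.smul_const φ, hI1.2.smul_const φ⟩
    rw [e]
    refine ⟨hI1'.sub hI2'', ?_⟩
    rw [intervalIntegral.integral_sub hI1' hI2'', intervalIntegral.integral_smul_const,
      (solFunctional σ F lam m μ k φ).intervalIntegral_comp_comm hI2,
      integral_rlKernel_smul_kernelFamily σ ha hγ ht]
    congr 1
    · congr 1
      by_cases hk : α ≤ k
      · rw [if_pos hk]
        have hk' : ⌈α⌉₊ ≤ k := Nat.ceil_le.2 hk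
        have hk'' : (⌈α⌉₊ : ℝ) ≤ k := by exact_mod_cast hk'
        rw [show (k : ℝ) + 1 - α = (⌈α⌉₊ - α) + (k + 1 - ⌈α⌉₊) by ring,
          ← integral_rlKernel_mul ha (by linarith) ht]
        refine intervalIntegral.integral_congr_ae (Eventually.of_forall fun τ hτ => ?_)
        rw [uIoc_of_le ht.le] at hτ
        rw [monoDeriv_eq_rlKernel _ _ hτ.1]
      · rw [if_neg hk]
        have hk' : ¬ ⌈α⌉₊ ≤ k := fun h => hk (Nat.ceil_le.1 h)
        simp [monoDeriv, hk']
    · rw [show μ + 1 - (⌈α⌉₊ : ℝ) + (⌈α⌉₊ - α) = μ + 1 - α by ring]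

theorem isSolution_solution (hμ₁ : (m : ℝ) - 1 < μ) (hμ₂ : μ ≤ m) {k : Fin m}
    (hC : ‖volterraOp σ F lam m μ‖ < 1) {B : ℝ → E → E}
    (hB : ∀ α ∈ Icc (0 : ℝ) ((m : ℝ) - 1), ∀ y, B α y = F α y) (φ : E) {u : ℝ → E}
    (hu : EqOn u (solution σ F lam m μ k φ) (Ici 0)) :
    IsSolution m μ lam B (Pi.single k φ) u := by
  have hm : 1 ≤ m := by have := k.2; omega
  have hm1 : ((m - 1 : ℕ) : ℝ) = (m : ℝ) - 1 := by rw [Nat.cast_sub hm, Nat.cast_one]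
  have hm1' : (1 : ℝ) ≤ m := by exact_mod_cast hm
  have hkm : (k : ℝ) ≤ (m : ℝ) - 1 := by
    rw [← hm1]; exact_mod_cast (show (k : ℕ) ≤ m - 1 by have := k.2; omega)
  have hlow : ∀ α ∈ Icc (0 : ℝ) ((m : ℝ) - 1), ⌈α⌉₊ ≤ m := fun α hα =>
    Nat.ceil_le.2 (by linarith [hα.2])
  have hlow' := fun (t : ℝ) (ht : 0 < t) (α : ℝ) (hα : α ∈ Icc (0 : ℝ) ((m : ℝ) - 1)) =>
    caputo_solution_aux hμ₁ φ hu (hlow α hα) ht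
  have htop := fun (t : ℝ) (ht : 0 < t) =>
    caputo_solution_aux hμ₁ φ hu (Nat.ceil_le.2 hμ₂) ht
  have hu0 : EqOn u (solutionDeriv σ F lam m μ k φ 0) (Ici 0) := fun x hx => by
    rw [hu hx, solutionDeriv_zero]
  have hder : ∀ n < m - 1, ∀ x ∈ Ici (0 : ℝ), HasDerivWithinAt (solutionDeriv σ F lam m μ k φ n)
      (solutionDeriv σ F lam m μ k φ (n + 1) x) (Ici 0) x := by
    intro n hn x _
    have : ((n + 1 : ℕ) : ℝ) ≤ (m - 1 : ℕ) := by exact_mod_cast hn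
    refine (hasDerivAt_solutionDeriv φ n (Or.inr ?_)).hasDerivWithinAt
    rw [hm1] at this
    push_cast at this
    linarith
  have hint := fun t : ℝ => integrable_solFunctional (k := k) hC hμ₁ φ t
  have hsub : Icc (0 : ℝ) k ⊆ Icc 0 ((m : ℝ) - 1) := Icc_subset_Icc_right hkm
  have e1 : ∀ t : ℝ, 0 < t → ∀ α ∈ Icc (0 : ℝ) ((m : ℝ) - 1), B α (caputo α u t) =
      (Icc (0 : ℝ) k).indicator (fun α => F α (rlKernel (k + 1 - α) t • φ)) α -
      F α (solFunctional σ F lam m μ k φ (kernelFamily σ (μ + 1 - α) t)) := by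
    intro t ht α hα
    rw [hB α hα, (hlow' t ht α hα).2, map_sub]
    congr 1
    by_cases hk : α ≤ k
    · rw [if_pos hk, indicator_of_mem (show α ∈ Icc (0 : ℝ) k from ⟨hα.1, hk⟩)]
    · rw [if_neg hk, indicator_of_notMem (fun h => hk h.2), zero_smul, map_zero]
  have hind : ∀ t : ℝ, IntegrableOn ((Icc (0 : ℝ) k).indicator
      (fun α => F α (rlKernel (k + 1 - α) t • φ))) (Icc 0 ((m : ℝ) - 1)) lam := fun t =>
    ((integrable_indicator_iff measurableSet_Icc).2 (integrable_data φ t)).integrableOn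
  refine ⟨?_, ?_, fun t ht => (htop t ht).1, fun t ht α hα => (hlow' t ht α hα).1, ?_, ?_, ?_⟩
  · refine contDiffOn_of_hasDerivWithinAt isOpen_Ioi.uniqueDiffOn (hu0.mono Ioi_subset_Ici_self)
      (fun n _ x hx => (hasDerivAt_solutionDeriv φ n (Or.inl hx)).hasDerivWithinAt) ?_
    exact fun x hx => (hasDerivAt_solutionDeriv φ m (Or.inl hx)).continuousAt.continuousWithinAt
  · refine contDiffOn_of_hasDerivWithinAt (uniqueDiffOn_Ici 0) hu0 hder ?_
    have h1 : Continuous (solutionDeriv σ F lam m μ k φ (m - 1)) := by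
      have h2 : Continuous (monoDeriv k (m - 1)) :=
        continuous_iff_continuousAt.2 fun x => (hasDerivAt_monoDeriv _ _ x).continuousAt
      have h3 : Continuous (kernelFamily σ (μ + 1 - (m - 1 : ℕ))) :=
        continuous_kernelFamily _ (by rw [hm1]; linarith)
      exact (h2.smul continuous_const).sub ((solFunctional σ F lam m μ k φ).continuous.comp h3)
    exact h1.continuousOn
  · intro t ht
    refine IntegrableOn.congr_fun ((hind t).sub (hint t)) ?_ measurableSet_Icc
    exact fun α hα => (e1 t ht α hα).symm
  · intro t ht
    -- The polynomial part is absent from `D_*^μ u` since `k ≤ m - 1 < μ`.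
    rw [(htop t ht).2, if_neg (by linarith), zero_smul, zero_sub,
      setIntegral_congr_fun measurableSet_Icc (e1 t ht), integral_sub (hind t) (hint t),
      setIntegral_indicator measurableSet_Icc, inter_eq_right.2 hsub,
      ← solFunctional_equation hC hμ₁ φ t, show μ + 1 - μ = 1 by ring]
    abel
  · intro j
    rw [iteratedDerivWithin_eqOn_of_hasDerivWithinAt (uniqueDiffOn_Ici 0) hu0 hder j
      (by have := j.2; omega) (mem_Ici.2 le_rfl), solutionDeriv, kernelFamily_of_nonpos _ _ le_rfl,
      map_zero, sub_zero, monoDeriv_zero_right]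
    by_cases hjk : j = k
    · subst hjk; simp
    · rw [Pi.single_eq_of_ne hjk, if_neg (fun h => hjk (Fin.ext h)), zero_smul]

end Existence

/-! ### Linear combinations of solutions -/

section Linear

variable {E : Type*} [NormedAddCommGroup E] [NormedSpace ℂ E]

theorem caputo_add_smul {m : ℕ} {α : ℝ} (hα : ⌈α⌉₊ ≤ m) {u v : ℝ → E}
    (hu : ContDiffOn ℝ m u (Ioi 0)) (hv : ContDiffOn ℝ m v (Ioi 0)) (c : ℝ) {t : ℝ} (ht : 0 < t)
    (hu' : CaputoConverges α u t) (hv' : CaputoConverges α v t) :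
    CaputoConverges α (fun t => u t + c • v t) t ∧
      caputo α (fun t => u t + c • v t) t = caputo α u t + c • caputo α v t := by
  have hd : ∀ τ, 0 < τ → iteratedDeriv ⌈α⌉₊ (fun t => u t + c • v t) τ =
      iteratedDeriv ⌈α⌉₊ u τ + c • iteratedDeriv ⌈α⌉₊ v τ := by
    intro τ hτ
    have h1 : ContDiffAt ℝ ⌈α⌉₊ u τ :=
      (hu.contDiffAt (Ioi_mem_nhds hτ)).of_le (by exact_mod_cast hα)
    have h2 : ContDiffAt ℝ ⌈α⌉₊ v τ :=
      (hv.contDiffAt (Ioi_mem_nhds hτ)).of_le (by exact_mod_cast hα)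
    rw [iteratedDeriv_fun_add h1 (h2.const_smul c), iteratedDeriv_fun_const_smul h2 c]
  rcases (Nat.le_ceil α).eq_or_lt with h | h
  · refine ⟨fun h' => absurd h.symm h', ?_⟩
    rw [caputo_of_eq h.symm, caputo_of_eq h.symm, caputo_of_eq h.symm, hd t ht]
  · have hw := fun τ (hτ : τ ∈ Ioo 0 t) => hd τ hτ.1
    rw [caputoConverges_iff ht h (w := iteratedDeriv ⌈α⌉₊ u) fun _ _ => rfl] at hu'
    rw [caputoConverges_iff ht h (w := iteratedDeriv ⌈α⌉₊ v) fun _ _ => rfl] at hv'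
    rw [caputoConverges_iff ht h hw, caputo_of_lt ht h hw,
      caputo_of_lt ht h (w := iteratedDeriv ⌈α⌉₊ u) fun _ _ => rfl,
      caputo_of_lt ht h (w := iteratedDeriv ⌈α⌉₊ v) fun _ _ => rfl]
    have e : (fun τ => rlKernel (⌈α⌉₊ - α) (t - τ) •
        (iteratedDeriv ⌈α⌉₊ u τ + c • iteratedDeriv ⌈α⌉₊ v τ)) = fun τ =>
        rlKernel (⌈α⌉₊ - α) (t - τ) • iteratedDeriv ⌈α⌉₊ u τ +
          c • (rlKernel (⌈α⌉₊ - α) (t - τ) • iteratedDeriv ⌈α⌉₊ v τ) := by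
      funext τ
      rw [smul_add, smul_comm]
    have hv'' := hv'.smul c
    rw [e]
    refine ⟨hu'.add hv'', ?_⟩
    rw [← intervalIntegral.integral_smul]
    exact intervalIntegral.integral_add hu' hv''

theorem IsSolution.add_smul {m : ℕ} {μ : ℝ} (hμ₂ : μ ≤ m)
    {lam : Measure ℝ} {B : ℝ → E → E} {F : ℝ → E →L[ℝ] E}
    (hB : ∀ α ∈ Icc (0 : ℝ) ((m : ℝ) - 1), ∀ y, B α y = F α y) {φ ψ : Fin m → E}
    {u v : ℝ → E} (hu : IsSolution m μ lam B φ u) (hv : IsSolution m μ lam B ψ v) (c : ℝ) :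
    IsSolution m μ lam B (φ + c • ψ) (fun t => u t + c • v t) := by
  have htop := fun (t : ℝ) (ht : 0 < t) => caputo_add_smul (Nat.ceil_le.2 hμ₂)
    hu.contDiffOn_pos hv.contDiffOn_pos c ht (hu.caputo_top t ht) (hv.caputo_top t ht)
  have hlow := fun (t : ℝ) (ht : 0 < t) (α : ℝ) (hα : α ∈ Icc (0 : ℝ) ((m : ℝ) - 1)) =>
    caputo_add_smul (Nat.ceil_le.2 (by linarith [hα.2] : α ≤ m))
      hu.contDiffOn_pos hv.contDiffOn_pos c ht (hu.caputo_low t ht α hα) (hv.caputo_low t ht α hα)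
  have hBl : ∀ t : ℝ, 0 < t → ∀ α ∈ Icc (0 : ℝ) ((m : ℝ) - 1),
      B α (caputo α (fun t => u t + c • v t) t) =
        B α (caputo α u t) + c • B α (caputo α v t) := by
    intro t ht α hα
    rw [(hlow t ht α hα).2, hB α hα, hB α hα, hB α hα, map_add, map_smul]
  refine ⟨hu.contDiffOn_pos.add (hv.contDiffOn_pos.const_smul c),
    hu.contDiffOn_nonneg.add (hv.contDiffOn_nonneg.const_smul c), fun t ht => (htop t ht).1,
    fun t ht α hα => (hlow t ht α hα).1, fun t ht => ?_, fun t ht => ?_, fun j => ?_⟩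
  · exact ((hu.integrable t ht).add ((hv.integrable t ht).smul c)).congr_fun
      (fun α hα => (hBl t ht α hα).symm) measurableSet_Icc
  · rw [(htop t ht).2, setIntegral_congr_fun measurableSet_Icc (hBl t ht),
      integral_add (f := fun α => B α (caputo α u t)) (g := fun α => c • B α (caputo α v t))
        (hu.integrable t ht) ((hv.integrable t ht).smul c), integral_smul]
    have h1 := hu.equation t ht
    have h2 := hv.equation t ht
    calc _ = (caputo μ u t + ∫ α in Icc 0 ((m : ℝ) - 1), B α (caputo α u t) ∂lam) +
          c • (caputo μ v t + ∫ α in Icc 0 ((m : ℝ) - 1), B α (caputo α v t) ∂lam) := by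
            rw [smul_add]; abel
      _ = 0 := by rw [h1, h2, smul_zero, add_zero]
  · have hj : ((j : ℕ) : WithTop ℕ∞) ≤ ((m - 1 : ℕ) : WithTop ℕ∞) := by
      exact_mod_cast (show (j : ℕ) ≤ m - 1 by have := j.2; omega)
    have h0 : (0 : ℝ) ∈ Ici (0 : ℝ) := mem_Ici.2 le_rfl
    have h1 := (hu.contDiffOn_nonneg 0 h0).of_le hj
    have h2 := (hv.contDiffOn_nonneg 0 h0).of_le hj
    rw [iteratedDerivWithin_fun_add h0 (uniqueDiffOn_Ici 0) h1 (h2.const_smul c),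
      iteratedDerivWithin_fun_const_smul h0 (uniqueDiffOn_Ici 0) c h2, hu.initial, hv.initial]
    rfl

end Linear

/-! ### Abel inversion: fractional integrals of orders `a` and `1 - a` compose to the integral -/

section Fubini

variable {E : Type*} [NormedAddCommGroup E] [NormedSpace ℝ E] [CompleteSpace E]

/-- This is the convolution identity `h_a * h_{1-a} = h_1 = 1` translated by `τ`. The kernel
vanishes for `x ≤ τ`, so the range extends to the fixed interval `(0, t]`, as Fubini requires. -/
theorem integral_rlKernel_rlKernel {a t τ : ℝ} (ha : 0 < a) (ha' : a < 1) (hτ : 0 < τ)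
    (hτt : τ < t) : IntegrableOn (fun x => rlKernel a (t - x) * rlKernel (1 - a) (x - τ))
      (Ioc 0 t) ∧ ∫ x in Ioc 0 t, rlKernel a (t - x) * rlKernel (1 - a) (x - τ) = 1 := by
  have hI := intervalIntegrable_rlKernel_mul ha (sub_pos.2 ha') (sub_pos.2 hτt)
  have hJ := integral_rlKernel_mul ha (sub_pos.2 ha') (sub_pos.2 hτt)
  have hI' := hI.comp_sub_right τ
  have hJ' := intervalIntegral.integral_comp_sub_right (a := τ) (b := t)
    (fun x => rlKernel a (t - τ - x) * rlKernel (1 - a) x) τ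
  simp only [sub_self, zero_add, sub_add_cancel, sub_sub_sub_cancel_right] at hI' hJ'
  rw [hJ, add_sub_cancel, rlKernel_one (sub_pos.2 hτt)] at hJ'
  have hI'' := (intervalIntegrable_iff_integrableOn_Ioc_of_le hτt.le).1 hI'
  rw [intervalIntegral.integral_of_le hτt.le] at hJ'
  have hz : ∀ x ∈ Ioc 0 t \ Ioc τ t, rlKernel a (t - x) * rlKernel (1 - a) (x - τ) = 0 := by
    intro x hx
    rw [rlKernel_of_nonpos (1 - a) (t := x - τ), mul_zero]
    have := hx.2
    simp only [mem_Ioc, not_and, not_le] at this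
    by_contra hc
    exact absurd (this (by linarith)) (not_lt.2 hx.1.2)
  constructor
  · exact hI''.of_forall_sdiff_eq_zero measurableSet_Ioc hz
  · exact (setIntegral_eq_of_subset_of_forall_sdiff_eq_zero measurableSet_Ioc
      (Ioc_subset_Ioc_left hτ.le) hz).trans hJ'

theorem integral_rlKernel_smul_integral {a t : ℝ} (ha : 0 < a) (ha' : a < 1) (ht : 0 < t)
    {g : ℝ → E} (hg : IntegrableOn g (Ioc 0 t)) :
    ∫ x in (0 : ℝ)..t, rlKernel a (t - x) •
      ∫ τ in (0 : ℝ)..x, rlKernel (1 - a) (x - τ) • g τ = ∫ τ in (0 : ℝ)..t, g τ := by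
  have hne : ∀ᵐ τ ∂(volume.restrict (Ioc 0 t)), τ ∈ Ioc 0 t ∧ τ ≠ t := by
    have h0 : ∀ᵐ τ : ℝ, τ ≠ t := by simp [ae_iff, measure_singleton]
    filter_upwards [ae_restrict_mem measurableSet_Ioc, ae_restrict_of_ae h0] with τ h1 h2
    exact ⟨h1, h2⟩
  have hk : ∀ᵐ τ ∂(volume.restrict (Ioc 0 t)),
      IntegrableOn (fun x => rlKernel a (t - x) * rlKernel (1 - a) (x - τ)) (Ioc 0 t) ∧
      ∫ x in Ioc 0 t, rlKernel a (t - x) * rlKernel (1 - a) (x - τ) = 1 := by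
    filter_upwards [hne] with τ hτ
    exact integral_rlKernel_rlKernel ha ha' hτ.1.1 (lt_of_le_of_ne hτ.1.2 hτ.2)
  have hinner : ∀ x ∈ Ioc 0 t, ∫ τ in (0 : ℝ)..x, rlKernel (1 - a) (x - τ) • g τ =
      ∫ τ in Ioc 0 t, rlKernel (1 - a) (x - τ) • g τ := by
    intro x hx
    rw [intervalIntegral.integral_of_le hx.1.le]
    refine (setIntegral_eq_of_subset_of_forall_sdiff_eq_zero measurableSet_Ioc
      (Ioc_subset_Ioc_right hx.2) fun τ hτ => ?_).symm
    rw [rlKernel_of_nonpos, zero_smul]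
    have := hτ.2
    simp only [mem_Ioc, not_and, not_le] at this
    linarith [this hτ.1.1]
  rw [intervalIntegral.integral_of_le ht.le, intervalIntegral.integral_of_le ht.le]
  have hmeas : AEStronglyMeasurable (Function.uncurry fun x τ : ℝ =>
      (rlKernel a (t - x) * rlKernel (1 - a) (x - τ)) • g τ)
      ((volume.restrict (Ioc 0 t)).prod (volume.restrict (Ioc 0 t))) := by
    refine AEStronglyMeasurable.smul (Measurable.aestronglyMeasurable ?_)
      hg.aestronglyMeasurable.comp_snd
    exact ((measurable_rlKernel a).comp (by fun_prop)).mul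
      ((measurable_rlKernel (1 - a)).comp (by fun_prop))
  have hint : Integrable (Function.uncurry fun x τ : ℝ =>
      (rlKernel a (t - x) * rlKernel (1 - a) (x - τ)) • g τ)
      ((volume.restrict (Ioc 0 t)).prod (volume.restrict (Ioc 0 t))) := by
    rw [integrable_prod_iff' hmeas]
    constructor
    · filter_upwards [hk] with τ hτ
      exact hτ.1.smul_const (g τ)
    · refine hg.norm.congr ?_
      filter_upwards [hk] with τ hτ
      simp only [Function.uncurry, norm_smul]
      rw [integral_mul_const]
      have : ∀ x : ℝ, ‖rlKernel a (t - x) * rlKernel (1 - a) (x - τ)‖ =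
          rlKernel a (t - x) * rlKernel (1 - a) (x - τ) := fun x =>
        Real.norm_of_nonneg (mul_nonneg (rlKernel_nonneg ha _)
          (rlKernel_nonneg (sub_pos.2 ha') _))
      simp only [this]
      rw [hτ.2, one_mul]
  calc ∫ x in Ioc 0 t, rlKernel a (t - x) • ∫ τ in (0 : ℝ)..x, rlKernel (1 - a) (x - τ) • g τ
      = ∫ x in Ioc 0 t, ∫ τ in Ioc 0 t,
          (rlKernel a (t - x) * rlKernel (1 - a) (x - τ)) • g τ := by
        refine setIntegral_congr_fun measurableSet_Ioc fun x hx => ?_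
        rw [hinner x hx, ← integral_smul]
        simp only [smul_smul]
    _ = ∫ τ in Ioc 0 t, ∫ x in Ioc 0 t,
          (rlKernel a (t - x) * rlKernel (1 - a) (x - τ)) • g τ := integral_integral_swap hint
    _ = ∫ τ in Ioc 0 t, g τ := by
        refine integral_congr_ae ?_
        filter_upwards [hk] with τ hτ
        rw [integral_smul_const, hτ.2, one_smul]

end Fubini

/-! ### Uniqueness by an exponentially weighted estimate -/

section Uniqueness

variable {E : Type*} [NormedAddCommGroup E] [NormedSpace ℂ E]

theorem norm_integral_rlKernel_smul_le {a s t N : ℝ} (ha : 0 < a) (hs : 0 < s) (ht : 0 < t)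
    {w : ℝ → E} (hw : ∀ τ ∈ Ioc 0 t, ‖w τ‖ ≤ N * Real.exp (s * τ)) (hN : 0 ≤ N) :
    ‖∫ τ in (0 : ℝ)..t, rlKernel a (t - τ) • w τ‖ ≤ N * (Real.exp (s * t) * s ^ (-a)) := by
  refine (intervalIntegral.norm_integral_le_of_norm_le (g := fun τ =>
    N * (rlKernel a (t - τ) * Real.exp (s * τ))) ht.le (Eventually.of_forall fun τ hτ => ?_)
    ((intervalIntegrable_rlKernel_mul_exp s ha ht).const_mul N)).trans ?_
  · rw [norm_smul, Real.norm_of_nonneg (rlKernel_nonneg ha _)]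
    refine (mul_le_mul_of_nonneg_left (hw τ hτ) (rlKernel_nonneg ha _)).trans (le_of_eq ?_)
    ring
  · rw [intervalIntegral.integral_const_mul]
    exact mul_le_mul_of_nonneg_left (integral_rlKernel_mul_exp_le ha hs ht) hN

namespace IsSolution

variable {m : ℕ} {μ : ℝ} {lam : Measure ℝ} {B : ℝ → E → E} {φ : Fin m → E} {w : ℝ → E}

theorem iteratedDeriv_eq (hw : IsSolution m μ lam B φ w) {j : ℕ} (hj : j ≤ m) {t : ℝ}
    (ht : 0 < t) : iteratedDeriv j w t = iteratedDerivWithin j w (Ici 0) t :=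
  (iteratedDerivWithin_eq_iteratedDeriv (uniqueDiffOn_Ici 0)
    ((hw.contDiffOn_pos.contDiffAt (Ioi_mem_nhds ht)).of_le (by exact_mod_cast hj)) ht.le).symm

theorem hasDerivWithinAt (hw : IsSolution m μ lam B φ w) {j : ℕ} (hj : j < m - 1) {t : ℝ}
    (ht : 0 ≤ t) : HasDerivWithinAt (iteratedDerivWithin j w (Ici 0))
      (iteratedDerivWithin (j + 1) w (Ici 0) t) (Ici 0) t := by
  rw [iteratedDerivWithin_succ]
  exact (hw.contDiffOn_nonneg.differentiableOn_iteratedDerivWithin (by exact_mod_cast hj)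
    (uniqueDiffOn_Ici 0) t ht).hasDerivWithinAt

theorem continuousOn (hw : IsSolution m μ lam B φ w) {j : ℕ} (hj : j ≤ m - 1) :
    ContinuousOn (iteratedDerivWithin j w (Ici 0)) (Ici 0) :=
  hw.contDiffOn_nonneg.continuousOn_iteratedDerivWithin (by exact_mod_cast hj)
    (uniqueDiffOn_Ici 0)

theorem hasDerivAt_top (hw : IsSolution m μ lam B φ w) (hm : 1 ≤ m) {t : ℝ} (ht : 0 < t) :
    HasDerivAt (iteratedDerivWithin (m - 1) w (Ici 0)) (iteratedDeriv m w t) t := by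
  obtain ⟨p, rfl⟩ : ∃ p, m = p + 1 := ⟨m - 1, by omega⟩
  have h1 := hw.contDiffOn_pos.differentiableOn_iteratedDerivWithin (m := p)
    (by exact_mod_cast p.lt_succ_self) isOpen_Ioi.uniqueDiffOn
  have h2 := (h1 t ht).differentiableAt (Ioi_mem_nhds ht)
  have he : iteratedDerivWithin p w (Ioi 0) =ᶠ[𝓝 t] iteratedDeriv p w := by
    filter_upwards [Ioi_mem_nhds ht] with x hx using iteratedDerivWithin_of_isOpen isOpen_Ioi hx
  have h3 : HasDerivAt (iteratedDeriv p w) (iteratedDeriv (p + 1) w t) t := by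
    rw [iteratedDeriv_succ]
    exact (h2.congr_of_eventuallyEq he.symm).hasDerivAt
  refine h3.congr_of_eventuallyEq ?_
  filter_upwards [Ioi_mem_nhds ht] with x hx
  exact (hw.iteratedDeriv_eq (Nat.le_succ p) hx).symm

/-- Descend from order `m - 1`: the lower derivatives start at `0`, and for `s ≥ 1` the bound `N exp
(s t)` grows at least as fast as it itself allows the function to grow. -/
theorem norm_iteratedDerivWithin_le (hw : IsSolution m μ lam B 0 w) {s T N : ℝ} (hs : 1 ≤ s)
    (hN : 0 ≤ N)
    (h : ∀ t ∈ Icc 0 T, ‖iteratedDerivWithin (m - 1) w (Ici 0) t‖ ≤ N * Real.exp (s * t))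
    {j : ℕ} (hj : j ≤ m - 1) :
    ∀ t ∈ Icc 0 T, ‖iteratedDerivWithin j w (Ici 0) t‖ ≤ N * Real.exp (s * t) := by
  obtain ⟨d, hd⟩ := Nat.exists_eq_add_of_le hj
  induction d generalizing j with
  | zero => rwa [show j = m - 1 by omega]
  | succ d ih =>
    have ih := ih (j := j + 1) (by omega) (by omega)
    have hj : j < m - 1 := by omega
    refine image_norm_le_of_norm_deriv_right_le_deriv_boundary
      (f' := iteratedDerivWithin (j + 1) w (Ici 0)) (B' := fun t => N * (Real.exp (s * t) * s))
      ((hw.continuousOn hj.le).mono Icc_subset_Ici_self)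
      (fun x hx => (hw.hasDerivWithinAt hj hx.1).mono (Ici_subset_Ici.2 hx.1)) ?_ ?_ ?_
    · have := hw.initial ⟨j, by omega⟩
      simp only [Pi.zero_apply] at this
      rw [this, norm_zero]
      positivity
    · intro x
      have : HasDerivAt (fun x => s * x) s x := by simpa using (hasDerivAt_id x).const_mul s
      exact this.exp.const_mul N
    · intro x hx
      refine (ih x (Ico_subset_Icc_self hx)).trans (mul_le_mul_of_nonneg_left ?_ hN)
      exact le_mul_of_one_le_right (Real.exp_pos _).le hs

theorem norm_caputo_le (hm : 1 ≤ m) (hw : IsSolution m μ lam B 0 w) {s T N : ℝ} (hs : 1 ≤ s)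
    (hN : 0 ≤ N)
    (h : ∀ t ∈ Icc 0 T, ‖iteratedDerivWithin (m - 1) w (Ici 0) t‖ ≤ N * Real.exp (s * t))
    {α : ℝ} (hα : α ∈ Icc 0 ((m : ℝ) - 1)) {t : ℝ} (ht : 0 < t) (htT : t ≤ T) :
    ‖caputo α w t‖ ≤ N * Real.exp (s * t) := by
  have hn : ⌈α⌉₊ ≤ m - 1 := Nat.ceil_le.2 (by rw [Nat.cast_sub hm, Nat.cast_one]; exact hα.2)
  have hb := hw.norm_iteratedDerivWithin_le hs hN h hn
  rcases (Nat.le_ceil α).eq_or_lt with he | hl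
  · rw [caputo_of_eq he.symm, hw.iteratedDeriv_eq (by omega) ht]
    exact hb t ⟨ht.le, htT⟩
  · rw [caputo_of_lt ht hl (w := iteratedDerivWithin ⌈α⌉₊ w (Ici 0)) fun τ hτ =>
      hw.iteratedDeriv_eq (by omega) hτ.1]
    refine (norm_integral_rlKernel_smul_le (sub_pos.2 hl) (by linarith) ht
      (fun τ hτ => hb τ ⟨hτ.1.le, hτ.2.trans htT⟩) hN).trans
      (mul_le_mul_of_nonneg_left ?_ hN)
    refine mul_le_of_le_one_right (Real.exp_pos _).le ?_
    exact Real.rpow_le_one_of_one_le_of_nonpos hs (by linarith)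

variable [CompleteSpace E]

/-- The fractional integral of order `μ - m + 1` inverts the Caputo derivative. Integrability of
`w⁽ᵐ⁾` near `0` is not part of the solution class and has to be derived: from the bound `C` if `μ =
m`, and from convergence of the Caputo integral if `μ < m`. -/
theorem integral_caputo_top (hm : 1 ≤ m) (hμ₁ : (m : ℝ) - 1 < μ) (hμ₂ : μ ≤ m)
    (hw : IsSolution m μ lam B 0 w) {t C : ℝ} (ht : 0 < t)
    (hC : ∀ τ ∈ Ioc 0 t, ‖caputo μ w τ‖ ≤ C) :
    iteratedDerivWithin (m - 1) w (Ici 0) t =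
      ∫ τ in (0 : ℝ)..t, rlKernel (μ - (m - 1)) (t - τ) • caputo μ w τ := by
  have hceil : ⌈μ⌉₊ = m := by
    refine (Nat.ceil_eq_iff (by omega)).2 ⟨?_, hμ₂⟩
    rw [Nat.cast_sub hm, Nat.cast_one]
    exact hμ₁
  have hcont : ContinuousOn (iteratedDeriv m w) (Ioi 0) := by
    refine ContinuousOn.congr (hw.contDiffOn_pos.continuousOn_iteratedDerivWithin (m := m) le_rfl
      isOpen_Ioi.uniqueDiffOn) fun x hx => (iteratedDerivWithin_of_isOpen isOpen_Ioi hx).symm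
  have hmeas : AEStronglyMeasurable (iteratedDeriv m w) (volume.restrict (Ioc 0 t)) :=
    (hcont.mono Ioc_subset_Ioi_self).aestronglyMeasurable measurableSet_Ioc
  have hFTC : ∀ hI : IntegrableOn (iteratedDeriv m w) (Ioc 0 t),
      ∫ τ in (0 : ℝ)..t, iteratedDeriv m w τ = iteratedDerivWithin (m - 1) w (Ici 0) t := by
    intro hI
    rw [intervalIntegral.integral_eq_sub_of_hasDerivAt_of_le ht.le
      ((hw.continuousOn le_rfl).mono Icc_subset_Ici_self)
      (fun x hx => hw.hasDerivAt_top hm hx.1)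
      ((intervalIntegrable_iff_integrableOn_Ioc_of_le ht.le).2 hI)]
    have := hw.initial ⟨m - 1, by omega⟩
    simp only [Pi.zero_apply] at this
    rw [this, sub_zero]
  rcases hμ₂.eq_or_lt with rfl | hlt
  · have hc : ∀ τ, caputo (m : ℝ) w τ = iteratedDeriv m w τ := fun τ => by
      rw [caputo_of_eq (by rw [Nat.ceil_natCast]), Nat.ceil_natCast]
    have hI : IntegrableOn (iteratedDeriv m w) (Ioc 0 t) := by
      refine Integrable.of_bound hmeas C ?_
      filter_upwards [ae_restrict_mem measurableSet_Ioc] with τ hτ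
      rw [← hc]
      exact hC τ hτ
    rw [← hFTC hI]
    have h0 : ∀ᵐ τ : ℝ, τ ≠ t := by simp [ae_iff, measure_singleton]
    refine intervalIntegral.integral_congr_ae ?_
    filter_upwards [h0] with τ h0 hτ
    rw [uIoc_of_le ht.le] at hτ
    rw [hc, sub_sub_cancel, rlKernel_one (sub_pos.2 (lt_of_le_of_ne hτ.2 h0)), one_smul]
  · have hlt' : μ < (⌈μ⌉₊ : ℝ) := by rw [hceil]; exact hlt
    have hc : ∀ τ, 0 < τ → caputo μ w τ =
        ∫ x in (0 : ℝ)..τ, rlKernel (1 - (μ - (m - 1))) (τ - x) • iteratedDeriv m w x := by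
      intro τ hτ
      rw [caputo_of_lt hτ hlt' (w := iteratedDeriv m w) (fun x _ => by rw [hceil]), hceil,
        show (m : ℝ) - μ = 1 - (μ - (m - 1)) by ring]
    have hconv := (caputoConverges_iff ht hlt' (w := iteratedDeriv m w)
      (fun x _ => by rw [hceil])).1 (hw.caputo_top t ht)
    rw [hceil, intervalIntegrable_iff_integrableOn_Ioc_of_le ht.le] at hconv
    -- The exponent `m - μ - 1` is negative, so the kernel at `t - τ` is at least its value at `t`,
    -- and dividing by this positive constant dominates `w⁽ᵐ⁾`.
    have hI : IntegrableOn (iteratedDeriv m w) (Ioc 0 t) := by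
      have hlow : ∀ᵐ τ ∂(volume.restrict (Ioc 0 t)), rlKernel (m - μ) t ≤
          rlKernel (m - μ) (t - τ) := by
        have h0 : ∀ᵐ τ : ℝ, τ ≠ t := by simp [ae_iff, measure_singleton]
        filter_upwards [ae_restrict_mem measurableSet_Ioc, ae_restrict_of_ae h0] with τ hτ h0
        have h1 : 0 < t - τ := sub_pos.2 (lt_of_le_of_ne hτ.2 h0)
        rw [rlKernel_of_pos _ ht, rlKernel_of_pos _ h1]
        refine div_le_div_of_nonneg_right ?_ (Real.Gamma_pos_of_pos (sub_pos.2 hlt)).le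
        exact Real.rpow_le_rpow_of_nonpos h1 (by linarith [hτ.1]) (by linarith)
      have hp := rlKernel_pos (sub_pos.2 hlt) ht
      refine Integrable.mono' (hconv.norm.const_mul (rlKernel (m - μ) t)⁻¹) hmeas ?_
      filter_upwards [hlow] with τ hτ
      rw [norm_smul, Real.norm_of_nonneg (rlKernel_nonneg (sub_pos.2 hlt) _), ← mul_assoc]
      refine le_mul_of_one_le_left (norm_nonneg _) ?_
      rw [inv_mul_eq_div, le_div_iff₀ hp, one_mul]
      exact hτ
    rw [← hFTC hI, ← integral_rlKernel_smul_integral (a := μ - (m - 1)) (by linarith)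
      (by linarith) ht hI]
    refine intervalIntegral.integral_congr_ae (Eventually.of_forall fun τ hτ => ?_)
    rw [uIoc_of_le ht.le] at hτ
    rw [hc τ hτ.1]

theorem eq_zero [IsFiniteMeasure lam] (hm : 1 ≤ m) (hμ₁ : (m : ℝ) - 1 < μ) (hμ₂ : μ ≤ m)
    {F : ℝ →ᵇ (E →L[ℝ] E)} (hB : ∀ α ∈ Icc (0 : ℝ) ((m : ℝ) - 1), ∀ y, B α y = F α y)
    (hw : IsSolution m μ lam B 0 w) {T : ℝ} (hT : 0 ≤ T) : w T = 0 := by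
  set ε := μ - (m - 1) with hε
  have hε0 : 0 < ε := by rw [hε]; linarith
  set M := ‖F‖ * lam.real univ with hM
  have hM0 : 0 ≤ M := by positivity
  -- With this `s` the equation followed by the fractional integral halves the weighted norm of
  -- `w⁽ᵐ⁻¹⁾`.
  obtain ⟨s, hs1, hsM⟩ : ∃ s : ℝ, 1 ≤ s ∧ M * s ^ (-ε) ≤ 1 / 2 := by
    have h := (tendsto_rpow_neg_atTop hε0).const_mul M
    rw [mul_zero] at h
    exact ((eventually_ge_atTop 1).and
      (h.eventually (eventually_le_nhds (by norm_num : (0 : ℝ) < 1 / 2)))).exists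
  have hs0 : 0 < s := by linarith
  set y := iteratedDerivWithin (m - 1) w (Ici 0) with hy
  obtain ⟨t₀, ht₀, hmax⟩ := (isCompact_Icc (a := 0) (b := T)).exists_isMaxOn ⟨0, le_rfl, hT⟩
    (f := fun t => ‖y t‖ * Real.exp (-(s * t)))
    (((hw.continuousOn le_rfl).mono Icc_subset_Ici_self).norm.mul (by fun_prop))
  set N := ‖y t₀‖ * Real.exp (-(s * t₀)) with hNdef
  have hN : 0 ≤ N := by positivity
  have hyN : ∀ t ∈ Icc 0 T, ‖y t‖ ≤ N * Real.exp (s * t) := by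
    intro t ht
    have : ‖y t‖ * Real.exp (-(s * t)) ≤ N := hmax ht
    calc ‖y t‖ = ‖y t‖ * Real.exp (-(s * t)) * Real.exp (s * t) := by
          rw [mul_assoc, ← Real.exp_add]; simp
      _ ≤ _ := by gcongr
  have hlow : ∀ t, 0 < t → t ≤ T → ‖caputo μ w t‖ ≤ M * N * Real.exp (s * t) := by
    intro t ht htT
    rw [eq_neg_of_add_eq_zero_left (hw.equation t ht), norm_neg]
    refine (norm_setIntegral_le_of_norm_le_const (C := ‖F‖ * (N * Real.exp (s * t)))
      (measure_lt_top _ _) fun α hα => ?_).trans ?_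
    · rw [hB α hα]
      exact (ContinuousLinearMap.le_opNorm _ _).trans (mul_le_mul (F.norm_coe_le_norm _)
        (hw.norm_caputo_le hm hs1 hN hyN hα ht htT) (norm_nonneg _) (norm_nonneg F))
    · calc ‖F‖ * (N * Real.exp (s * t)) * lam.real (Icc 0 ((m : ℝ) - 1))
          ≤ ‖F‖ * (N * Real.exp (s * t)) * lam.real univ :=
            mul_le_mul_of_nonneg_left (measureReal_mono (subset_univ _)) (by positivity)
        _ = _ := by rw [hM]; ring
  have hhalf : ∀ t, 0 < t → t ≤ T → ‖y t‖ ≤ N / 2 * Real.exp (s * t) := by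
    intro t ht htT
    have h1 := hw.integral_caputo_top hm hμ₁ hμ₂ (C := M * N * Real.exp (s * t)) ht
      (fun τ hτ => (hlow τ hτ.1 (hτ.2.trans htT)).trans
        (mul_le_mul_of_nonneg_left (Real.exp_le_exp.2
          (mul_le_mul_of_nonneg_left hτ.2 hs0.le)) (by positivity)))
    rw [hy, h1]
    refine (norm_integral_rlKernel_smul_le hε0 hs0 ht
      (fun τ hτ => hlow τ hτ.1 (hτ.2.trans htT)) (by positivity)).trans ?_
    calc M * N * (Real.exp (s * t) * s ^ (-ε)) = (M * s ^ (-ε)) * (N * Real.exp (s * t)) := by ring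
      _ ≤ 1 / 2 * (N * Real.exp (s * t)) := by gcongr
      _ = _ := by ring
  have hy0 : y 0 = 0 := by
    have := hw.initial ⟨m - 1, by omega⟩
    simpa using this
  -- At a maximum point `t₀ > 0` the halved bound says `N ≤ N / 2`; at `t₀ = 0` the initial
  -- condition gives `N = 0`.
  have hN0 : N ≤ 0 := by
    rcases ht₀.1.eq_or_lt with h | h
    · rw [hNdef, ← h, hy0, norm_zero, zero_mul]
    · have h1 : N ≤ N / 2 := by
        calc N ≤ N / 2 * Real.exp (s * t₀) * Real.exp (-(s * t₀)) := by
              rw [hNdef]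
              gcongr
              exact hhalf t₀ h ht₀.2
          _ = N / 2 := by rw [mul_assoc, ← Real.exp_add]; simp
      linarith
  have hfin := hw.norm_iteratedDerivWithin_le hs1 hN hyN (Nat.zero_le _) T ⟨hT, le_rfl⟩
  rw [iteratedDerivWithin_zero, le_antisymm hN0 hN, zero_mul] at hfin
  exact norm_le_zero_iff.1 hfin

end IsSolution

end Uniqueness

/-! ### Lerch's theorem: uniqueness of inverse Laplace transforms -/

section Lerch

/-- The hypothesis says that `G` annihilates every polynomial in `exp (-t)`; Weierstrass
approximation extends this to continuous functions of `exp (-t)`. -/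
theorem integral_comp_exp_mul_eq_zero {G : ℝ → ℂ} (hG : IntegrableOn G (Ioi 0))
    (h : ∀ n : ℕ, ∫ t in Ioi (0 : ℝ), (Real.exp (-(n * t)) : ℂ) * G t = 0) {φ : ℝ → ℝ}
    (hφ : ContinuousOn φ (Icc 0 1)) :
    ∫ t in Ioi (0 : ℝ), φ (Real.exp (-t)) • G t = 0 := by
  have hmem : ∀ t ∈ Ioi (0 : ℝ), Real.exp (-t) ∈ Icc (0 : ℝ) 1 := fun t ht =>
    ⟨(Real.exp_pos _).le, Real.exp_le_one_iff.2 (by linarith [mem_Ioi.1 ht])⟩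
  have hint : ∀ ψ : ℝ → ℝ, ContinuousOn ψ (Icc 0 1) →
      IntegrableOn (fun t => ψ (Real.exp (-t)) • G t) (Ioi 0) := by
    intro ψ hψ
    obtain ⟨C, hC⟩ := isCompact_Icc.exists_bound_of_continuousOn hψ
    refine Integrable.bdd_smul (𝕜 := ℝ) (φ := fun t : ℝ => ψ (Real.exp (-t))) (C := C) hG ?_ ?_
    · exact (hψ.comp (f := fun t : ℝ => Real.exp (-t)) (by fun_prop)
        hmem).aestronglyMeasurable measurableSet_Ioi
    · filter_upwards [ae_restrict_mem measurableSet_Ioi] with t ht using hC _ (hmem t ht)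
  have hpoly : ∀ p : Polynomial ℝ,
      ∫ t in Ioi (0 : ℝ), p.eval (Real.exp (-t)) • G t = 0 := by
    intro p
    induction p using Polynomial.induction_on' with
    | add p q hp hq =>
      simp only [Polynomial.eval_add, add_smul]
      rw [integral_add (hint _ p.continuous.continuousOn) (hint _ q.continuous.continuousOn),
        hp, hq, add_zero]
    | monomial n a =>
      simp only [Polynomial.eval_monomial]
      have e : ∀ t : ℝ, (a * Real.exp (-t) ^ n) • G t =
          (a : ℂ) * ((Real.exp (-(n * t)) : ℂ) * G t) := by
        intro t
        rw [← Real.exp_nat_mul, mul_neg, Complex.real_smul]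
        push_cast
        ring
      simp only [e]
      rw [integral_const_mul, h n, mul_zero]
  set I := ∫ t in Ioi (0 : ℝ), ‖G t‖ with hI
  have hI0 : 0 ≤ I := integral_nonneg fun t => norm_nonneg _
  refine norm_le_zero_iff.1 (le_of_forall_pos_le_add fun ε hε => ?_)
  obtain ⟨p, hp⟩ := exists_polynomial_near_of_continuousOn 0 1 φ hφ (ε / (I + 1)) (by positivity)
  have h1 : ∫ t in Ioi (0 : ℝ), φ (Real.exp (-t)) • G t =
      ∫ t in Ioi (0 : ℝ), (φ (Real.exp (-t)) - p.eval (Real.exp (-t))) • G t := by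
    simp only [sub_smul]
    rw [integral_sub (hint _ hφ) (hint _ p.continuous.continuousOn), hpoly, sub_zero]
  rw [h1, zero_add]
  calc ‖∫ t in Ioi (0 : ℝ), (φ (Real.exp (-t)) - p.eval (Real.exp (-t))) • G t‖
      ≤ ∫ t in Ioi (0 : ℝ), ε / (I + 1) * ‖G t‖ := by
        refine norm_integral_le_of_norm_le (hG.norm.const_mul _) ?_
        filter_upwards [ae_restrict_mem measurableSet_Ioi] with t ht
        rw [norm_smul, Real.norm_eq_abs, abs_sub_comm]
        exact mul_le_mul_of_nonneg_right (hp _ (hmem t ht)).le (norm_nonneg _)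
    _ = ε / (I + 1) * I := by rw [integral_const_mul]
    _ ≤ ε := by
        rw [div_mul_eq_mul_div, div_le_iff₀ (by positivity)]
        nlinarith

/-- Near `x = 0` the argument `-log x` leaves the support. At `x = 0` itself `Real.log 0 = 0`, so
`h0` supplies the correct limiting value. -/
theorem continuousOn_comp_neg_log {ψ : ℝ → ℝ} (hψ : Continuous ψ) (hc : HasCompactSupport ψ)
    (h0 : ψ 0 = 0) : ContinuousOn (fun x => ψ (-Real.log x)) (Icc 0 1) := by
  intro x hx
  rcases hx.1.eq_or_lt with rfl | hx0
  · obtain ⟨R, hR⟩ := hc.isCompact.isBounded.subset_closedBall (0 : ℝ)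
    refine ContinuousWithinAt.congr_of_eventuallyEq
      (continuousWithinAt_const (b := (0 : ℝ))) ?_ (by simpa using h0)
    filter_upwards [self_mem_nhdsWithin,
      mem_nhdsWithin_of_mem_nhds (Iio_mem_nhds (Real.exp_pos (-R)))] with y hy hy'
    rcases hy.1.eq_or_lt with rfl | hy0
    · simpa using h0
    · by_contra hne
      have := hR (subset_tsupport _ hne)
      rw [mem_closedBall_zero_iff, Real.norm_eq_abs] at this
      have h2 := (Real.log_lt_iff_lt_exp hy0).2 hy'
      linarith [le_abs_self (-Real.log y)]
  · exact (hψ.continuousAt.comp (Real.continuousAt_log hx0.ne').neg).continuousWithinAt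

/-- Absorb `exp (-(s₀ + 1) t)` into `g`; the transforms at `s₀ + 1 + n` become the moments of the
product in `exp (-t)`. They vanish, so the product is orthogonal to all test functions. -/
theorem eqOn_zero_of_laplace_eq_zero {g : ℝ → ℂ} (hg : ContinuousOn g (Ici 0)) {s₀ : ℝ}
    (h : ∀ s, s₀ < s → IntegrableOn (fun t : ℝ => (Real.exp (-(s * t)) : ℂ) * g t) (Ioi 0) ∧
      ∫ t in Ioi (0 : ℝ), (Real.exp (-(s * t)) : ℂ) * g t = 0) : EqOn g 0 (Ici 0) := by
  set G : ℝ → ℂ := fun t => (Real.exp (-((s₀ + 1) * t)) : ℂ) * g t with hGdef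
  have hG : IntegrableOn G (Ioi 0) := (h (s₀ + 1) (by linarith)).1
  have hGn : ∀ n : ℕ, ∫ t in Ioi (0 : ℝ), (Real.exp (-(n * t)) : ℂ) * G t = 0 := by
    intro n
    rw [← (h (s₀ + 1 + n) (by have : (0 : ℝ) ≤ n := n.cast_nonneg; linarith)).2]
    congr 1
    funext t
    rw [hGdef]
    simp only
    rw [← mul_assoc, ← Complex.ofReal_mul, ← Real.exp_add]
    congr 3
    ring
  have hae : ∀ᵐ t : ℝ, t ∈ Ioi (0 : ℝ) → G t = 0 := by
    refine isOpen_Ioi.ae_eq_zero_of_integral_contDiff_smul_eq_zero hG.locallyIntegrableOn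
      fun ψ hψ hc hs => ?_
    have hz : ∀ t, t ∉ Ioi (0 : ℝ) → ψ t = 0 := fun t ht =>
      image_eq_zero_of_notMem_tsupport fun h => ht (hs h)
    have := integral_comp_exp_mul_eq_zero hG hGn
      (continuousOn_comp_neg_log hψ.continuous hc (hz 0 (by simp)))
    simp only [Real.log_exp, neg_neg] at this
    rw [← this]
    refine (setIntegral_eq_integral_of_forall_compl_eq_zero fun t ht => ?_).symm
    rw [hz t ht, zero_smul]
  have hopen : EqOn g 0 (Ioi 0) := by
    refine Measure.eqOn_open_of_ae_eq (μ := volume) ?_ isOpen_Ioi (hg.mono Ioi_subset_Ici_self)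
      continuousOn_const
    rw [EventuallyEq, ae_restrict_iff' measurableSet_Ioi]
    filter_upwards [hae] with t ht ht0
    have h1 : (Real.exp (-((s₀ + 1) * t)) : ℂ) ≠ 0 := by
      exact_mod_cast (Real.exp_pos _).ne'
    exact (mul_eq_zero.1 (ht ht0)).resolve_left h1
  exact hopen.of_subset_closure hg continuousOn_const Ioi_subset_Ici_self (by rw [closure_Ioi])

theorem IsInverseLaplace.eqOn {F : ℝ → ℂ} {g₁ g₂ : ℝ → ℂ} (h₁ : IsInverseLaplace F g₁)
    (h₂ : IsInverseLaplace F g₂) : EqOn g₁ g₂ (Ici 0) := by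
  obtain ⟨hc₁, s₁, -, h₁⟩ := h₁
  obtain ⟨hc₂, s₂, -, h₂⟩ := h₂
  have := eqOn_zero_of_laplace_eq_zero (hc₁.sub hc₂) (s₀ := max s₁ s₂) fun s hs => by
    obtain ⟨i₁, e₁⟩ := h₁ s ((le_max_left _ _).trans_lt hs)
    obtain ⟨i₂, e₂⟩ := h₂ s ((le_max_right _ _).trans_lt hs)
    simp only [Pi.sub_apply, mul_sub]
    exact ⟨i₁.sub i₂, by rw [integral_sub i₁ i₂, e₁, e₂, sub_self]⟩
  exact fun t ht => sub_eq_zero.1 (this ht)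

theorem isInverseLaplace_inverseLaplace {F g : ℝ → ℂ} (h : IsInverseLaplace F g) :
    IsInverseLaplace F (inverseLaplace F) := by
  have h' : ∃ g, IsInverseLaplace F g := ⟨g, h⟩
  rw [inverseLaplace, dif_pos h']
  exact h'.choose_spec

end Lerch

/-! ### Scalar symbols: `c_β` and `S_k` through the Neumann series -/

section Scalar

theorem charFn_eq (m : ℕ) (μ : ℝ) (lam : Measure ℝ) (f : ℝ → ℂ → ℂ) (z : ℂ) {S : ℝ}
    (hS : 0 < S) : charFn m μ lam f S z = ((S ^ μ : ℝ) : ℂ) *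
      (1 + ∫ α in Icc 0 ((m : ℝ) - 1), f α z * ((S ^ (α - μ) : ℝ) : ℂ) ∂lam) := by
  rw [charFn, mul_add, mul_one, ← integral_const_mul]
  congr 1
  refine integral_congr_ae (Eventually.of_forall fun α => ?_)
  simp only
  rw [mul_left_comm, ← Complex.ofReal_mul, ← Real.rpow_add hS]
  congr 3
  ring

variable (σ : ℝ≥0) (F : ℝ →ᵇ (ℂ →L[ℝ] ℂ)) (lam : Measure ℝ) [IsFiniteMeasure lam]
  (m : ℕ) (μ : ℝ)

/-- The inverse Laplace transform of `s ^ (μ - γ) / Δ(s)` in terms of the Neumann series. -/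
def resolventKernel (γ t : ℝ) : ℂ :=
  ((t ^ (γ - 1) / Real.Gamma γ : ℝ) : ℂ) -
    convOp σ F (lam.restrict (Icc 0 ((m : ℝ) - 1))) ((m : ℝ) - 1)
      (neumann (volterraOp σ F lam m μ) (tensor 1 (kernelFamily σ (γ + (μ - (m - 1))) t))) 0

variable {σ F lam m μ}

theorem neumann_kernelFamily_add (hC : ‖volterraOp σ F lam m μ‖ < 1) (γ t : ℝ) (η δ : ℝ≥0) :
    neumann (volterraOp σ F lam m μ) (tensor 1 (kernelFamily σ (γ + η) t)) δ =
      Real.exp (-(σ * η)) •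
        neumann (volterraOp σ F lam m μ) (tensor 1 (kernelFamily σ γ t)) (δ + η) := by
  rw [tensor_kernelFamily_add, map_smul, neumann_translate hC]
  rfl

/-- For `t > 0` this is `(1 + C) x = h_γ` at `δ = 0`. The definition splits off `h_γ` and moves the
shift `μ - (m - 1)` from the translation into the kernel order. For `γ ≥ 1` the correction then has
order above `1` and is continuous at `t = 0`, while the explicit power has the right value `1` there
when `γ = 1`, unlike the zero-extended kernel. -/
theorem resolventKernel_eq (hC : ‖volterraOp σ F lam m μ‖ < 1) (hμ₁ : (m : ℝ) - 1 < μ)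
    (γ : ℝ) {t : ℝ} (ht : 0 < t) : resolventKernel σ F lam m μ γ t =
      neumann (volterraOp σ F lam m μ) (tensor 1 (kernelFamily σ γ t)) 0 := by
  have h := congrArg (fun x : ℝ≥0 →ᵇ ℂ => x 0)
    (neumann_apply_add hC (tensor (1 : ℂ) (kernelFamily σ γ t)))
  simp only [BoundedContinuousFunction.coe_add, Pi.add_apply] at h
  rw [resolventKernel, sub_eq_iff_eq_add]
  refine Eq.trans ?_ (h.symm.trans ?_)
  · simp [rlKernel_of_pos _ ht]
  · congr 1
    rw [convOp_apply, convOp_apply]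
    refine integral_congr_ae ?_
    filter_upwards [ae_restrict_mem measurableSet_Icc] with α hα
    have h1 : Real.toNNReal (μ - α) =
        Real.toNNReal ((m : ℝ) - 1 - α) + Real.toNNReal (μ - (m - 1)) := by
      rw [← Real.toNNReal_add (by linarith [hα.2]) (by linarith)]
      congr 1
      ring
    have h2 : γ + (μ - (m - 1)) = γ + (Real.toNNReal (μ - (m - 1)) : ℝ) := by
      rw [Real.coe_toNNReal _ (by linarith)]
    simp only [convIntegrand, zero_add]
    rw [h2, neumann_kernelFamily_add hC, map_smul, smul_smul, ← Real.exp_add, h1, NNReal.coe_add]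
    congr 2
    ring

theorem continuousOn_resolventKernel (hμ₁ : (m : ℝ) - 1 < μ) {γ : ℝ} (hγ : 1 ≤ γ) :
    ContinuousOn (resolventKernel σ F lam m μ γ) (Ici 0) := by
  refine Continuous.continuousOn (Continuous.sub ?_ ?_)
  · refine Complex.continuous_ofReal.comp (Continuous.div_const ?_ _)
    exact continuous_id.rpow_const fun _ => Or.inr (by linarith)
  · have h1 := continuous_kernelFamily (σ : ℝ) (γ := γ + (μ - (m - 1))) (by linarith)
    exact (evalCLM ℝ (0 : ℝ≥0) : (ℝ≥0 →ᵇ ℂ) →L[ℝ] ℂ).continuous.comp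
      ((convOp σ F _ _).continuous.comp ((neumann _).continuous.comp
        ((tensor (1 : ℂ)).continuous.comp h1)))

theorem resolventKernel_zero (γ : ℝ) :
    resolventKernel σ F lam m μ γ 0 = (((0 : ℝ) ^ (γ - 1) / Real.Gamma γ : ℝ) : ℂ) := by
  rw [resolventKernel, kernelFamily_of_nonpos _ _ le_rfl]
  simp

variable {f : ℝ → ℂ → ℂ} {z : ℂ}

/-- The Laplace transform at `S` of the kernels `kernelFamily σ γ`. -/
def kernelLaplace (σ γ S : ℝ) : ℝ≥0 →ᵇ ℝ :=
  ∫ t in Ioi (0 : ℝ), Real.exp (-(S * t)) • kernelFamily σ γ t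

/-- Translation by `μ - α` multiplies the transform by `(exp σ / S) ^ (μ - α)`, and the weight
cancels the power of `exp σ`. The eigenvalue of `1 + C` is therefore `Δ(S, z) S ^ (-μ)`. -/
theorem add_volterraOp_kernelLaplace (hmul : ∀ α y, F α y = F α 1 * y)
    (hf : ∀ α ∈ Icc (0 : ℝ) ((m : ℝ) - 1), F α 1 = f α z) (hμ₁ : (m : ℝ) - 1 < μ)
    {γ S : ℝ} (hγ : 1 ≤ γ) (hS : Real.exp σ < S) (q : ℂ) :
    tensor q (kernelLaplace σ γ S) + volterraOp σ F lam m μ (tensor q (kernelLaplace σ γ S)) =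
      tensor (q * (1 + ∫ α in Icc 0 ((m : ℝ) - 1), f α z * ((S ^ (α - μ) : ℝ) : ℂ) ∂lam))
        (kernelLaplace σ γ S) := by
  have hS0 : 0 < S := (Real.exp_pos _).trans hS
  ext δ
  rw [BoundedContinuousFunction.coe_add, Pi.add_apply, convOp_apply, tensor_apply, tensor_apply,
    mul_add, mul_one, smul_add, ← integral_const_mul, ← integral_smul]
  congr 1
  refine integral_congr_ae ?_
  filter_upwards [ae_restrict_mem measurableSet_Icc] with α hα
  have hle : 0 ≤ μ - α := by linarith [hα.2]
  rw [convIntegrand, tensor_apply, hmul, hf α hα, kernelLaplace,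
    integral_exp_smul_kernelFamily_apply hγ hS, integral_exp_smul_kernelFamily_apply hγ hS,
    NNReal.coe_add, Real.coe_toNNReal _ hle, Real.rpow_add (div_pos (Real.exp_pos _) hS0),
    Real.div_rpow (Real.exp_pos _).le hS0.le (μ - α), ← Real.exp_mul,
    show α - μ = -(μ - α) by ring, Real.rpow_neg hS0.le (μ - α), Real.exp_neg]
  simp only [Complex.real_smul]
  push_cast
  have : Complex.exp (σ * (μ - α)) ≠ 0 := Complex.exp_ne_zero _
  field_simp

/-- Otherwise the invertible operator `1 + C` would annihilate the Laplace transform of the kernels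
of order `1`, whose value at `δ = 0` is `S⁻¹`. -/
theorem one_add_integral_ne_zero (hC : ‖volterraOp σ F lam m μ‖ < 1)
    (hmul : ∀ α y, F α y = F α 1 * y)
    (hf : ∀ α ∈ Icc (0 : ℝ) ((m : ℝ) - 1), F α 1 = f α z) (hμ₁ : (m : ℝ) - 1 < μ)
    {S : ℝ} (hS : Real.exp σ < S) :
    1 + ∫ α in Icc 0 ((m : ℝ) - 1), f α z * ((S ^ (α - μ) : ℝ) : ℂ) ∂lam ≠ 0 := by
  intro h0
  have hS0 : 0 < S := (Real.exp_pos _).trans hS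
  have h1 := add_volterraOp_kernelLaplace (lam := lam) hmul hf hμ₁ (γ := 1) le_rfl hS 1
  have h2 := neumann_apply_of_add_eq hC h1
  rw [h0, mul_zero] at h2
  have h3 : tensor (0 : ℂ) (kernelLaplace σ 1 S) = 0 := by ext δ; simp
  rw [h3, map_zero] at h2
  have h4 := congrArg (fun x : ℝ≥0 →ᵇ ℂ => x 0) h2
  rw [tensor_apply, kernelLaplace, integral_exp_smul_kernelFamily_apply le_rfl hS] at h4
  simp only [BoundedContinuousFunction.coe_zero, Pi.zero_apply, NNReal.coe_zero, Real.rpow_zero,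
    mul_one, Complex.real_smul] at h4
  exact (Real.rpow_pos_of_pos hS0 (-1)).ne (by exact_mod_cast h4)

theorem isInverseLaplace_resolventKernel (hC : ‖volterraOp σ F lam m μ‖ < 1)
    (hmul : ∀ α y, F α y = F α 1 * y)
    (hf : ∀ α ∈ Icc (0 : ℝ) ((m : ℝ) - 1), F α 1 = f α z) (hμ₁ : (m : ℝ) - 1 < μ)
    {β : ℝ} (hβ : β ≤ μ - 1) :
    IsInverseLaplace (cTransform m μ lam f β z) (resolventKernel σ F lam m μ (μ - β)) := by
  have hγ : 1 ≤ μ - β := by linarith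
  refine ⟨continuousOn_resolventKernel hμ₁ hγ, Real.exp σ, (Real.exp_pos _).le, fun S hS => ?_⟩
  have hS0 : 0 < S := (Real.exp_pos _).trans hS
  set L : (ℝ≥0 →ᵇ ℝ) →L[ℝ] ℂ :=
    evalCLM ℝ 0 ∘L neumann (volterraOp σ F lam m μ) ∘L tensor 1 with hL
  have e : EqOn (fun t : ℝ => L (Real.exp (-(S * t)) • kernelFamily σ (μ - β) t))
      (fun t : ℝ => (Real.exp (-(S * t)) : ℂ) * resolventKernel σ F lam m μ (μ - β) t)
      (Ioi 0) := by
    intro t ht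
    simp only
    rw [map_smul, resolventKernel_eq hC hμ₁ _ ht, Complex.real_smul]
    rfl
  have hI := integrableOn_exp_smul_kernelFamily hγ hS
  refine ⟨IntegrableOn.congr_fun (L.integrable_comp hI) e measurableSet_Ioi, ?_⟩
  · rw [← setIntegral_congr_fun measurableSet_Ioi e, L.integral_comp_comm hI]
    have hne := one_add_integral_ne_zero (lam := lam) hC hmul hf hμ₁ hS
    have h1 := add_volterraOp_kernelLaplace (lam := lam) hmul hf hμ₁ hγ hS
      (1 + ∫ α in Icc 0 ((m : ℝ) - 1), f α z * ((S ^ (α - μ) : ℝ) : ℂ) ∂lam)⁻¹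
    rw [inv_mul_cancel₀ hne] at h1
    have h2 := congrArg (fun x : ℝ≥0 →ᵇ ℂ => x 0) (neumann_apply_of_add_eq hC h1)
    refine h2.trans ?_
    rw [tensor_apply, kernelLaplace, integral_exp_smul_kernelFamily_apply hγ hS, cTransform,
      charFn_eq _ _ _ _ _ hS0]
    rw [NNReal.coe_zero, Real.rpow_zero, mul_one, Complex.real_smul, neg_sub,
      Real.rpow_sub hS0]
    push_cast
    have : ((S ^ μ : ℝ) : ℂ) ≠ 0 := by exact_mod_cast (Real.rpow_pos_of_pos hS0 _).ne'
    field_simp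

theorem isInverseLaplace_cFn (hC : ‖volterraOp σ F lam m μ‖ < 1)
    (hmul : ∀ α y, F α y = F α 1 * y)
    (hf : ∀ α ∈ Icc (0 : ℝ) ((m : ℝ) - 1), F α 1 = f α z) (hμ₁ : (m : ℝ) - 1 < μ)
    {β : ℝ} (hβ : β ≤ μ - 1) :
    IsInverseLaplace (cTransform m μ lam f β z) (fun t => cFn m μ lam f β t z) :=
  isInverseLaplace_inverseLaplace (isInverseLaplace_resolventKernel hC hmul hf hμ₁ hβ)

theorem cFn_eq (hC : ‖volterraOp σ F lam m μ‖ < 1) (hmul : ∀ α y, F α y = F α 1 * y)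
    (hf : ∀ α ∈ Icc (0 : ℝ) ((m : ℝ) - 1), F α 1 = f α z) (hμ₁ : (m : ℝ) - 1 < μ)
    {β : ℝ} (hβ : β ≤ μ - 1) {t : ℝ} (ht : 0 ≤ t) :
    cFn m μ lam f β t z = resolventKernel σ F lam m μ (μ - β) t :=
  (isInverseLaplace_cFn hC hmul hf hμ₁ hβ).eqOn
    (isInverseLaplace_resolventKernel hC hmul hf hμ₁ hβ) ht

theorem cFn_zero (hC : ‖volterraOp σ F lam m μ‖ < 1) (hmul : ∀ α y, F α y = F α 1 * y)
    (hf : ∀ α ∈ Icc (0 : ℝ) ((m : ℝ) - 1), F α 1 = f α z) (hμ₁ : (m : ℝ) - 1 < μ)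
    {β : ℝ} (hβ : β < μ - 1) : cFn m μ lam f β 0 z = 0 := by
  rw [cFn_eq hC hmul hf hμ₁ hβ.le le_rfl, resolventKernel_zero,
    Real.zero_rpow (by linarith : μ - β - 1 ≠ 0)]
  simp

theorem symbol_mul_cFn_eq (hC : ‖volterraOp σ F lam m μ‖ < 1)
    (hmul : ∀ α y, F α y = F α 1 * y)
    (hf : ∀ α ∈ Icc (0 : ℝ) ((m : ℝ) - 1), F α 1 = f α z) (hμ₁ : (m : ℝ) - 1 < μ)
    {k : ℕ} {t : ℝ} (ht : 0 < t) {α : ℝ} (hα : α ∈ Icc (0 : ℝ) ((m : ℝ) - 1)) :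
    f α z * cFn m μ lam f (α - k - 1) t z = Real.exp (-(σ * k)) • convIntegrand σ F μ
      (neumann (volterraOp σ F lam m μ) (tensor 1 (kernelFamily σ 1 t))) k α := by
  have hk : (0 : ℝ) ≤ k := k.cast_nonneg
  have h0 : 0 ≤ μ - α := by linarith [hα.2]
  have h1 : μ - (α - k - 1) = 1 + ((k + Real.toNNReal (μ - α) : ℝ≥0) : ℝ) := by
    rw [NNReal.coe_add, Real.coe_toNNReal _ h0, NNReal.coe_natCast]
    ring
  rw [cFn_eq hC hmul hf hμ₁ (by linarith [hα.2]) ht.le, resolventKernel_eq hC hμ₁ _ ht, h1,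
    neumann_kernelFamily_add hC, convIntegrand, hmul, hf α hα, zero_add, smul_smul,
    ← Real.exp_add, mul_smul_comm, NNReal.coe_add, NNReal.coe_natCast]
  congr 2
  ring

theorem integrableOn_symbol_mul_cFn (hC : ‖volterraOp σ F lam m μ‖ < 1)
    (hmul : ∀ α y, F α y = F α 1 * y)
    (hf : ∀ α ∈ Icc (0 : ℝ) ((m : ℝ) - 1), F α 1 = f α z) (hμ₁ : (m : ℝ) - 1 < μ)
    (k : ℕ) {t : ℝ} (ht : 0 ≤ t) :
    IntegrableOn (fun α => f α z * cFn m μ lam f (α - k - 1) t z)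
      (Ioc (k : ℝ) ((m : ℝ) - 1)) lam := by
  have hk : (0 : ℝ) ≤ k := k.cast_nonneg
  rcases ht.eq_or_lt with rfl | ht
  · refine IntegrableOn.congr_fun integrableOn_zero (fun α hα => ?_) measurableSet_Ioc
    rw [cFn_zero hC hmul hf hμ₁ (by linarith [hα.2]), mul_zero]
  · refine IntegrableOn.congr_fun ?_ (fun α hα =>
      (symbol_mul_cFn_eq hC hmul hf hμ₁ ht ⟨hk.trans hα.1.le, hα.2⟩).symm) measurableSet_Ioc
    exact (integrable_convIntegrand σ F (lam.restrict (Ioc (k : ℝ) ((m : ℝ) - 1))) μ _ k).smul (Real.exp (-(σ * k)))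

/-- Let `x` solve `(1 + C) x = h_1`. Then `c_{μ-k-1}` is `exp (-σ k) x(k)`, and the equation at `δ =
k` expresses it as `t ^ k / k!` minus an integral over `[0, m - 1]`. The integral in `S_k` cancels
the part over `(k, m - 1]`; what remains over `[0, k]` is `solFunctional`, because the data operator
commutes with the Neumann series. -/
theorem solFn_eq_solution (hC : ‖volterraOp σ F lam m μ‖ < 1)
    (hmul : ∀ α y, F α y = F α 1 * y)
    (hf : ∀ α ∈ Icc (0 : ℝ) ((m : ℝ) - 1), F α 1 = f α z) (hμ₁ : (m : ℝ) - 1 < μ)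
    {k : ℕ} (hkm : (k : ℝ) ≤ (m : ℝ) - 1) {t : ℝ} (ht : 0 ≤ t) :
    solFn m μ lam f k t z = solution σ F lam m μ k 1 t := by
  have hk : (0 : ℝ) ≤ k := k.cast_nonneg
  have hγ : μ - (μ - k - 1) = k + 1 := by ring
  rcases ht.eq_or_lt with rfl | ht
  -- At `t = 0` the zero-extended kernels are of no use; the integrand vanishes since `α - k - 1 < μ
  -- - 1`, and only `0 ^ k / k!` remains.
  · rw [solFn, setIntegral_congr_fun (g := fun _ => 0) measurableSet_Ioc (fun α hα => by
      simp only
      rw [cFn_zero hC hmul hf hμ₁ (by linarith [hα.2]), mul_zero]), integral_zero, add_zero,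
      cFn_eq hC hmul hf hμ₁ (by linarith) le_rfl, resolventKernel_zero, solution,
      kernelFamily_of_nonpos _ _ le_rfl, map_zero, sub_zero, hγ, Real.Gamma_nat_eq_factorial,
      add_sub_cancel_right, Real.rpow_natCast, Complex.real_smul, mul_one]
  set x := neumann (volterraOp σ F lam m μ) (tensor (1 : ℂ) (kernelFamily σ 1 t)) with hx
  have hcomm : ∀ α β y, F α (F β y) = F β (F α y) := by
    intro α β y
    rw [hmul α, hmul β y, hmul β (F α y), hmul α y]
    ring
  have hc : cFn m μ lam f (μ - k - 1) t z = Real.exp (-(σ * k)) • x k := by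
    rw [cFn_eq hC hmul hf hμ₁ (by linarith) ht.le, resolventKernel_eq hC hμ₁ _ ht, hγ,
      show (k : ℝ) + 1 = 1 + ((k : ℝ≥0) : ℝ) by rw [NNReal.coe_natCast]; ring,
      neumann_kernelFamily_add hC, zero_add, NNReal.coe_natCast]
  have hxk : x k = rlKernel (k + 1) t * Real.exp (σ * k) -
      ∫ α in Icc 0 ((m : ℝ) - 1), convIntegrand σ F μ x k α ∂lam := by
    have h := congrArg (fun x : ℝ≥0 →ᵇ ℂ => x k)
      (neumann_apply_add hC (tensor (1 : ℂ) (kernelFamily σ 1 t)))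
    simp only [BoundedContinuousFunction.coe_add, Pi.add_apply] at h
    rw [← hx, convOp_apply] at h
    rw [eq_sub_iff_add_eq, h, tensor_apply, kernelFamily_apply, NNReal.coe_natCast,
      Complex.real_smul, mul_one, Complex.ofReal_mul, mul_comm, add_comm (k : ℝ) 1]
  have hsplit : ∫ α in Icc 0 ((m : ℝ) - 1), convIntegrand σ F μ x k α ∂lam =
      (∫ α in Icc 0 (k : ℝ), convIntegrand σ F μ x k α ∂lam) +
        ∫ α in Ioc (k : ℝ) ((m : ℝ) - 1), convIntegrand σ F μ x k α ∂lam := by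
    rw [← Icc_union_Ioc_eq_Icc hk hkm]
    refine setIntegral_union ?_ measurableSet_Ioc (integrable_convIntegrand σ F _ μ x k)
      (integrable_convIntegrand σ F _ μ x k)
    rw [Set.disjoint_left]
    exact fun α h1 h2 => absurd h1.2 (not_le.2 h2.1)
  have hint : ∫ α in Ioc (k : ℝ) ((m : ℝ) - 1), f α z * cFn m μ lam f (α - k - 1) t z ∂lam =
      Real.exp (-(σ * k)) • ∫ α in Ioc (k : ℝ) ((m : ℝ) - 1), convIntegrand σ F μ x k α ∂lam := by
    rw [← integral_smul]
    exact setIntegral_congr_fun measurableSet_Ioc fun α hα =>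
      symbol_mul_cFn_eq hC hmul hf hμ₁ ht ⟨hk.trans hα.1.le, hα.2⟩
  have hsol : solFunctional σ F lam m μ k 1 (kernelFamily σ (μ + 1) t) =
      Real.exp (-(σ * k)) • ∫ α in Icc 0 (k : ℝ), convIntegrand σ F μ x k α ∂lam := by
    have hμ0 : 0 ≤ μ := by linarith
    rw [solFunctional_apply, ← neumann_intertwine hC hC (dataOp σ F lam k)
      (fun y => convOp_comm σ F _ k _ μ hcomm y), convOp_apply, ← integral_smul]
    refine setIntegral_congr_fun measurableSet_Icc fun α hα => ?_
    have h1 : Real.toNNReal (k - α) + Real.toNNReal μ = k + Real.toNNReal (μ - α) := by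
      apply NNReal.eq
      rw [NNReal.coe_add, NNReal.coe_add, NNReal.coe_natCast, Real.coe_toNNReal _ hμ0,
        Real.coe_toNNReal _ (sub_nonneg.2 hα.2), Real.coe_toNNReal _ (by linarith [hα.2])]
      ring
    simp only [convIntegrand]
    rw [show μ + 1 = 1 + (Real.toNNReal μ : ℝ) by rw [Real.coe_toNNReal _ hμ0]; ring,
      neumann_kernelFamily_add hC, map_smul, zero_add, h1, smul_smul, smul_smul,
      ← Real.exp_add, ← Real.exp_add]
    congr 2
    have h2 := congrArg NNReal.toReal h1
    rw [NNReal.coe_add, NNReal.coe_add, NNReal.coe_natCast] at h2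
    linear_combination (-(σ : ℝ)) * h2
  rw [solFn, hc, hint, solution, hsol, hxk, hsplit, ← rlKernel_nat_succ k ht]
  simp only [Complex.real_smul]
  have : ((Real.exp (-(σ * k)) : ℝ) : ℂ) * ((Real.exp (σ * k) : ℝ) : ℂ) = 1 := by
    rw [← Complex.ofReal_mul, ← Real.exp_add]; simp
  linear_combination (rlKernel (k + 1) t : ℂ) * this

end Scalar

/-! ### The shift on `ℓ¹` and the calculus `∑ bₙ R ^ n` of a contraction -/

section Summable

/-- The space `ℓ¹` of absolutely summable complex sequences. -/
abbrev SummableSeq : Type := lp (fun _ : ℕ => ℂ) 1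

theorem memℓp_one_iff {b : ℕ → ℂ} : Memℓp b 1 ↔ Summable fun n => ‖b n‖ := by
  rw [memℓp_gen_iff (by simp)]
  simp

theorem SummableSeq.summable (b : SummableSeq) : Summable fun n => ‖b n‖ :=
  memℓp_one_iff.1 (lp.memℓp b)

theorem SummableSeq.norm_eq (b : SummableSeq) : ‖b‖ = ∑' n, ‖b n‖ := by
  rw [lp.norm_eq_tsum_rpow (by simp)]
  simp

variable {Y : Type*} [NormedAddCommGroup Y] [NormedSpace ℂ Y]

theorem SummableSeq.clm_ext {T T' : SummableSeq →L[ℂ] Y}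
    (h : ∀ n, T (lp.single 1 n 1) = T' (lp.single 1 n 1)) : T = T' := by
  ext b
  have hb := lp.hasSum_single (p := 1) (by simp) b
  have e : ∀ (T : SummableSeq →L[ℂ] Y) n, T (lp.single 1 n (b n)) =
      b n • T (lp.single 1 n 1) := fun T n => by
    rw [← map_smul, ← lp.single_smul, smul_eq_mul, mul_one]
  have h1 := T.hasSum hb
  have h2 := T'.hasSum hb
  simp only [e] at h1 h2
  simp only [h] at h1
  exact h1.unique h2

theorem norm_clm_pow_le {R : Y →L[ℂ] Y} (hR : ‖R‖ ≤ 1) (n : ℕ) : ‖R ^ n‖ ≤ 1 := by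
  rcases Nat.eq_zero_or_pos n with rfl | hn
  · exact ContinuousLinearMap.norm_id_le
  · exact (norm_pow_le' R hn).trans (pow_le_one₀ (norm_nonneg _) hR)

variable [CompleteSpace Y]

/-- The map `b ↦ ∑ bₙ vₙ` on `ℓ¹` given by a bounded sequence `v`. -/
def seqLift (v : ℕ → Y) (C : ℝ) (hv : ∀ n, ‖v n‖ ≤ C) : SummableSeq →L[ℂ] Y :=
  LinearMap.mkContinuous
    { toFun := fun b => ∑' n, b n • v n
      map_add' := fun b c => by
        have hs : ∀ b : SummableSeq, Summable fun n => b n • v n := fun b =>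
          Summable.of_norm_bounded (b.summable.mul_right C) fun n => by
            rw [norm_smul]; exact mul_le_mul_of_nonneg_left (hv n) (norm_nonneg _)
        rw [← (hs b).tsum_add (hs c)]
        simp [add_smul]
      map_smul' := fun c b => by
        have hs : Summable fun n => b n • v n :=
          Summable.of_norm_bounded (b.summable.mul_right C) fun n => by
            rw [norm_smul]; exact mul_le_mul_of_nonneg_left (hv n) (norm_nonneg _)
        rw [RingHom.id_apply, ← hs.tsum_const_smul]
        simp [mul_smul] }
    C fun b => by
      rw [SummableSeq.norm_eq, mul_comm, ← tsum_mul_right]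
      refine tsum_of_norm_bounded (b.summable.mul_right C).hasSum fun n => ?_
      rw [norm_smul]
      exact mul_le_mul_of_nonneg_left (hv n) (norm_nonneg _)

theorem seqLift_apply (v : ℕ → Y) (C : ℝ) (hv : ∀ n, ‖v n‖ ≤ C) (b : SummableSeq) :
    seqLift v C hv b = ∑' n, b n • v n := rfl

@[simp]
theorem seqLift_single (v : ℕ → Y) (C : ℝ) (hv : ∀ n, ‖v n‖ ≤ C) (n : ℕ) :
    seqLift v C hv (lp.single 1 n 1) = v n := by
  rw [seqLift_apply, tsum_eq_single n, lp.single_apply_self, one_smul]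
  intro k hk
  rw [lp.single_apply_ne _ _ _ hk, zero_smul]

theorem norm_seqLift_le (v : ℕ → Y) {C : ℝ} (hC : 0 ≤ C) (hv : ∀ n, ‖v n‖ ≤ C) :
    ‖seqLift v C hv‖ ≤ C := LinearMap.mkContinuous_norm_le _ hC _

/-- The functional calculus `b ↦ ∑ bₙ R ^ n` of a contraction `R`. -/
def seqCalc (R : Y →L[ℂ] Y) (hR : ‖R‖ ≤ 1) : SummableSeq →L[ℂ] (Y →L[ℂ] Y) :=
  seqLift (fun n => R ^ n) 1 (norm_clm_pow_le hR)

theorem norm_seqCalc_le (R : Y →L[ℂ] Y) (hR : ‖R‖ ≤ 1) (b : SummableSeq) :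
    ‖seqCalc R hR b‖ ≤ ‖b‖ := by
  simpa using (seqCalc R hR).le_of_opNorm_le (norm_seqLift_le _ zero_le_one _) b

theorem seqCalc_single (R : Y →L[ℂ] Y) (hR : ‖R‖ ≤ 1) (n : ℕ) (y : Y) :
    seqCalc R hR (lp.single 1 n 1) y = (R ^ n) y := by
  rw [seqCalc, seqLift_single]

theorem seqCalc_apply (R : Y →L[ℂ] Y) (hR : ‖R‖ ≤ 1) (b : SummableSeq) (y : Y) :
    seqCalc R hR b y = ∑' n, b n • (R ^ n) y := by
  have : (ContinuousLinearMap.apply ℂ Y y) ∘L seqCalc R hR =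
      seqLift (fun n => (R ^ n) y) ‖y‖ (fun n => by
        simpa using (R ^ n).le_of_opNorm_le (norm_clm_pow_le hR n) y) := by
    refine SummableSeq.clm_ext fun n => ?_
    rw [seqLift_single]
    exact seqCalc_single R hR n y
  exact congrArg (fun T : SummableSeq →L[ℂ] Y => T b) this

/-- It suffices to compare both sides on the unit sequences, where they are powers of `R` and `R'`.
-/
theorem seqCalc_intertwine {Y' : Type*} [NormedAddCommGroup Y'] [NormedSpace ℂ Y']
    [CompleteSpace Y'] {R : Y →L[ℂ] Y} (hR : ‖R‖ ≤ 1) {R' : Y' →L[ℂ] Y'} (hR' : ‖R'‖ ≤ 1)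
    (T : Y →L[ℂ] Y') (h : ∀ y, T (R y) = R' (T y)) (b : SummableSeq) (y : Y) :
    T (seqCalc R hR b y) = seqCalc R' hR' b (T y) := by
  have hn : ∀ n : ℕ, T ((R ^ n) y) = (R' ^ n) (T y) := by
    intro n
    induction n with
    | zero => rfl
    | succ n ih =>
      rw [pow_succ', pow_succ', mul_apply_eq_comp, mul_apply_eq_comp, h, ih]
  have : T ∘L (ContinuousLinearMap.apply ℂ Y y) ∘L seqCalc R hR =
      (ContinuousLinearMap.apply ℂ Y' (T y)) ∘L seqCalc R' hR' := by
    refine SummableSeq.clm_ext fun n => ?_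
    change T (seqCalc R hR (lp.single 1 n 1) y) = seqCalc R' hR' (lp.single 1 n 1) (T y)
    rw [seqCalc_single, seqCalc_single, hn]
  exact congrArg (fun S : SummableSeq →L[ℂ] Y' => S b) this

theorem norm_single_le (n : ℕ) : ‖(lp.single 1 (n + 1) 1 : SummableSeq)‖ ≤ 1 := by
  rw [lp.norm_single (by simp)]
  simp

/-- The right shift on `ℓ¹`. -/
def seqShift : SummableSeq →L[ℂ] SummableSeq :=
  seqLift (fun n => lp.single 1 (n + 1) 1) 1 norm_single_le

theorem norm_seqShift_le : ‖seqShift‖ ≤ 1 := norm_seqLift_le _ zero_le_one _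

/-- `b ↦ ∑ bₙ R ^ n y` intertwines the shift with `R`. -/
theorem seqCalc_shift (R : Y →L[ℂ] Y) (hR : ‖R‖ ≤ 1) (b : SummableSeq) (y : Y) :
    seqCalc R hR (seqShift b) y = R (seqCalc R hR b y) := by
  have : (ContinuousLinearMap.apply ℂ Y y) ∘L seqCalc R hR ∘L seqShift =
      R ∘L (ContinuousLinearMap.apply ℂ Y y) ∘L seqCalc R hR := by
    refine SummableSeq.clm_ext fun n => ?_
    change seqCalc R hR (seqShift (lp.single 1 n 1)) y = R (seqCalc R hR (lp.single 1 n 1) y)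
    rw [seqShift, seqLift_single, seqCalc_single, seqCalc_single, pow_succ',
      mul_apply_eq_comp]
  exact congrArg (fun S : SummableSeq →L[ℂ] Y => S b) this

end Summable

/-! ### Scaled Taylor coefficients in `ℓ¹` -/

section Taylor

open Classical in
/-- The scaled Taylor coefficients `r ^ n g⁽ⁿ⁾(a) / n!` (zero if they are not summable). -/
def taylorSeq (a : ℂ) (r : ℝ) (g : ℂ → ℂ) : SummableSeq :=
  if h : Memℓp (fun n : ℕ => (r : ℂ) ^ n * (iteratedDeriv n g a / (n.factorial : ℂ))) 1
  then ⟨_, h⟩ else 0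

variable {a : ℂ} {r r' : ℝ}

/-- Cauchy's estimate on the larger circle of radius `r'` turns the scaling by `r ^ n` into
geometric decay. -/
theorem norm_taylor_coeff_le (hr : 0 < r) (hrr' : r < r') {g : ℂ → ℂ}
    (hg : AnalyticOnNhd ℂ g (Metric.closedBall a r')) {C : ℝ}
    (hC : ∀ z ∈ Metric.sphere a r', ‖g z‖ ≤ C) (n : ℕ) :
    ‖(r : ℂ) ^ n * (iteratedDeriv n g a / (n.factorial : ℂ))‖ ≤ C * (r / r') ^ n := by
  have hr' : 0 < r' := hr.trans hrr'
  have h1 : DiffContOnCl ℂ g (Metric.ball a r') := by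
    refine DifferentiableOn.diffContOnCl ?_
    rw [closure_ball a hr'.ne']
    exact hg.differentiableOn
  have h2 := Complex.norm_iteratedDeriv_le_of_forall_mem_sphere_norm_le n hr' h1 hC
  have hn : (0 : ℝ) < n.factorial := by positivity
  rw [norm_mul, norm_pow, norm_div, Complex.norm_real, Complex.norm_natCast,
    Real.norm_of_nonneg hr.le]
  calc r ^ n * (‖iteratedDeriv n g a‖ / n.factorial)
      ≤ r ^ n * ((n.factorial * C / r' ^ n) / n.factorial) := by gcongr
    _ = C * (r / r') ^ n := by
        rw [div_pow]
        field_simp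

theorem summable_taylor_coeff (hr : 0 < r) (hrr' : r < r') {g : ℂ → ℂ}
    (hg : AnalyticOnNhd ℂ g (Metric.closedBall a r')) :
    Summable fun n : ℕ => ‖(r : ℂ) ^ n * (iteratedDeriv n g a / (n.factorial : ℂ))‖ := by
  obtain ⟨C, hC⟩ := (isCompact_sphere a r').exists_bound_of_continuousOn
    (hg.continuousOn.mono Metric.sphere_subset_closedBall)
  refine Summable.of_nonneg_of_le (fun n => norm_nonneg _)
    (fun n => norm_taylor_coeff_le hr hrr' hg hC n) ?_
  exact (summable_geometric_of_lt_one (div_nonneg hr.le (hr.trans hrr').le)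
    ((div_lt_one (hr.trans hrr')).2 hrr')).mul_left C

theorem taylorSeq_apply (hr : 0 < r) (hrr' : r < r') {g : ℂ → ℂ}
    (hg : AnalyticOnNhd ℂ g (Metric.closedBall a r')) (n : ℕ) :
    taylorSeq a r g n = (r : ℂ) ^ n * (iteratedDeriv n g a / (n.factorial : ℂ)) := by
  rw [taylorSeq, dif_pos (memℓp_one_iff.2 (summable_taylor_coeff hr hrr' hg))]

theorem norm_taylorSeq_sub_le (hr : 0 < r) (hrr' : r < r') {g g' : ℂ → ℂ}
    (hg : AnalyticOnNhd ℂ g (Metric.closedBall a r'))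
    (hg' : AnalyticOnNhd ℂ g' (Metric.closedBall a r')) {C : ℝ}
    (hC : ∀ z ∈ Metric.sphere a r', ‖g z - g' z‖ ≤ C) :
    ‖taylorSeq a r g - taylorSeq a r g'‖ ≤ C * (1 - r / r')⁻¹ := by
  have hq : r / r' < 1 := (div_lt_one (hr.trans hrr')).2 hrr'
  have hq0 : 0 ≤ r / r' := by have := hr.trans hrr'; positivity
  have ha : a ∈ Metric.closedBall a r' := Metric.mem_closedBall_self (hr.trans hrr').le
  rw [SummableSeq.norm_eq, ← tsum_geometric_of_lt_one hq0 hq, ← tsum_mul_left]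
  refine (SummableSeq.summable _).tsum_le_tsum (fun n => ?_)
    ((summable_geometric_of_lt_one hq0 hq).mul_left C)
  rw [lp.coeFn_sub, Pi.sub_apply, taylorSeq_apply hr hrr' hg, taylorSeq_apply hr hrr' hg',
    ← mul_sub, ← sub_div, ← iteratedDeriv_sub (hg a ha).contDiffAt (hg' a ha).contDiffAt]
  exact norm_taylor_coeff_le hr hrr' (hg.sub hg') hC n

theorem hasSum_taylorSeq (hr : 0 < r) (hrr' : r < r') {g : ℂ → ℂ}
    (hg : AnalyticOnNhd ℂ g (Metric.closedBall a r')) {z : ℂ} (hz : z ∈ Metric.ball a r) :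
    HasSum (fun n => taylorSeq a r g n * ((z - a) / r) ^ n) (g z) := by
  have h := Complex.hasSum_taylorSeries_on_ball (f := g) (c := a) (r := r)
    (hg.differentiableOn.mono ((Metric.ball_subset_ball hrr'.le).trans
      Metric.ball_subset_closedBall)) hz
  refine h.congr_fun fun n => ?_
  have hr0 : (r : ℂ) ≠ 0 := by exact_mod_cast hr.ne'
  rw [taylorSeq_apply hr hrr' hg, div_pow, smul_eq_mul, smul_eq_mul]
  field_simp

/-- If the sums of a power series with coefficients in `ℓ¹` represent `g` then they give
its Taylor coefficients. -/
theorem analyticAt_of_hasSum {r : ℝ} (hr : 0 < r) {g : ℂ → ℂ} (d : SummableSeq)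
    (h : ∀ z ∈ Metric.ball a r, HasSum (fun n => d n * ((z - a) / r) ^ n) (g z)) :
    AnalyticAt ℂ g a ∧ ∀ n : ℕ, iteratedDeriv n g a / (n.factorial : ℂ) = d n / r ^ n := by
  have hps : HasFPowerSeriesOnBall g
      (FormalMultilinearSeries.ofScalars ℂ (fun n => d n / (r : ℂ) ^ n)) a
      (ENNReal.ofReal r) := by
    refine ⟨?_, by simpa using hr, fun {y} hy => ?_⟩
    · refine FormalMultilinearSeries.le_radius_of_bound _ ‖d‖ fun n => ?_
      rw [Real.coe_toNNReal _ hr.le, FormalMultilinearSeries.norm_apply_eq_norm_coef,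
        FormalMultilinearSeries.coeff_ofScalars, norm_div, norm_pow, Complex.norm_real,
        Real.norm_of_nonneg hr.le, div_mul_cancel₀ _ (pow_pos hr n).ne']
      exact lp.norm_apply_le_norm (by simp) d n
    · have hy' : a + y ∈ Metric.ball a r := by
        rw [Metric.eball_ofReal] at hy
        simpa using hy
      refine (h _ hy').congr_fun fun n => ?_
      rw [FormalMultilinearSeries.ofScalars_apply_eq, add_sub_cancel_left, div_pow, smul_eq_mul]
      ring
  refine ⟨hps.analyticAt, fun n => ?_⟩
  have h1 := hps.hasFPowerSeriesAt.eq_formalMultilinearSeries hps.analyticAt.hasFPowerSeriesAt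
  have h2 := congrArg (fun p => FormalMultilinearSeries.coeff p n) h1
  simp only [FormalMultilinearSeries.coeff_ofScalars] at h2
  exact h2.symm

end Taylor

/-! ### Families of complex operators and the universal solution in `ℓ¹` -/

section ComplexFamily

variable {Y : Type*} [NormedAddCommGroup Y] [NormedSpace ℂ Y] {Y' : Type*}
  [NormedAddCommGroup Y'] [NormedSpace ℂ Y']

/-- A family of complex linear operators, as a family of real linear operators. -/
def realFamily (Φ : ℝ →ᵇ (Y →L[ℂ] Y)) : ℝ →ᵇ (Y →L[ℝ] Y) :=
  (ContinuousLinearMap.restrictScalarsL ℂ Y Y ℝ ℝ).compLeftContinuousBounded ℝ Φ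

@[simp]
theorem realFamily_apply (Φ : ℝ →ᵇ (Y →L[ℂ] Y)) (α : ℝ) (y : Y) :
    realFamily Φ α y = Φ α y := rfl

theorem norm_realFamily_le (Φ : ℝ →ᵇ (Y →L[ℂ] Y)) : ‖realFamily Φ‖ ≤ ‖Φ‖ :=
  (BoundedContinuousFunction.norm_le (norm_nonneg _)).2 fun α =>
    ContinuousLinearMap.opNorm_le_bound _ (norm_nonneg _) fun y =>
      (Φ α).le_of_opNorm_le (Φ.norm_coe_le_norm α) y

variable (σ : ℝ≥0) (lam : Measure ℝ) (m : ℕ) (μ : ℝ)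

/-- The shift `σ` is so large that the Volterra operators of all families of norm at most `M`
are contractions. -/
def IsLarge (M : ℝ) : Prop :=
  Real.exp (-(σ * (μ - (m - 1)))) * (M * lam.real univ) < 1

variable {σ lam m μ}

theorem exists_isLarge (hμ₁ : (m : ℝ) - 1 < μ) (M : ℝ) : ∃ σ : ℝ≥0, IsLarge σ lam m μ M := by
  have h1 : Tendsto (fun s : ℝ => s * (μ - (m - 1))) atTop atTop :=
    tendsto_id.atTop_mul_const (sub_pos.2 hμ₁)
  have h2 : Tendsto (fun s : ℝ => Real.exp (-(s * (μ - (m - 1)))) * (M * lam.real univ))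
      atTop (𝓝 (0 * (M * lam.real univ))) :=
    (Real.tendsto_exp_neg_atTop_nhds_zero.comp h1).mul_const _
  rw [zero_mul] at h2
  obtain ⟨s, hs, hs0⟩ := ((h2.eventually_lt_const one_pos).and (eventually_ge_atTop 0)).exists
  exact ⟨⟨s, hs0⟩, hs⟩

variable [IsFiniteMeasure lam]

theorem norm_volterraOp_lt_one {M : ℝ} (hσ : IsLarge σ lam m μ M) {Φ : ℝ →ᵇ (Y →L[ℂ] Y)}
    (hΦ : ‖Φ‖ ≤ M) : ‖volterraOp σ (realFamily Φ) lam m μ‖ < 1 := by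
  refine lt_of_le_of_lt ?_ hσ
  refine (norm_convOp_le σ _ _ μ (Real.exp_pos _).le ?_).trans
    (mul_le_mul_of_nonneg_left (mul_le_mul ((norm_realFamily_le Φ).trans hΦ) ?_
      measureReal_nonneg ((norm_nonneg Φ).trans hΦ)) (Real.exp_pos _).le)
  · filter_upwards [ae_restrict_mem measurableSet_Icc] with α hα
    refine Real.exp_le_exp.2 (neg_le_neg (mul_le_mul_of_nonneg_left ?_ σ.2))
    exact le_trans (by linarith [hα.2]) (Real.le_coe_toNNReal _)
  · rw [measureReal_restrict_apply MeasurableSet.univ, univ_inter]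
    exact measureReal_mono (subset_univ _)

variable [CompleteSpace Y] [CompleteSpace Y']

theorem complex_solution_intertwine {M : ℝ} (hσ : IsLarge σ lam m μ M)
    {Φ : ℝ →ᵇ (Y →L[ℂ] Y)} (hΦ : ‖Φ‖ ≤ M) {Φ' : ℝ →ᵇ (Y' →L[ℂ] Y')} (hΦ' : ‖Φ'‖ ≤ M)
    (T : Y →L[ℂ] Y') (h : ∀ α y, T (Φ α y) = Φ' α (T y)) (k : ℕ) (φ : Y) (t : ℝ) :
    T (solution σ (realFamily Φ) lam m μ k φ t) =
      solution σ (realFamily Φ') lam m μ k (T φ) t :=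
  solution_intertwine (norm_volterraOp_lt_one hσ hΦ) (norm_volterraOp_lt_one hσ hΦ')
    (T.restrictScalars ℝ) h φ t

/-- The family of operators `∑ₙ b(α)ₙ R ^ n`. -/
def calcFamily (R : Y →L[ℂ] Y) (hR : ‖R‖ ≤ 1) (b : ℝ →ᵇ SummableSeq) :
    ℝ →ᵇ (Y →L[ℂ] Y) :=
  (seqCalc R hR).compLeftContinuousBounded ℝ b

theorem calcFamily_apply (R : Y →L[ℂ] Y) (hR : ‖R‖ ≤ 1) (b : ℝ →ᵇ SummableSeq) (α : ℝ) :
    calcFamily R hR b α = seqCalc R hR (b α) := rfl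

theorem norm_calcFamily_le (R : Y →L[ℂ] Y) (hR : ‖R‖ ≤ 1) (b : ℝ →ᵇ SummableSeq) :
    ‖calcFamily R hR b‖ ≤ ‖b‖ :=
  (BoundedContinuousFunction.norm_le (norm_nonneg _)).2 fun α =>
    (norm_seqCalc_le R hR _).trans (b.norm_coe_le_norm α)

/-- The solution for the shift on `ℓ¹` with the initial datum `e₀`. It consists of the scaled
Taylor coefficients of the symbol of the solution operator. -/
def solutionSeq (σ : ℝ≥0) (lam : Measure ℝ) [IsFiniteMeasure lam] (m : ℕ) (μ : ℝ)
    (b : ℝ →ᵇ SummableSeq) (k : ℕ) (t : ℝ) : SummableSeq :=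
  solution σ (realFamily (calcFamily seqShift norm_seqShift_le b)) lam m μ k
    (lp.single 1 0 1) t

/-- The map `b ↦ ∑ bₙ R ^ n y` intertwines the calculus of the shift with that of `R` and sends `e₀`
to `y`. A common bound `M` permits the same `σ` on both sides. -/
theorem seqCalc_solutionSeq {M : ℝ} (hσ : IsLarge σ lam m μ M) {b : ℝ →ᵇ SummableSeq}
    (hb : ‖b‖ ≤ M) (R : Y →L[ℂ] Y) (hR : ‖R‖ ≤ 1) (k : ℕ) (t : ℝ) (y : Y) :
    seqCalc R hR (solutionSeq σ lam m μ b k t) y =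
      solution σ (realFamily (calcFamily R hR b)) lam m μ k y t := by
  have h := complex_solution_intertwine hσ ((norm_calcFamily_le seqShift norm_seqShift_le b).trans hb)
    ((norm_calcFamily_le R hR b).trans hb) ((ContinuousLinearMap.apply ℂ Y y) ∘L seqCalc R hR)
    (fun α d => seqCalc_intertwine norm_seqShift_le hR
      ((ContinuousLinearMap.apply ℂ Y y) ∘L seqCalc R hR)
      (fun d => seqCalc_shift R hR d y) (b α) d) k (lp.single 1 0 1) t
  have h1 : ((ContinuousLinearMap.apply ℂ Y y) ∘L seqCalc R hR) (lp.single 1 0 1) = y :=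
    seqCalc_single R hR 0 y
  rw [h1] at h
  exact h

/-- The diagonal family of operators on a finite product. -/
def piFamily {ι : Type*} [Fintype ι] {Z : ι → Type*} [∀ i, NormedAddCommGroup (Z i)]
    [∀ i, NormedSpace ℂ (Z i)] (Φ : ∀ i, ℝ →ᵇ (Z i →L[ℂ] Z i)) (M : ℝ) (hM : 0 ≤ M)
    (h : ∀ i, ‖Φ i‖ ≤ M) : ℝ →ᵇ ((∀ i, Z i) →L[ℂ] ∀ i, Z i) :=
  BoundedContinuousFunction.ofNormedAddCommGroup
    (fun α => ContinuousLinearMap.pi fun i => Φ i α ∘L ContinuousLinearMap.proj i)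
    (by
      classical
      have e : (fun α => ContinuousLinearMap.pi fun i => Φ i α ∘L ContinuousLinearMap.proj i) =
          fun α => ∑ i, ContinuousLinearMap.single ℂ Z i ∘L Φ i α ∘L
            ContinuousLinearMap.proj i := by
        funext α
        ext z j
        simp
      rw [e]
      exact continuous_finsetSum _ fun i _ =>
        continuous_const.clm_comp ((Φ i).continuous.clm_comp continuous_const))
    M fun α => ContinuousLinearMap.opNorm_le_bound _ hM fun z =>
      (pi_norm_le_iff_of_nonneg (by positivity)).2 fun i =>
        ((Φ i α).le_of_opNorm_le (((Φ i).norm_coe_le_norm α).trans (h i)) (z i)).trans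
          (mul_le_mul_of_nonneg_left (norm_le_pi_norm z i) hM)

theorem norm_piFamily_le {ι : Type*} [Fintype ι] {Z : ι → Type*}
    [∀ i, NormedAddCommGroup (Z i)] [∀ i, NormedSpace ℂ (Z i)]
    (Φ : ∀ i, ℝ →ᵇ (Z i →L[ℂ] Z i)) {M : ℝ} (hM : 0 ≤ M) (h : ∀ i, ‖Φ i‖ ≤ M) :
    ‖piFamily Φ M hM h‖ ≤ M :=
  BoundedContinuousFunction.norm_ofNormedAddCommGroup_le _ hM _

end ComplexFamily

/-! ### From the `ℓ¹` solution to the symbol `S_k(t, z)` -/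

section Symbol

theorem exists_taylorFamily {a : ℂ} {r r' : ℝ} (hr : 0 < r) (hrr' : r < r') {p q : ℝ}
    (hpq : p ≤ q) {f : ℝ → ℂ → ℂ}
    (hf : ContinuousOn (fun x : ℝ × ℂ => f x.1 x.2) (Icc p q ×ˢ Metric.closedBall a r'))
    (hfa : ∀ α ∈ Icc p q, AnalyticOnNhd ℂ (f α) (Metric.closedBall a r')) :
    ∃ b : ℝ →ᵇ SummableSeq, ∀ α ∈ Icc p q, b α = taylorSeq a r (f α) := by
  have hr' : 0 < r' := hr.trans hrr'
  have hq : 0 < (1 - r / r')⁻¹ := inv_pos.2 (sub_pos.2 ((div_lt_one hr').2 hrr'))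
  have hc : ContinuousOn (fun α => taylorSeq a r (f α)) (Icc p q) := by
    have huc := (isCompact_Icc.prod (isCompact_closedBall a r')).uniformContinuousOn_of_continuous hf
    rw [Metric.uniformContinuousOn_iff] at huc
    rw [Metric.continuousOn_iff]
    intro α hα ε hε
    obtain ⟨δ, hδ, h⟩ := huc (ε / 2 / (1 - r / r')⁻¹) (by positivity)
    refine ⟨δ, hδ, fun β hβ hd => ?_⟩
    rw [dist_eq_norm]
    refine (norm_taylorSeq_sub_le hr hrr' (hfa β hβ) (hfa α hα)
      (C := ε / 2 / (1 - r / r')⁻¹) fun z hz => ?_).trans_lt ?_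
    · have hz' := Metric.sphere_subset_closedBall hz
      have := h (β, z) ⟨hβ, hz'⟩ (α, z) ⟨hα, hz'⟩ (by rw [Prod.dist_eq, dist_self]; exact max_lt hd hδ)
      rw [← dist_eq_norm]
      exact this.le
    · rw [div_mul_cancel₀ _ hq.ne']
      linarith
  -- Outside `[p, q]` the family is continued by its endpoint values.
  refine ⟨(mkOfCompact ⟨_, continuousOn_iff_continuous_domRestrict.1 hc⟩).compContinuous
    ⟨projIcc p q hpq, continuous_projIcc⟩, fun α hα => ?_⟩
  simp [projIcc_of_mem hpq hα]

/-- Multiplication by a number in the closed unit disc. -/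
def scalarOp (w : ℂ) : ℂ →L[ℂ] ℂ := w • ContinuousLinearMap.id ℂ ℂ

theorem norm_scalarOp_le {w : ℂ} (hw : ‖w‖ ≤ 1) : ‖scalarOp w‖ ≤ 1 :=
  ContinuousLinearMap.opNorm_le_bound _ zero_le_one fun y => by
    simpa [scalarOp] using mul_le_mul_of_nonneg_right hw (norm_nonneg y)

theorem scalarOp_pow_apply (w : ℂ) (n : ℕ) (y : ℂ) : (scalarOp w ^ n) y = w ^ n * y := by
  simp [scalarOp, smul_pow]

theorem seqCalc_scalarOp {w : ℂ} (hw : ‖w‖ ≤ 1) (d : SummableSeq) (y : ℂ) :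
    seqCalc (scalarOp w) (norm_scalarOp_le hw) d y = (∑' n, d n * w ^ n) * y := by
  rw [seqCalc_apply, ← tsum_mul_right]
  simp only [scalarOp_pow_apply, smul_eq_mul, mul_assoc]

theorem realFamily_scalarOp_apply {w : ℂ} (hw : ‖w‖ ≤ 1) (b : ℝ →ᵇ SummableSeq) (α : ℝ)
    (y : ℂ) : realFamily (calcFamily (scalarOp w) (norm_scalarOp_le hw) b) α y =
      realFamily (calcFamily (scalarOp w) (norm_scalarOp_le hw) b) α 1 * y := by
  simp only [realFamily_apply, calcFamily_apply, seqCalc_scalarOp hw, mul_one]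

theorem norm_div_le_one {a z : ℂ} {r : ℝ} (hr : 0 < r) (hz : z ∈ Metric.ball a r) :
    ‖(z - a) / r‖ ≤ 1 := by
  rw [norm_div, Complex.norm_real, Real.norm_of_nonneg hr.le, div_le_one hr, ← dist_eq_norm]
  exact (Metric.mem_ball.1 hz).le

theorem calcFamily_scalarOp {a z : ℂ} {r r' : ℝ} (hr : 0 < r) (hrr' : r < r')
    (hz : z ∈ Metric.ball a r) {b : ℝ →ᵇ SummableSeq} {g : ℂ → ℂ} {α : ℝ}
    (hb : b α = taylorSeq a r g) (hg : AnalyticOnNhd ℂ g (Metric.closedBall a r')) :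
    calcFamily (scalarOp ((z - a) / r)) (norm_scalarOp_le (norm_div_le_one hr hz)) b α 1 =
      g z := by
  rw [calcFamily_apply, seqCalc_scalarOp (norm_div_le_one hr hz), hb, (hasSum_taylorSeq hr hrr' hg hz).tsum_eq, mul_one]

variable {σ : ℝ≥0} {lam : Measure ℝ} [IsFiniteMeasure lam] {m : ℕ} {μ : ℝ} {f : ℝ → ℂ → ℂ}

/-- The universal solution is evaluated with `R` equal to multiplication by `(z - a) / r`, and the
resulting scalar solution is the symbol. -/
theorem hasSum_solutionSeq {M : ℝ} (hσ : IsLarge σ lam m μ M) (hμ₁ : (m : ℝ) - 1 < μ)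
    {a : ℂ} {r r' : ℝ} (hr : 0 < r) (hrr' : r < r') {b : ℝ →ᵇ SummableSeq} (hbM : ‖b‖ ≤ M)
    (hb : ∀ α ∈ Icc 0 ((m : ℝ) - 1), b α = taylorSeq a r (f α))
    (hfa : ∀ α ∈ Icc 0 ((m : ℝ) - 1), AnalyticOnNhd ℂ (f α) (Metric.closedBall a r'))
    {k : ℕ} (hk : (k : ℝ) ≤ m - 1) {t : ℝ} (ht : 0 ≤ t) {z : ℂ} (hz : z ∈ Metric.ball a r) :
    HasSum (fun n => solutionSeq σ lam m μ b k t n * ((z - a) / r) ^ n)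
      (solFn m μ lam f k t z) := by
  have hw := norm_div_le_one hr hz
  have h1 := seqCalc_solutionSeq hσ hbM _ (norm_scalarOp_le hw) k t 1
  have h2 := solFn_eq_solution (norm_volterraOp_lt_one hσ ((norm_calcFamily_le _
    (norm_scalarOp_le hw) b).trans hbM)) (f := f) (z := z)
    (realFamily_scalarOp_apply hw b)
    (fun α hα => calcFamily_scalarOp hr hrr' hz (hb α hα) (hfa α hα)) hμ₁ hk ht
  have hs : Summable fun n => solutionSeq σ lam m μ b k t n * ((z - a) / r) ^ n :=
    Summable.of_norm_bounded (SummableSeq.summable _) fun n => by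
      rw [norm_mul, norm_pow]
      exact mul_le_of_le_one_right (norm_nonneg _) (pow_le_one₀ (norm_nonneg _) hw)
  rw [h2, ← h1, seqCalc_scalarOp hw, mul_one]
  exact hs.hasSum

end Symbol

/-! ### The spaces of exponential type: bounded restriction and completeness -/

section ExpSpace

variable {X : Type*} [NormedAddCommGroup X] [NormedSpace ℂ X] {A : X →ₗ.[ℂ] X} {ν : ℝ≥0}

theorem ExpSpace.norm_iterate_le (v : ExpSpace A ν) (k : ℕ) :
    ‖(act A)^[k] v.val‖ ≤ ‖v‖ * (ν : ℝ) ^ k := by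
  have h0 : 0 ≤ (ν : ℝ) ^ k := by positivity
  -- When `ν ^ k = 0` the quotient in the norm is `0` by convention and carries no information; the
  -- defining growth bound forces the iterate to vanish.
  rcases h0.eq_or_lt with h | h
  · obtain ⟨M, -, hM⟩ := v.isExpType.bound
    simpa [← h] using hM k
  · rw [← div_le_iff₀ h, v.norm_def]
    exact le_ciSup v.bddAbove k

theorem ExpSpace.norm_le (v : ExpSpace A ν) {C : ℝ} (hC : 0 ≤ C)
    (h : ∀ k, ‖(act A)^[k] v.val‖ ≤ C * (ν : ℝ) ^ k) : ‖v‖ ≤ C := by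
  rw [v.norm_def]
  exact ciSup_le fun k => div_le_of_le_mul₀ (by positivity) hC (h k)

theorem iterate_restr_val (v : ExpSpace A ν) (n : ℕ) :
    ((restr A ν ^ n) v).val = (act A)^[n] v.val := by
  induction n with
  | zero => rfl
  | succ n ih =>
    rw [pow_succ', Function.iterate_succ_apply', ← ih]
    rfl

/-- The operator `A` on `Exp_{A, ν}(X)`, as a bounded operator. -/
def restrCLM (A : X →ₗ.[ℂ] X) (ν : ℝ≥0) : ExpSpace A ν →L[ℂ] ExpSpace A ν :=
  (restr A ν).mkContinuous ν fun v => by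
    refine ExpSpace.norm_le _ (by positivity) fun k => ?_
    have h := v.norm_iterate_le (k + 1)
    rw [Function.iterate_succ_apply] at h
    exact h.trans (le_of_eq (by ring))

theorem norm_restrCLM_le : ‖restrCLM A ν‖ ≤ ν :=
  LinearMap.mkContinuous_norm_le _ ν.2 _

theorem restrCLM_pow_apply (n : ℕ) (v : ExpSpace A ν) :
    (restrCLM A ν ^ n) v = (restr A ν ^ n) v := by
  induction n with
  | zero => rfl
  | succ n ih =>
    rw [pow_succ', pow_succ', mul_apply_eq_comp, ih]
    rfl

theorem act_eq_of_mem_graph {x y : X} (h : (x, y) ∈ A.graph) :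
    x ∈ A.domain ∧ act A x = y := by
  obtain ⟨z, hz, hz'⟩ := LinearPMap.mem_graph_iff A |>.1 h
  have hz₁ : (z : X) = x := hz
  have hx : x ∈ A.domain := hz₁ ▸ z.2
  refine ⟨hx, ?_⟩
  rw [act, dif_pos hx]
  exact (congrArg A (Subtype.ext hz₁.symm)).trans hz'

theorem mem_graph_act {x : X} (h : x ∈ A.domain) : (x, act A x) ∈ A.graph := by
  rw [act, dif_pos h]
  exact A.mem_graph ⟨x, h⟩

theorem isClosed_shift (hA : A.IsClosed) (a : ℂ) : (shift A a).IsClosed := by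
  have h : ((shift A a).graph : Set (X × X)) =
      (fun p : X × X => (p.1, p.2 + a • p.1)) ⁻¹' (A.graph : Set (X × X)) := by
    ext ⟨x, y⟩
    simp only [mem_preimage, SetLike.mem_coe, LinearPMap.mem_graph_iff]
    constructor
    · rintro ⟨z, hz, hz'⟩
      refine ⟨z, hz, ?_⟩
      change A z - a • (z : X) = y at hz'
      rw [← hz', ← hz, sub_add_cancel]
    · rintro ⟨z, hz, hz'⟩
      refine ⟨z, hz, ?_⟩
      change A z - a • (z : X) = y
      rw [hz', hz, add_sub_cancel_right]
  rw [LinearPMap.IsClosed, h]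
  exact IsClosed.preimage (by fun_prop) hA

theorem ExpSpace.val_sub (v w : ExpSpace A ν) : (v - w).val = v.val - w.val := rfl

theorem ExpSpace.iterate_sub (v w : ExpSpace A ν) (k : ℕ) :
    (act A)^[k] (v - w).val = (act A)^[k] v.val - (act A)^[k] w.val := by
  rw [← iterate_restr_val, ← iterate_restr_val, ← iterate_restr_val, map_sub, val_sub]

/-- All iterates of a Cauchy sequence converge in `X`, and closedness of the graph shows step by
step that their limits are the iterates of the first limit. -/
theorem completeSpace_expSpace [CompleteSpace X] (hA : A.IsClosed) :
    CompleteSpace (ExpSpace A ν) := by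
  refine Metric.complete_of_cauchySeq_tendsto fun v hv => ?_
  have hc : ∀ k, CauchySeq fun n => (act A)^[k] (v n).val := by
    intro k
    rw [Metric.cauchySeq_iff'] at hv ⊢
    intro ε hε
    obtain ⟨N, hN⟩ := hv (ε / ((ν : ℝ) ^ k + 1)) (by positivity)
    refine ⟨N, fun n hn => ?_⟩
    rw [dist_eq_norm, ← ExpSpace.iterate_sub]
    have h1 := hN n hn
    rw [dist_eq_norm, lt_div_iff₀ (by positivity)] at h1
    refine ((v n - v N).norm_iterate_le k).trans_lt (lt_of_le_of_lt ?_ h1)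
    exact mul_le_mul_of_nonneg_left (by linarith) (norm_nonneg _)
  choose y hy using fun k => cauchySeq_tendsto_of_complete (hc k)
  have hstep : ∀ k, y k ∈ A.domain ∧ act A (y k) = y (k + 1) := fun k =>
    act_eq_of_mem_graph (hA.mem_of_tendsto ((hy k).prodMk_nhds (hy (k + 1)))
      (Eventually.of_forall fun n => by
        simp only [Function.iterate_succ_apply']
        exact mem_graph_act ((v n).isExpType.1 k)))
  have hiter : ∀ k, (act A)^[k] (y 0) = y k := by
    intro k
    induction k with
    | zero => rfl
    | succ k ih => rw [Function.iterate_succ_apply', ih, (hstep k).2]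
  obtain ⟨C, hC⟩ := hv.norm_bddAbove
  have hexp : IsExpType A ν (y 0) := by
    refine isExpType_of_bound (M := C) (fun k => ?_) fun k => ?_
    · rw [hiter]
      exact (hstep k).1
    · rw [hiter]
      refine le_of_tendsto (hy k).norm (Eventually.of_forall fun n => ?_)
      exact ((v n).norm_iterate_le k).trans
        (mul_le_mul_of_nonneg_right (hC ⟨n, rfl⟩) (by positivity))
  refine ⟨(⟨y 0, hexp⟩ : ↥(expSubmodule A ν)), ?_⟩
  set w : ExpSpace A ν := (⟨y 0, hexp⟩ : ↥(expSubmodule A ν))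
  rw [Metric.tendsto_atTop]
  intro ε hε
  obtain ⟨N, hN⟩ := Metric.cauchySeq_iff.1 hv (ε / 2) (by positivity)
  refine ⟨N, fun n hn => lt_of_le_of_lt ?_ (half_lt_self hε)⟩
  rw [dist_eq_norm]
  refine ExpSpace.norm_le _ (by positivity) fun k => ?_
  rw [ExpSpace.iterate_sub]
  have hw : (act A)^[k] w.val = y k := hiter k
  rw [hw]
  refine le_of_tendsto (tendsto_const_nhds.sub (hy k)).norm ?_
  filter_upwards [eventually_ge_atTop N] with p hp
  rw [← ExpSpace.iterate_sub]
  refine ((v n - v p).norm_iterate_le k).trans (mul_le_mul_of_nonneg_right ?_ (by positivity))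
  rw [← dist_eq_norm]
  exact (hN n hn p hp).le

end ExpSpace

/-! ### The local calculus as the calculus of a contraction -/

section LocalCalc

variable {X : Type*} [NormedAddCommGroup X] [NormedSpace ℂ X] {A : X →ₗ.[ℂ] X} {ν : ℝ≥0}

/-- The contraction `r⁻¹ A` on `Exp_{A, ν}(X)`, where `ν ≤ r`. -/
def scaledRestr (A : X →ₗ.[ℂ] X) (ν : ℝ≥0) (r : ℝ) : ExpSpace A ν →L[ℂ] ExpSpace A ν :=
  (r : ℂ)⁻¹ • restrCLM A ν

theorem norm_scaledRestr_le {r : ℝ} (hr : 0 < r) (hν : (ν : ℝ) < r) :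
    ‖scaledRestr A ν r‖ ≤ 1 := by
  rw [scaledRestr, norm_smul, norm_inv, Complex.norm_real, Real.norm_of_nonneg hr.le,
    inv_mul_le_one₀ hr]
  exact norm_restrCLM_le.trans hν.le

theorem localCalc_eq_seqCalc {a : ℂ} [CompleteSpace (ExpSpace (shift A a) ν)] {r : ℝ}
    (hr : 0 < r) (hν : (ν : ℝ) < r) {g : ℂ → ℂ} {d : SummableSeq}
    (hd : ∀ n : ℕ, iteratedDeriv n g a / (n.factorial : ℂ) = d n / r ^ n)
    (v : ExpSpace (shift A a) ν) :
    localCalc A a ν g v =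
      seqCalc (scaledRestr (shift A a) ν r) (norm_scaledRestr_le hr hν) d v := by
  rw [seqCalc_apply, localCalc]
  refine tsum_congr fun n => ?_
  rw [hd, scaledRestr, smul_pow, _root_.smul_apply, restrCLM_pow_apply, smul_smul,
    inv_pow, div_eq_mul_inv]

theorem exists_closedBall_subset {G : Set ℂ} (hG : IsOpen G) {a : ℂ} (ha : a ∈ G)
    (hν : (ν : ℝ≥0∞) < Metric.infEDist a (frontier G)) :
    ∃ r r' : ℝ, 0 < r ∧ (ν : ℝ) < r ∧ r < r' ∧ Metric.closedBall a r' ⊆ G := by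
  -- The distance to the frontier is infinite when the frontier is empty, so a finite radius is
  -- inserted.
  obtain ⟨ρ, hνρ, hρ⟩ := ENNReal.lt_iff_exists_nnreal_btwn.1 hν
  have hνρ' : (ν : ℝ) < ρ := by exact_mod_cast hνρ
  have hρ0 : (0 : ℝ) < ρ := ν.2.trans_lt hνρ'
  have hball : Metric.ball a ρ ⊆ G := by
    -- The ball misses the frontier, so it is covered by the disjoint open sets `G` and the
    -- complement of `closure G`; being connected and meeting `G`, it lies in `G`.
    refine IsPreconnected.subset_left_of_subset_union hG isClosed_closure.isOpen_compl
      (disjoint_compl_right.mono_left subset_closure) (fun z hz => ?_)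
      ⟨a, Metric.mem_ball_self hρ0, ha⟩ (convex_ball a (ρ : ℝ)).isPreconnected
    by_contra hzG
    rw [mem_union, not_or, notMem_compl_iff] at hzG
    have hfr : z ∈ frontier G := by
      rw [hG.frontier_eq]
      exact ⟨hzG.2, hzG.1⟩
    have h1 := hρ.trans_le (Metric.infEDist_le_edist_of_mem hfr)
    rw [edist_comm, edist_nndist, ENNReal.coe_lt_coe, ← NNReal.coe_lt_coe, coe_nndist] at h1
    exact h1.not_gt (Metric.mem_ball.1 hz)
  refine ⟨ν + (ρ - ν) / 3, ν + 2 * (ρ - ν) / 3, ?_, ?_, ?_, ?_⟩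
  · have := ν.2; linarith
  · linarith
  · linarith
  · exact (Metric.closedBall_subset_ball (by linarith)).trans hball

end LocalCalc

/-! ### Assembly: scalar data, superposition and uniqueness, action on `Exp_{A - a I, ν}(X)` -/

section Main

variable {σ : ℝ≥0} {lam : Measure ℝ} {m : ℕ} {μ : ℝ} {f : ℝ → ℂ → ℂ}

/-- The data of the scalar problem at `z` for a suitable shift `σ`. -/
theorem exists_scalarFamily {G : Set ℂ} (hG : IsOpen G) (hm : 1 ≤ m) (hμ₁ : (m : ℝ) - 1 < μ)
    (hf : ContinuousOn (fun p : ℝ × ℂ => f p.1 p.2) (Icc 0 ((m : ℝ) - 1) ×ˢ G))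
    (hfa : ∀ α ∈ Icc (0 : ℝ) ((m : ℝ) - 1), AnalyticOnNhd ℂ (f α) G) {z : ℂ} (hz : z ∈ G) :
    ∃ (σ : ℝ≥0) (M r r' : ℝ) (b : ℝ →ᵇ SummableSeq), IsLarge σ lam m μ M ∧ 0 < r ∧ r < r' ∧
      ‖b‖ ≤ M ∧ (∀ α ∈ Icc 0 ((m : ℝ) - 1), b α = taylorSeq z r (f α)) ∧
      ∀ α ∈ Icc 0 ((m : ℝ) - 1), AnalyticOnNhd ℂ (f α) (Metric.closedBall z r') := by
  have hm' : (0 : ℝ) ≤ (m : ℝ) - 1 := sub_nonneg.2 (by exact_mod_cast hm)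
  obtain ⟨ε, hε, hball⟩ := Metric.nhds_basis_closedBall.mem_iff.1 (hG.mem_nhds hz)
  obtain ⟨b, hb⟩ := exists_taylorFamily (half_pos hε) (half_lt_self hε) hm'
    (hf.mono (prod_mono_right hball)) fun α hα => (hfa α hα).mono hball
  obtain ⟨σ, hσ⟩ := exists_isLarge (lam := lam) hμ₁ ‖b‖
  exact ⟨σ, ‖b‖, ε / 2, ε, b, hσ, half_pos hε, half_lt_self hε, le_rfl, hb,
    fun α hα => (hfa α hα).mono hball⟩

variable [IsFiniteMeasure lam]

theorem isSolution_and_unique {E : Type*} [NormedAddCommGroup E] [NormedSpace ℂ E]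
    [CompleteSpace E] (hm : 1 ≤ m) (hμ₁ : (m : ℝ) - 1 < μ) (hμ₂ : μ ≤ m) {M : ℝ}
    (hσ : IsLarge σ lam m μ M) {Φ : ℝ →ᵇ (E →L[ℂ] E)} (hΦ : ‖Φ‖ ≤ M) {B : ℝ → E → E}
    (hB : ∀ α ∈ Icc (0 : ℝ) ((m : ℝ) - 1), ∀ y, B α y = Φ α y) {S : ℕ → ℝ → E → E}
    (hS : ∀ k : Fin m, ∀ t : ℝ, 0 ≤ t → ∀ φ,
      S k t φ = solution σ (realFamily Φ) lam m μ k φ t) :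
    (∀ (k : Fin m) (φ : E), IsSolution m μ lam B (Pi.single k φ) (fun t => S k t φ)) ∧
    (∀ φ : Fin m → E, IsSolution m μ lam B φ (fun t => ∑ k : Fin m, S k t (φ k)) ∧
      ∀ v : ℝ → E, IsSolution m μ lam B φ v →
        ∀ t : ℝ, 0 ≤ t → v t = ∑ k : Fin m, S k t (φ k)) := by
  have hC := norm_volterraOp_lt_one hσ hΦ
  have hB' : ∀ α ∈ Icc (0 : ℝ) ((m : ℝ) - 1), ∀ y, B α y = realFamily Φ α y := hB
  have h1 : ∀ (k : Fin m) (φ : E),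
      IsSolution m μ lam B (Pi.single k φ) (fun t => S k t φ) := fun k φ =>
    isSolution_solution hμ₁ hμ₂ hC hB' φ fun t ht => hS k t ht φ
  -- The zero solution is obtained as a solution minus itself; it starts the induction over finite
  -- sums.
  have h0 : IsSolution m μ lam B 0 fun _ => 0 := by
    have h := (h1 ⟨0, hm⟩ 0).add_smul hμ₂ hB' (h1 ⟨0, hm⟩ 0) (-1)
    simpa using h
  have hsum : ∀ (φ : Fin m → E) (s : Finset (Fin m)),
      IsSolution m μ lam B (∑ k ∈ s, Pi.single k (φ k)) (fun t => ∑ k ∈ s, S k t (φ k)) := by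
    intro φ s
    induction s using Finset.cons_induction with
    | empty => simpa using h0
    | cons k s hk ih =>
      have h := (h1 k (φ k)).add_smul hμ₂ hB' ih 1
      simpa only [Finset.sum_cons, one_smul] using h
  have h2 : ∀ φ : Fin m → E,
      IsSolution m μ lam B φ (fun t => ∑ k : Fin m, S k t (φ k)) := fun φ => by
    simpa [Finset.univ_sum_single] using hsum φ Finset.univ
  refine ⟨h1, fun φ => ⟨h2 φ, fun v hv t ht => ?_⟩⟩
  have h3 := hv.add_smul hμ₂ hB' (h2 φ) (-1)
  have h4 : φ + (-1 : ℝ) • φ = 0 := by simp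
  rw [h4] at h3
  have h5 := IsSolution.eq_zero hm hμ₁ hμ₂ hB' h3 ht
  rw [neg_one_smul, ← sub_eq_add_neg] at h5
  exact sub_eq_zero.1 h5

/-- The Taylor coefficients of the symbol are the rescaled entries of the universal solution, and
`(A - a I) / r` is a contraction because `ν < r`. -/
theorem localCalc_solFn {X : Type*} [NormedAddCommGroup X] [NormedSpace ℂ X]
    {A : X →ₗ.[ℂ] X} {a : ℂ} {ν : ℝ≥0} [CompleteSpace (ExpSpace (shift A a) ν)] {M : ℝ}
    (hσ : IsLarge σ lam m μ M) (hμ₁ : (m : ℝ) - 1 < μ)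
    {r r' : ℝ} (hr : 0 < r) (hν : (ν : ℝ) < r) (hrr' : r < r') {b : ℝ →ᵇ SummableSeq}
    (hbM : ‖b‖ ≤ M) (hb : ∀ α ∈ Icc 0 ((m : ℝ) - 1), b α = taylorSeq a r (f α))
    (hfa : ∀ α ∈ Icc 0 ((m : ℝ) - 1), AnalyticOnNhd ℂ (f α) (Metric.closedBall a r'))
    {k : ℕ} (hk : (k : ℝ) ≤ m - 1) {t : ℝ} (ht : 0 ≤ t) (φ : ExpSpace (shift A a) ν) :
    localCalc A a ν (solFn m μ lam f k t) φ =
      solution σ (realFamily (calcFamily (scaledRestr (shift A a) ν r)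
        (norm_scaledRestr_le hr hν) b)) lam m μ k φ t := by
  have h := (analyticAt_of_hasSum hr _ fun z hz =>
    hasSum_solutionSeq hσ hμ₁ hr hrr' hbM hb hfa hk ht hz).2
  rw [localCalc_eq_seqCalc hr hν h, seqCalc_solutionSeq hσ hbM]

theorem localCalc_symbol {X : Type*} [NormedAddCommGroup X] [NormedSpace ℂ X]
    {A : X →ₗ.[ℂ] X} {a : ℂ} {ν : ℝ≥0} [CompleteSpace (ExpSpace (shift A a) ν)]
    {r r' : ℝ} (hr : 0 < r) (hν : (ν : ℝ) < r) (hrr' : r < r') {g : ℂ → ℂ}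
    (hg : AnalyticOnNhd ℂ g (Metric.closedBall a r')) (v : ExpSpace (shift A a) ν) :
    localCalc A a ν g v = seqCalc (scaledRestr (shift A a) ν r)
      (norm_scaledRestr_le hr hν) (taylorSeq a r g) v := by
  refine localCalc_eq_seqCalc hr hν (fun n => ?_) v
  have : (r : ℂ) ^ n ≠ 0 := pow_ne_zero _ (by exact_mod_cast hr.ne')
  rw [taylorSeq_apply hr hrr' hg, mul_div_cancel_left₀ _ this]

end Main

end FracCauchy

end

theorem mainTheorem3
    {X : Type*} [NormedAddCommGroup X] [NormedSpace ℂ X] [CompleteSpace X]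
    (A : X →ₗ.[ℂ] X) (hA : A.IsClosed)
    (G : Set ℂ) (hG : IsOpen G)
    (m : ℕ) (hm : 1 ≤ m) (μ : ℝ) (hμ₁ : (m : ℝ) - 1 < μ) (hμ₂ : μ ≤ m)
    (lam : MeasureTheory.Measure ℝ) [MeasureTheory.IsFiniteMeasure lam]
    (f : ℝ → ℂ → ℂ)
    (hf_cont : ContinuousOn (fun p : ℝ × ℂ => f p.1 p.2) (Set.Icc 0 ((m : ℝ) - 1) ×ˢ G))
    (hf_an : ∀ α ∈ Set.Icc (0 : ℝ) ((m : ℝ) - 1), AnalyticOnNhd ℂ (f α) G) :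
    -- the functions `c_β(t, z)` exist
    (∀ z ∈ G, ∀ β : ℝ, β ≤ μ - 1 →
      FracCauchy.IsInverseLaplace (FracCauchy.cTransform m μ lam f β z)
        (fun t => FracCauchy.cFn m μ lam f β t z)) ∧
    -- the functions `S_k(t, z)` exist and are symbols on `G`
    (∀ k : Fin m, ∀ t : ℝ, 0 ≤ t →
      (∀ z ∈ G, MeasureTheory.IntegrableOn
        (fun α => f α z * FracCauchy.cFn m μ lam f (α - (k : ℕ) - 1) t z)
        (Set.Ioc ((k : ℕ) : ℝ) ((m : ℝ) - 1)) lam) ∧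
      AnalyticOnNhd ℂ (FracCauchy.solFn m μ lam f k t) G) ∧
    ∀ {ι : Type} [Fintype ι] (a : ι → ℂ) (ν : ι → NNReal),
      (∀ i, a i ∈ G) →
      (∀ i, (ν i : ENNReal) < Metric.infEDist (a i) (frontier G)) →
      -- `S_k(t, A) φ` solves the problem with data `u⁽ʲ⁾(0) = δ_{jk} φ`
      (∀ (k : Fin m) (φ : FracCauchy.ExpFamily A a ν),
        FracCauchy.IsSolution m μ lam (fun α => FracCauchy.opCalc A a ν (f α))
          (Pi.single k φ)
          (fun t => FracCauchy.opCalc A a ν (FracCauchy.solFn m μ lam f k t) φ)) ∧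
      -- `∑ₖ S_k(t, A) φ_k` is the solution of the problem with data `u⁽ʲ⁾(0) = φ_j`
      (∀ φ : Fin m → FracCauchy.ExpFamily A a ν,
        FracCauchy.IsSolution m μ lam (fun α => FracCauchy.opCalc A a ν (f α)) φ
          (fun t => ∑ k : Fin m,
            FracCauchy.opCalc A a ν (FracCauchy.solFn m μ lam f k t) (φ k)) ∧
        ∀ v : ℝ → FracCauchy.ExpFamily A a ν,
          FracCauchy.IsSolution m μ lam (fun α => FracCauchy.opCalc A a ν (f α)) φ v →
          ∀ t : ℝ, 0 ≤ t → v t = ∑ k : Fin m,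
            FracCauchy.opCalc A a ν (FracCauchy.solFn m μ lam f k t) (φ k)) := by
  have hk : ∀ k : Fin m, ((k : ℕ) : ℝ) ≤ (m : ℝ) - 1 := fun k => by
    have : ((k : ℕ) : ℝ) + 1 ≤ m := by exact_mod_cast k.2
    linarith
  have hm' : (0 : ℝ) ≤ (m : ℝ) - 1 := sub_nonneg.2 (by exact_mod_cast hm)
  refine ⟨fun z hz β hβ => ?_, fun k t ht => ⟨fun z hz => ?_, fun z hz => ?_⟩, ?_⟩
  · obtain ⟨σ, M, r, r', b, hσ, hr, hrr', hbM, hb, hfa⟩ :=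
      FracCauchy.exists_scalarFamily (lam := lam) hG hm hμ₁ hf_cont hf_an hz
    have hzr := Metric.mem_ball_self (x := z) hr
    exact FracCauchy.isInverseLaplace_cFn
      (FracCauchy.norm_volterraOp_lt_one hσ ((FracCauchy.norm_calcFamily_le _
        (FracCauchy.norm_scalarOp_le (FracCauchy.norm_div_le_one hr hzr)) b).trans hbM))
      (FracCauchy.realFamily_scalarOp_apply (FracCauchy.norm_div_le_one hr hzr) b)
      (fun α hα => FracCauchy.calcFamily_scalarOp hr hrr' hzr (hb α hα) (hfa α hα)) hμ₁ hβ
  · obtain ⟨σ, M, r, r', b, hσ, hr, hrr', hbM, hb, hfa⟩ :=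
      FracCauchy.exists_scalarFamily (lam := lam) hG hm hμ₁ hf_cont hf_an hz
    have hzr := Metric.mem_ball_self (x := z) hr
    exact FracCauchy.integrableOn_symbol_mul_cFn
      (FracCauchy.norm_volterraOp_lt_one hσ ((FracCauchy.norm_calcFamily_le _
        (FracCauchy.norm_scalarOp_le (FracCauchy.norm_div_le_one hr hzr)) b).trans hbM))
      (FracCauchy.realFamily_scalarOp_apply (FracCauchy.norm_div_le_one hr hzr) b)
      (fun α hα => FracCauchy.calcFamily_scalarOp hr hrr' hzr (hb α hα) (hfa α hα)) hμ₁ k ht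
  · obtain ⟨σ, M, r, r', b, hσ, hr, hrr', hbM, hb, hfa⟩ :=
      FracCauchy.exists_scalarFamily (lam := lam) hG hm hμ₁ hf_cont hf_an hz
    exact (FracCauchy.analyticAt_of_hasSum hr _ fun w hw =>
      FracCauchy.hasSum_solutionSeq hσ hμ₁ hr hrr' hbM hb hfa (hk k) ht hw).1
  · intro ι _ a ν ha hν
    choose r r' hr hνr hrr' hball using fun i =>
      FracCauchy.exists_closedBall_subset hG (ha i) (hν i)
    choose b hb using fun i => FracCauchy.exists_taylorFamily (hr i) (hrr' i) hm'
      (hf_cont.mono (Set.prod_mono_right (hball i))) fun α hα => (hf_an α hα).mono (hball i)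
    have hfa := fun i α hα => (hf_an α hα).mono (hball i)
    -- The sup norm over the finite index set gives one bound, hence one shift `σ` for all
    -- components.
    have hbM : ∀ i, ‖b i‖ ≤ ‖b‖ := norm_le_pi_norm b
    obtain ⟨σ, hσ⟩ := FracCauchy.exists_isLarge (lam := lam) hμ₁ ‖b‖
    have hcomp : ∀ i, CompleteSpace (FracCauchy.ExpSpace (FracCauchy.shift A (a i)) (ν i)) :=
      fun i => FracCauchy.completeSpace_expSpace (FracCauchy.isClosed_shift hA (a i))
    let Φ := fun i => FracCauchy.calcFamily
      (FracCauchy.scaledRestr (FracCauchy.shift A (a i)) (ν i) (r i))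
      (FracCauchy.norm_scaledRestr_le (hr i) (hνr i)) (b i)
    have hΦ : ∀ i, ‖Φ i‖ ≤ ‖b‖ := fun i => (FracCauchy.norm_calcFamily_le _ _ _).trans (hbM i)
    refine FracCauchy.isSolution_and_unique hm hμ₁ hμ₂ hσ
      (FracCauchy.norm_piFamily_le Φ (norm_nonneg b) hΦ)
      (S := fun k t => FracCauchy.opCalc A a ν (FracCauchy.solFn m μ lam f k t)) ?_ ?_
    · intro α hα v
      funext i
      refine (FracCauchy.localCalc_symbol (hr i) (hνr i) (hrr' i) (hfa i α hα) (v i)).trans ?_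
      rw [← hb i α hα]
      rfl
    · intro k t ht φ
      funext i
      refine (FracCauchy.localCalc_solFn hσ hμ₁ (hr i) (hνr i) (hrr' i) (hbM i) (hb i) (hfa i)
        (hk k) ht (φ i)).trans ?_
      -- Coordinate projections intertwine the diagonal family with its components, so the solution
      -- in the product is formed componentwise.
      exact (FracCauchy.complex_solution_intertwine hσ
        (FracCauchy.norm_piFamily_le Φ (norm_nonneg b) hΦ) (hΦ i)
        (ContinuousLinearMap.proj i) (fun α y => rfl) k φ t).symm
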